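/- Let $n,b$ be nonnegative integers, let $(\epsilon_t)_{t\in\mathbb Z}$ be iid random vectors in $\mathbb R^b$ and let $(\epsilon^*_t)_{t\in\mathbb Z}$ be an independent copy of this sequence. Let $\mathbf R$ be a measurable function and $\mathbf Z_t=(Z_{1t},\dots,Z_{nt})'=\mathbf R(\dots,\epsilon_{t-1},\epsilon_t)\in\mathbb R^n$, $t\in\mathbb Z$. Let $\mathbf Z_{t,\{0\}}$ be obtained from $\mathbf Z_t$ by replacing $\epsilon_0$ by $\epsilon^*_0$ (so $\mathbf Z_{t,\{0\}}=\mathbf Z_t$ for $t<0$). For a real random variable put $\|X\|_p=(E|X|^p)^{1/p}$, and put $\|\mathbf Z_0\|_p=(\sum_{i=1}^n E|Z_{i0}|^p)^{1/p}$ and $$\Theta_{0,p}=\max_{1\le i\le n}\ \sum_{t=0}^\infty \|Z_{it}-Z_{it,\{0\}}\|_p .$$ Let $p\ge 2$ be real and assume $E\mathbf Z_0=0$, $\|\mathbf Z_0\|_p<\infty$ and $\Theta_{0,p}<\infty$. Let $K:\mathbb R\to\mathbb R$ be continuous and even with $K(0)=1$, $\int_{-\infty}^{\infty} K^2(u)\,du<\infty$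 and $\int_{-\infty}^\infty|\hat K(x)|\,dx<\infty$, where $\hat K(x)=\int_{-\infty}^\infty e^{-\imath x u}K(u)\,du$ is the Fourier transform of $K$ (in the $L^2$ sense if $K$ is not integrable). Let $B_T>0$ be real numbers with $1/B_T+B_T/T\to0$ as $T\to\infty$. For $1\le i,j\le n$ and $\lambda\in\mathbb R$ put $$\hat f_{Tij}(\lambda)=\frac1{2\pi}\sum_{u=-T+1}^{T-1}K\Big(\frac u{B_T}\Big)e^{-\imath u\lambda}\,\frac1T\sum_{\substack{1\le t\le T\\ 1\le t+u\le T}}Z_{it}Z_{j,t+u},\qquad f_{ij}(\lambda)=\frac1{2\pi}\sum_{u=-\infty}^\infty e^{-\imath u\lambda}E(Z_{i0}Z_{ju}).$$ Then for all $1\le i,j\le n$ we have $\sum_{u\in\mathbb Z}|E(Z_{i0}Z_{ju})|<\infty$, so that $f_{ij}$ exists, and $$\sup_{\lambda\in\mathbb R}\big\|\hat f_{Tij}(\lambda)-f_{ij}(\lambda)\big\|_{p/2}\to0\qquad(T\to\infty).$$ -/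

import Mathlib

open MeasureTheory ProbabilityTheory Filter Topology
open scoped ENNReal FourierTransform

namespace LagWindow

noncomputable section

/-- The causal process with `Z t = R (…, ε (t - 1), ε t)`. The one-sided history is written as
the sequence `k ↦ ε (t - k)`, `k = 0, 1, 2, …`. -/
def causalProcess {Ω : Type*} {b n : ℕ} (R : (ℕ → Fin b → ℝ) → Fin n → ℝ)
    (ε : ℤ → Ω → Fin b → ℝ) (t : ℤ) (ω : Ω) : Fin n → ℝ :=
  R fun k : ℕ => ε (t - (k : ℤ)) ω

/-- The coupled process `Z_{t,{0}}`: the innovation at time `0` is replaced by an independent copy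
`ε' 0`, all other innovations are kept. -/
def coupledProcess {Ω : Type*} {b n : ℕ} (R : (ℕ → Fin b → ℝ) → Fin n → ℝ)
    (ε ε' : ℤ → Ω → Fin b → ℝ) : ℤ → Ω → Fin n → ℝ :=
  causalProcess R (Function.update ε 0 (ε' 0))

/-- `ε` is an iid sequence and `ε'` is another iid sequence with the same law, the two sequences
being independent of each other. -/
structure IsIIDPair {Ω : Type*} [MeasurableSpace Ω] (P : Measure Ω) {b : ℕ}
    (ε ε' : ℤ → Ω → Fin b → ℝ) : Prop where
  measurable : ∀ t, Measurable (ε t)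
  measurable' : ∀ t, Measurable (ε' t)
  identDistrib : ∀ t, IdentDistrib (ε t) (ε 0) P P
  identDistrib' : ∀ t, IdentDistrib (ε' t) (ε 0) P P
  indep : iIndepFun (Sum.elim ε ε') P

/-- `‖X‖_p = (∑ i, E |X_i|^p)^{1/p}` for a random vector `X`, as an extended real. -/
def vecNorm {Ω : Type*} [MeasurableSpace Ω] (P : Measure Ω) {n : ℕ} (p : ℝ)
    (X : Ω → Fin n → ℝ) : ℝ≥0∞ :=
  (∑ i, ∫⁻ ω, ‖X ω i‖ₑ ^ p ∂P) ^ (1 / p)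

/-- Functional dependence measure `δ_{t,p}^{[i]} = ‖Z_{it} - Z_{it,{0}}‖_p`. -/
def depMeasure {Ω : Type*} [MeasurableSpace Ω] (P : Measure Ω) {b n : ℕ}
    (R : (ℕ → Fin b → ℝ) → Fin n → ℝ) (ε ε' : ℤ → Ω → Fin b → ℝ)
    (p : ℝ) (i : Fin n) (t : ℕ) : ℝ≥0∞ :=
  eLpNorm (fun ω => causalProcess R ε t ω i - coupledProcess R ε ε' t ω i) (ENNReal.ofReal p) P

/-- `Θ_{m,p} = max_i ∑_{t ≥ m} δ_{t,p}^{[i]}`. -/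
def cumDep {Ω : Type*} [MeasurableSpace Ω] (P : Measure Ω) {b n : ℕ}
    (R : (ℕ → Fin b → ℝ) → Fin n → ℝ) (ε ε' : ℤ → Ω → Fin b → ℝ)
    (m : ℕ) (p : ℝ) : ℝ≥0∞ :=
  ⨆ i : Fin n, ∑' t : ℕ, depMeasure P R ε ε' p i (m + t)

/-- The condition on the lag-window kernel: `K(0) = 1`, `K` is continuous and even, `∫ K² < ∞`, and
the (Plancherel) Fourier transform of `K` is absolutely integrable. Mathlib's normalization
`∫ e^{-2π i x u} K(u) du` only rescales the argument of `∫ e^{-i x u} K(u) du`, which does not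
affect integrability. -/
structure IsLagKernel (K : ℝ → ℝ) : Prop where
  map_zero : K 0 = 1
  continuous : Continuous K
  even : Function.Even K
  sq_integrable : Integrable fun u => K u ^ 2
  fourier_integrable : ∃ h : MemLp (fun u => (K u : ℂ)) 2 (volume : Measure ℝ),
    Integrable (𝓕 (h.toLp (fun u => (K u : ℂ))) : Lp ℂ 2 (volume : Measure ℝ))

/-- The `(i,j)` entry of `C(u) = T⁻¹ ∑ Z_t Z_{t+u}'`, the sum over all `t` with both `t` and `t + u`
between `1` and `T`. -/
def sampleAutocov {Ω : Type*} {n : ℕ} (Z : ℤ → Ω → Fin n → ℝ) (T : ℕ) (i j : Fin n) (u : ℤ)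
    (ω : Ω) : ℝ :=
  1 / (T : ℝ) * ∑ t ∈ (Finset.Icc (1 : ℤ) T).filter (fun t => t + u ∈ Finset.Icc (1 : ℤ) T),
    Z t ω i * Z (t + u) ω j

/-- The `(i,j)` entry of the lag-window spectral matrix estimate with kernel `K` and lag-window
size `B`. -/
def specEstimate {Ω : Type*} {n : ℕ} (K : ℝ → ℝ) (B : ℝ) (Z : ℤ → Ω → Fin n → ℝ) (T : ℕ)
    (i j : Fin n) (lam : ℝ) (ω : Ω) : ℂ :=
  1 / (2 * (Real.pi : ℂ)) * ∑ u ∈ Finset.Icc (-(T : ℤ) + 1) ((T : ℤ) - 1),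
    (K ((u : ℝ) / B) : ℂ) * Complex.exp (-(Complex.I * (u : ℂ) * (lam : ℂ))) *
      (sampleAutocov Z T i j u ω : ℂ)

/-- The `(i,j)` entry of the autocovariance matrix `Γ(u) = E (Z_0 Z_u')` (mean zero process). -/
def autocov {Ω : Type*} [MeasurableSpace Ω] (P : Measure Ω) {n : ℕ} (Z : ℤ → Ω → Fin n → ℝ)
    (i j : Fin n) (u : ℤ) : ℝ :=
  ∫ ω, Z 0 ω i * Z u ω j ∂P

/-- The `(i,j)` entry of the spectral density matrix. -/
def specDensity {Ω : Type*} [MeasurableSpace Ω] (P : Measure Ω) {n : ℕ} (Z : ℤ → Ω → Fin n → ℝ)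
    (i j : Fin n) (lam : ℝ) : ℂ :=
  1 / (2 * (Real.pi : ℂ)) *
    ∑' u : ℤ, Complex.exp (-(Complex.I * (u : ℂ) * (lam : ℂ))) * (autocov P Z i j u : ℂ)

end

end LagWindow

namespace LagWindow

section Jensen

variable {α β : Type*} [MeasurableSpace α] [MeasurableSpace β]

theorem lintegral_rpow_le_of_isProbabilityMeasure (μ : Measure α) [IsProbabilityMeasure μ]
    {q : ℝ} (hq : 1 ≤ q) {f : α → ℝ≥0∞} (hf : AEMeasurable f μ) :
    (∫⁻ x, f x ∂μ) ^ q ≤ ∫⁻ x, f x ^ q ∂μ := by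
  have h := eLpNorm'_le_eLpNorm'_of_exponent_le (f := f) (μ := μ) zero_lt_one hq
    hf.aestronglyMeasurable
  rw [eLpNorm', eLpNorm'] at h
  simp only [enorm_eq_self, ENNReal.rpow_one, one_div, inv_one] at h
  calc (∫⁻ x, f x ∂μ) ^ q ≤ ((∫⁻ x, f x ^ q ∂μ) ^ q⁻¹) ^ q := by gcongr
    _ = _ := by rw [← ENNReal.rpow_mul, inv_mul_cancel₀ (by linarith), ENNReal.rpow_one]

theorem eLpNorm_integral_le_eLpNorm_prod (μ : Measure α) [IsProbabilityMeasure μ]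
    (ρ : Measure β) [SFinite ρ] {q : ℝ≥0∞} (hq : 1 ≤ q) (hq' : q ≠ ∞) {F : α × β → ℂ}
    (hF : AEStronglyMeasurable F (μ.prod ρ)) :
    eLpNorm (fun y => ∫ x, F (x, y) ∂μ) q ρ ≤ eLpNorm F q (μ.prod ρ) := by
  have hq0 : q ≠ 0 := (zero_lt_one.trans_le hq).ne'
  have hq1 : 1 ≤ q.toReal := by
    rw [← ENNReal.toReal_one]; exact ENNReal.toReal_mono hq' hq
  rw [eLpNorm_eq_lintegral_rpow_enorm_toReal hq0 hq', eLpNorm_eq_lintegral_rpow_enorm_toReal hq0 hq']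
  gcongr
  rw [lintegral_prod_symm _ (hF.enorm.pow_const _)]
  apply lintegral_mono_ae
  have hs : AEStronglyMeasurable (fun z : β × α => F z.swap) (ρ.prod μ) := hF.prod_swap
  filter_upwards [hs.prodMk_left] with y hy
  calc ‖∫ x, F (x, y) ∂μ‖ₑ ^ q.toReal ≤ (∫⁻ x, ‖F (x, y)‖ₑ ∂μ) ^ q.toReal := by
        gcongr; exact enorm_integral_le_lintegral_enorm _
    _ ≤ _ := lintegral_rpow_le_of_isProbabilityMeasure μ hq1 hy.enorm

end Jensen

section Shift

variable {E : Type*}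

/-- The one-sided shift, forgetting the most recent coordinate. -/
def shift (x : ℕ → E) : ℕ → E := fun k => x (k + 1)

/-- Prepend a coordinate to a one-sided sequence. -/
def cons (z : E) (x : ℕ → E) : ℕ → E := fun k => Nat.casesOn k z x

@[simp] theorem cons_zero (z : E) (x : ℕ → E) : cons z x 0 = z := rfl

@[simp] theorem cons_succ (z : E) (x : ℕ → E) (k : ℕ) : cons z x (k + 1) = x k := rfl

@[simp] theorem shift_cons (z : E) (x : ℕ → E) : shift (cons z x) = x := rfl

theorem shift_iterate_apply (m : ℕ) (x : ℕ → E) (k : ℕ) : shift^[m] x k = x (k + m) := by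
  induction m generalizing x with
  | zero => rfl
  | succ m ih => rw [Function.iterate_succ_apply, ih]; simp [shift, add_assoc]

variable [MeasurableSpace E]

theorem measurable_shift : Measurable (shift : (ℕ → E) → ℕ → E) :=
  measurable_pi_lambda _ fun k => measurable_pi_apply (k + 1)

theorem measurable_cons : Measurable (fun q : E × (ℕ → E) => cons q.1 q.2) := by
  refine measurable_pi_lambda _ fun k => ?_
  cases k with
  | zero => exact measurable_fst
  | succ k => exact (measurable_pi_apply k).comp measurable_snd

/-- The law of an iid sequence with marginal `ν`. -/
noncomputable abbrev iidLaw (ν : Measure E) [IsProbabilityMeasure ν] : Measure (ℕ → E) :=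
  Measure.infinitePi fun _ : ℕ => ν

variable (ν : Measure E) [IsProbabilityMeasure ν]

theorem measurePreserving_cons :
    MeasurePreserving (fun q : E × (ℕ → E) => cons q.1 q.2) (ν.prod (iidLaw ν)) (iidLaw ν) := by
  refine ⟨measurable_cons, ?_⟩
  refine Measure.eq_infinitePi _ fun s t ht => ?_
  classical
  rw [Measure.map_apply measurable_cons (MeasurableSet.pi s.countable_toSet fun i _ => ht i)]
  have hpre : (fun q : E × (ℕ → E) => cons q.1 q.2) ⁻¹' (Set.pi (s : Set ℕ) t)
      = (if 0 ∈ s then t 0 else Set.univ) ×ˢ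
        (Set.pi ((s.filter (0 < ·)).image Nat.pred : Finset ℕ) fun k => t (k + 1)) := by
    ext ⟨z, x⟩
    simp only [Set.mem_preimage, Set.mem_pi, Finset.mem_coe, Set.mem_prod, Finset.mem_image,
      Finset.mem_filter]
    constructor
    · intro h
      refine ⟨?_, ?_⟩
      · split_ifs with h0
        · exact h 0 h0
        · trivial
      · rintro k ⟨m, ⟨hm, hm0⟩, rfl⟩
        obtain ⟨m, rfl⟩ := Nat.exists_eq_succ_of_ne_zero hm0.ne'
        exact h _ hm
    · rintro ⟨h0, h1⟩ k hk
      cases k with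
      | zero => rw [if_pos hk] at h0; exact h0
      | succ k => exact h1 k ⟨k + 1, ⟨hk, Nat.succ_pos k⟩, rfl⟩
  rw [hpre, Measure.prod_prod, Measure.infinitePi_pi _ (fun i _ => ht (i + 1)),
    Finset.prod_image]
  · rw [← Finset.prod_filter_mul_prod_filter_not s (0 < ·), mul_comm]
    congr 1
    · refine Finset.prod_congr rfl fun k hk => ?_
      have : 0 < k := (Finset.mem_filter.1 hk).2
      rw [Nat.pred_eq_sub_one, Nat.sub_add_cancel this]
    · have : s.filter (fun k => ¬ 0 < k) = if 0 ∈ s then {0} else ∅ := by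
        ext k
        by_cases h0 : 0 ∈ s
        · simp [h0]; rintro rfl; exact h0
        · simp [h0]; rintro h rfl; exact h0 h
      rw [this]
      split_ifs <;> simp
  · intro a ha b hb hab
    have ha' : 0 < a := (Finset.mem_filter.1 ha).2
    have hb' : 0 < b := (Finset.mem_filter.1 hb).2
    simp only [Nat.pred_eq_sub_one] at hab
    omega

theorem measurePreserving_shift : MeasurePreserving shift (iidLaw ν) (iidLaw ν) := by
  refine ⟨measurable_shift, ?_⟩
  conv_lhs => rw [← (measurePreserving_cons ν).map_eq]
  rw [Measure.map_map measurable_shift measurable_cons]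
  exact (measurePreserving_snd (μ := ν) (ν := iidLaw ν)).map_eq

theorem measurePreserving_shift_iterate (k : ℕ) :
    MeasurePreserving shift^[k] (iidLaw ν) (iidLaw ν) :=
  (measurePreserving_shift ν).iterate k

end Shift

section Transfer

variable {E : Type*} [MeasurableSpace E]

/-- The transfer operator of the shift: integrate out the most recent coordinate. -/
noncomputable def transfer (ν : Measure E) (f : (ℕ → E) → ℂ) (x : ℕ → E) : ℂ :=
  ∫ z, f (cons z x) ∂ν

variable {ν : Measure E} {f g : (ℕ → E) → ℂ} {q : ℝ≥0∞}

theorem transfer_shift_mul (f g : (ℕ → E) → ℂ) :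
    transfer ν (fun x => f (shift x) * g x) = fun x => f x * transfer ν g x := by
  ext x; simp [transfer, integral_const_mul]

variable [IsProbabilityMeasure ν]

theorem transfer_comp_shift (f : (ℕ → E) → ℂ) : transfer ν (f ∘ shift) = f := by
  ext x; simp [transfer]

theorem aestronglyMeasurable_transfer (hf : AEStronglyMeasurable f (iidLaw ν)) :
    AEStronglyMeasurable (transfer ν f) (iidLaw ν) := by
  have h := (hf.comp_measurePreserving (measurePreserving_cons ν)).prod_swap
  exact h.integral_prod_right'

theorem eLpNorm_transfer_le (hq : 1 ≤ q) (hq' : q ≠ ∞)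
    (hf : AEStronglyMeasurable f (iidLaw ν)) :
    eLpNorm (transfer ν f) q (iidLaw ν) ≤ eLpNorm f q (iidLaw ν) := by
  have hm := measurePreserving_cons ν
  have h := eLpNorm_integral_le_eLpNorm_prod ν (iidLaw ν) hq hq' (hf.comp_measurePreserving hm)
  rw [eLpNorm_comp_measurePreserving hf hm] at h
  exact h

theorem memLp_transfer (hq : 1 ≤ q) (hq' : q ≠ ∞) (hf : MemLp f q (iidLaw ν)) :
    MemLp (transfer ν f) q (iidLaw ν) :=
  ⟨aestronglyMeasurable_transfer hf.1, (eLpNorm_transfer_le hq hq' hf.1).trans_lt hf.2⟩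

theorem transfer_congr (h : f =ᵐ[iidLaw ν] g) : transfer ν f =ᵐ[iidLaw ν] transfer ν g := by
  have h1 := (measurePreserving_cons ν).quasiMeasurePreserving.ae_eq_comp h
  have h2 := Measure.ae_ae_of_ae_prod
    (Measure.measurePreserving_swap.quasiMeasurePreserving.ae_eq_comp h1)
  filter_upwards [h2] with x hx
  exact integral_congr_ae hx

theorem ae_integrable_cons (hf : Integrable f (iidLaw ν)) :
    ∀ᵐ x ∂iidLaw ν, Integrable (fun z => f (cons z x)) ν := by
  have h := ((measurePreserving_cons ν).integrable_comp_of_integrable hf).swap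
  exact h.prod_right_ae

theorem transfer_sub (hf : Integrable f (iidLaw ν)) (hg : Integrable g (iidLaw ν)) :
    transfer ν (f - g) =ᵐ[iidLaw ν] transfer ν f - transfer ν g := by
  filter_upwards [ae_integrable_cons hf, ae_integrable_cons hg] with x h1 h2
  exact integral_sub h1 h2

theorem integral_comp_shift (f : (ℕ → E) → ℂ) (hf : AEStronglyMeasurable f (iidLaw ν)) (k : ℕ) :
    ∫ x, f (shift^[k] x) ∂iidLaw ν = ∫ x, f x ∂iidLaw ν := by
  have hm := measurePreserving_shift_iterate ν k
  conv_rhs => rw [← hm.map_eq]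
  rw [integral_map hm.aemeasurable (by rwa [hm.map_eq])]

theorem integral_transfer (hf : Integrable f (iidLaw ν)) :
    ∫ x, transfer ν f x ∂iidLaw ν = ∫ x, f x ∂iidLaw ν := by
  have hm := measurePreserving_cons ν
  conv_rhs => rw [← hm.map_eq]
  rw [integral_map hm.aemeasurable (by rw [hm.map_eq]; exact hf.1),
    integral_prod_symm (fun q : E × (ℕ → E) => f (cons q.1 q.2))
      (hm.integrable_comp_of_integrable hf)]
  rfl

theorem integral_shift_mul_eq_zero (hg0 : transfer ν g =ᵐ[iidLaw ν] 0)
    (hi : Integrable (fun x => f (shift x) * g x) (iidLaw ν)) :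
    ∫ x, f (shift x) * g x ∂iidLaw ν = 0 := by
  rw [← integral_transfer hi, transfer_shift_mul]
  refine integral_eq_zero_of_ae ?_
  filter_upwards [hg0] with x hx
  simp [hx]

end Transfer

section Pointwise

theorem exp_le_one_add_add_sq_mul_exp_abs (x : ℝ) :
    Real.exp x ≤ 1 + x + x ^ 2 * Real.exp |x| := by
  have h := Complex.norm_exp_sub_sum_le_norm_mul_exp (x : ℂ) 2
  have h2 : Complex.exp (x : ℂ) - ∑ m ∈ Finset.range 2, (x : ℂ) ^ m / (m.factorial : ℂ)
      = ((Real.exp x - (1 + x) : ℝ) : ℂ) := by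
    simp [Finset.sum_range_succ]
  rw [h2, Complex.norm_real, Complex.norm_real, Real.norm_eq_abs, Real.norm_eq_abs, sq_abs] at h
  linarith [le_abs_self (Real.exp x - (1 + x))]

theorem norm_add_rpow_le_of_norm_le {p : ℝ} (hp : 2 ≤ p) {x y : ℂ} (hx : x ≠ 0)
    (h : 2 * ‖y‖ ≤ ‖x‖) :
    ‖x + y‖ ^ p ≤ ‖x‖ ^ p + p * ‖x‖ ^ (p - 2) * (starRingEnd ℂ x * y).re +
      (p / 2 + (p / 2) ^ 2 * (25 / 4) * Real.exp (p / 2 * (5 / 4))) *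
        (‖x‖ ^ (p - 2) * ‖y‖ ^ 2) := by
  have hx0 : 0 < ‖x‖ := norm_pos_iff.2 hx
  set a := ‖x‖ with ha
  set r := ‖y‖ / a with hr
  set s := (starRingEnd ℂ x * y).re with hs
  have hr0 : 0 ≤ r := by positivity
  have hy : ‖y‖ = r * a := by rw [hr]; field_simp
  have hr2 : r ≤ 1 / 2 := by rw [hr, div_le_iff₀ hx0]; linarith
  set v := 2 * (s / a ^ 2) + r ^ 2 with hv
  have hsle : |s| ≤ r * a ^ 2 := by
    refine (Complex.abs_re_le_norm _).trans ?_
    rw [norm_mul, RCLike.norm_conj, hy, ← ha]; nlinarith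
  have hsa : |s / a ^ 2| ≤ r := by
    rw [abs_div, abs_of_pos (by positivity : (0 : ℝ) < a ^ 2), div_le_iff₀ (by positivity)]
    exact hsle
  have hvr : |v| ≤ 5 / 2 * r := by
    calc |v| ≤ |2 * (s / a ^ 2)| + |r ^ 2| := abs_add_le _ _
      _ ≤ 2 * r + r ^ 2 := by
        rw [abs_mul, abs_two, abs_of_nonneg (sq_nonneg r)]; linarith
      _ ≤ _ := by nlinarith
  have hsq : ‖x + y‖ ^ 2 = a ^ 2 * (1 + v) := by
    have h1 : ‖x + y‖ ^ 2 = a ^ 2 + 2 * s + ‖y‖ ^ 2 := by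
      rw [ha, hs, ← Complex.normSq_eq_norm_sq, ← Complex.normSq_eq_norm_sq,
        ← Complex.normSq_eq_norm_sq, Complex.normSq_add]
      simp [Complex.mul_re]; ring
    rw [h1, hy, hv]; field_simp; ring
  have hv1 : 0 ≤ 1 + v := by
    have := abs_le.1 hvr
    nlinarith [sq_nonneg ‖x + y‖, sq_nonneg a, pow_pos hx0 2]
  have hpow : ∀ t : ℝ, 0 ≤ t → t ^ p = (t ^ 2) ^ (p / 2) := fun t ht => by
    rw [← Real.rpow_natCast, ← Real.rpow_mul ht]; congr 1; push_cast; ring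
  have hap : a ^ p = a ^ (p - 2) * a ^ 2 := by
    rw [← Real.rpow_natCast, ← Real.rpow_add hx0]; congr 1; push_cast; ring
  have hexp : (1 + v) ^ (p / 2) ≤ 1 + p / 2 * v +
      (p / 2) ^ 2 * (25 / 4) * Real.exp (p / 2 * (5 / 4)) * r ^ 2 := by
    calc (1 + v) ^ (p / 2) ≤ Real.exp v ^ (p / 2) := by
          apply Real.rpow_le_rpow hv1 _ (by linarith)
          linarith [Real.add_one_le_exp v]
      _ = Real.exp (p / 2 * v) := by rw [← Real.exp_mul, mul_comm]
      _ ≤ 1 + p / 2 * v + (p / 2 * v) ^ 2 * Real.exp |p / 2 * v| :=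
          exp_le_one_add_add_sq_mul_exp_abs _
      _ ≤ 1 + p / 2 * v + ((p / 2) ^ 2 * (25 / 4 * r ^ 2)) * Real.exp (p / 2 * (5 / 4)) := by
          gcongr
          · rw [mul_pow]
            gcongr
            rw [← sq_abs]
            calc |v| ^ 2 ≤ (5 / 2 * r) ^ 2 := by gcongr
              _ = _ := by ring
          · rw [abs_mul, abs_of_nonneg (by linarith : 0 ≤ p / 2)]
            gcongr
            linarith
      _ = _ := by ring
  calc ‖x + y‖ ^ p = (a ^ 2) ^ (p / 2) * (1 + v) ^ (p / 2) := by
        rw [hpow _ (norm_nonneg _), hsq, Real.mul_rpow (by positivity) hv1]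
    _ = a ^ p * (1 + v) ^ (p / 2) := by rw [← hpow a hx0.le]
    _ ≤ a ^ p * (1 + p / 2 * v +
      (p / 2) ^ 2 * (25 / 4) * Real.exp (p / 2 * (5 / 4)) * r ^ 2) := by gcongr
    _ = _ := by
      rw [hap, hy, hv]; field_simp; ring

theorem exists_norm_add_rpow_le {p : ℝ} (hp : 2 ≤ p) : ∃ C : ℝ, 0 ≤ C ∧ ∀ x y : ℂ,
    ‖x + y‖ ^ p ≤ ‖x‖ ^ p + p * ‖x‖ ^ (p - 2) * (starRingEnd ℂ x * y).re +
      C * (‖x‖ ^ (p - 2) * ‖y‖ ^ 2 + ‖y‖ ^ p) := by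
  set C₁ := p / 2 + (p / 2) ^ 2 * (25 / 4) * Real.exp (p / 2 * (5 / 4)) with hC₁
  set C₂ := (3 : ℝ) ^ p + p * 2 ^ (p - 2) * 2 with hC₂
  have h1 : 0 ≤ C₁ := by positivity
  have h2 : 0 ≤ C₂ := by positivity
  refine ⟨C₁ + C₂, by positivity, fun x y => ?_⟩
  by_cases h : 2 * ‖y‖ ≤ ‖x‖ ∧ x ≠ 0
  · refine (norm_add_rpow_le_of_norm_le hp h.2 h.1).trans ?_
    have h3 : 0 ≤ ‖x‖ ^ (p - 2) * ‖y‖ ^ 2 := by positivity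
    have h4 : 0 ≤ ‖y‖ ^ p := by positivity
    rw [← hC₁]
    nlinarith [mul_nonneg h1 h4, mul_nonneg h2 h3, mul_nonneg h2 h4]
  · have hxy : ‖x‖ ≤ 2 * ‖y‖ := by
      by_contra! h5
      refine h ⟨h5.le, ?_⟩
      rintro rfl
      simp only [norm_zero] at h5
      linarith [norm_nonneg y]
    have hyp : ‖y‖ ^ p = ‖y‖ ^ (p - 2) * ‖y‖ ^ 2 := by
      rw [← Real.rpow_natCast, ← Real.rpow_add' (norm_nonneg _) (by push_cast; linarith)]
      congr 1; push_cast; ring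
    have h3 : ‖x + y‖ ^ p ≤ 3 ^ p * ‖y‖ ^ p := by
      rw [← Real.mul_rpow (by norm_num) (norm_nonneg _)]
      apply Real.rpow_le_rpow (norm_nonneg _) _ (by linarith)
      linarith [norm_add_le x y]
    have h4 : |(starRingEnd ℂ x * y).re| ≤ 2 * ‖y‖ ^ 2 := by
      refine (Complex.abs_re_le_norm _).trans ?_
      rw [norm_mul, RCLike.norm_conj]; nlinarith [norm_nonneg y]
    have h5 : ‖x‖ ^ (p - 2) ≤ 2 ^ (p - 2) * ‖y‖ ^ (p - 2) := by
      rw [← Real.mul_rpow (by norm_num) (norm_nonneg _)]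
      exact Real.rpow_le_rpow (norm_nonneg _) hxy (by linarith)
    have h6 : -(p * 2 ^ (p - 2) * 2 * ‖y‖ ^ p) ≤
        p * ‖x‖ ^ (p - 2) * (starRingEnd ℂ x * y).re := by
      rw [neg_le]
      calc -(p * ‖x‖ ^ (p - 2) * (starRingEnd ℂ x * y).re)
          = p * ‖x‖ ^ (p - 2) * -(starRingEnd ℂ x * y).re := by ring
        _ ≤ p * ‖x‖ ^ (p - 2) * (2 * ‖y‖ ^ 2) :=
          mul_le_mul_of_nonneg_left ((neg_le_abs _).trans h4) (by positivity)
        _ ≤ p * (2 ^ (p - 2) * ‖y‖ ^ (p - 2)) * (2 * ‖y‖ ^ 2) := by gcongr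
        _ = _ := by rw [hyp]; ring
    have h7 : 0 ≤ ‖x‖ ^ (p - 2) * ‖y‖ ^ 2 := by positivity
    have h8 : 0 ≤ ‖y‖ ^ p := by positivity
    have h9 : 0 ≤ ‖x‖ ^ p := by positivity
    have h10 : C₂ * ‖y‖ ^ p = 3 ^ p * ‖y‖ ^ p + p * 2 ^ (p - 2) * 2 * ‖y‖ ^ p := by
      rw [hC₂]; ring
    nlinarith [mul_nonneg h1 h7, mul_nonneg h1 h8, mul_nonneg h2 h7]

theorem rpow_add_mul_add_le_rpow {q C : ℝ} (hq : 1 ≤ q) (hC : 0 ≤ C) {s t : ℝ} (hs : 0 ≤ s)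
    (ht : 0 ≤ t) :
    s ^ q + C * (s ^ (q - 1) * t + t ^ q) ≤ (s + (1 + 2 * C) * t) ^ q := by
  have h1 : s ^ q + C * (s ^ (q - 1) * t) ≤ (s + C * t) ^ q := by
    rcases hs.eq_or_lt with rfl | hs
    · rcases hq.eq_or_lt with rfl | hq
      · simp
      · rw [Real.zero_rpow (by linarith), Real.zero_rpow (by linarith)]
        simp only [zero_mul, mul_zero, add_zero]
        positivity
    · have hb := one_add_mul_self_le_rpow_one_add (s := C * t / s)
        (by have : 0 ≤ C * t / s := by positivity
            linarith) hq
      have h2 : s + C * t = s * (1 + C * t / s) := by field_simp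
      rw [h2, Real.mul_rpow hs.le (by positivity)]
      have hsq : s ^ q = s ^ (q - 1) * s := by
        rw [← Real.rpow_add_one hs.ne']; congr 1; ring
      have h3 : s ^ (q - 1) * (C * t) ≤ s ^ (q - 1) * (q * (C * t)) := by
        refine mul_le_mul_of_nonneg_left ?_ (by positivity)
        exact le_mul_of_one_le_left (by positivity) hq
      calc s ^ q + C * (s ^ (q - 1) * t) ≤ s ^ q * (1 + q * (C * t / s)) := by
            have h4 : s ^ q * (1 + q * (C * t / s)) = s ^ q + s ^ (q - 1) * (q * (C * t)) := by
              rw [hsq]; field_simp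
            rw [h4]; nlinarith
        _ ≤ _ := by gcongr
  have h2 : C * t ^ q ≤ ((1 + C) * t) ^ q := by
    rw [Real.mul_rpow (by linarith) ht]
    gcongr
    calc C ≤ 1 + C := by linarith
      _ = (1 + C) ^ (1 : ℝ) := by simp
      _ ≤ (1 + C) ^ q := Real.rpow_le_rpow_of_exponent_le (by linarith) hq
  have h3 := Real.add_rpow_le_rpow_add (a := s + C * t) (b := (1 + C) * t) (by positivity)
    (by positivity) hq
  calc _ ≤ (s + C * t) ^ q + ((1 + C) * t) ^ q := by linarith
    _ ≤ _ := h3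
    _ = _ := by congr 1; ring

end Pointwise

section RealNorm

variable {α : Type*} [MeasurableSpace α] {μ : Measure α} {p : ℝ} {f g : α → ℂ}

/-- The `L^p` norm as a real number. -/
noncomputable def realNorm (μ : Measure α) (p : ℝ) (f : α → ℂ) : ℝ :=
  (eLpNorm f (ENNReal.ofReal p) μ).toReal

theorem realNorm_nonneg : 0 ≤ realNorm μ p f := ENNReal.toReal_nonneg

theorem ofReal_realNorm (hf : MemLp f (ENNReal.ofReal p) μ) :
    ENNReal.ofReal (realNorm μ p f) = eLpNorm f (ENNReal.ofReal p) μ :=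
  ENNReal.ofReal_toReal hf.2.ne

theorem integrable_norm_rpow_of_memLp (hp : 0 < p) (hf : MemLp f (ENNReal.ofReal p) μ) :
    Integrable (fun x => ‖f x‖ ^ p) μ := by
  have h := hf.integrable_norm_rpow (by simpa using hp) ENNReal.ofReal_ne_top
  rwa [ENNReal.toReal_ofReal hp.le] at h

theorem realNorm_rpow (hp : 0 < p) (hf : MemLp f (ENNReal.ofReal p) μ) :
    realNorm μ p f ^ p = ∫ x, ‖f x‖ ^ p ∂μ := by
  have h0 : 0 ≤ ∫ x, ‖f x‖ ^ p ∂μ := integral_nonneg fun x => by positivity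
  rw [realNorm, hf.eLpNorm_eq_integral_rpow_norm (by simpa using hp) ENNReal.ofReal_ne_top,
    ENNReal.toReal_ofReal hp.le, ENNReal.toReal_ofReal (by positivity), ← Real.rpow_mul h0,
    inv_mul_cancel₀ hp.ne', Real.rpow_one]

theorem rpow_mul_rpow_le_add {u v r s : ℝ} (hu : 0 ≤ u) (hv : 0 ≤ v) (hr : 0 ≤ r) (hs : 0 ≤ s)
    (hrs : 0 < r + s) : u ^ r * v ^ s ≤ u ^ (r + s) + v ^ (r + s) := by
  have hu' : 0 ≤ u ^ (r + s) := by positivity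
  have hv' : 0 ≤ v ^ (r + s) := by positivity
  rcases le_total u v with h | h
  · calc u ^ r * v ^ s ≤ v ^ r * v ^ s := by gcongr
      _ = v ^ (r + s) := (Real.rpow_add' hv hrs.ne').symm
      _ ≤ _ := by linarith
  · calc u ^ r * v ^ s ≤ u ^ r * u ^ s := by gcongr
      _ = u ^ (r + s) := (Real.rpow_add' hu hrs.ne').symm
      _ ≤ _ := by linarith

theorem integrable_norm_rpow_mul_rpow {r s : ℝ} (hr : 0 ≤ r) (hs : 0 ≤ s) (hrs : r + s = p)
    (hp : 0 < p) (hf : MemLp f (ENNReal.ofReal p) μ) (hg : MemLp g (ENNReal.ofReal p) μ) :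
    Integrable (fun x => ‖f x‖ ^ r * ‖g x‖ ^ s) μ := by
  refine ((integrable_norm_rpow_of_memLp hp hf).add
    (integrable_norm_rpow_of_memLp hp hg)).mono' ?_ ?_
  · exact ((hf.1.norm.aemeasurable.pow_const r).mul
      (hg.1.norm.aemeasurable.pow_const s)).aestronglyMeasurable
  · filter_upwards with x
    rw [Real.norm_of_nonneg (by positivity)]
    have := rpow_mul_rpow_le_add (norm_nonneg (f x)) (norm_nonneg (g x)) hr hs (by linarith)
    rwa [hrs] at this

theorem integral_norm_rpow_mul_sq_le (hp : 2 ≤ p) (hf : MemLp f (ENNReal.ofReal p) μ)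
    (hg : MemLp g (ENNReal.ofReal p) μ) :
    ∫ x, ‖f x‖ ^ (p - 2) * ‖g x‖ ^ 2 ∂μ ≤ realNorm μ p f ^ (p - 2) * realNorm μ p g ^ 2 := by
  have hp0 : 0 < p := by linarith
  have hI := integrable_norm_rpow_mul_rpow (r := p - 2) (s := 2) (by linarith) (by norm_num)
    (by ring) hp0 hf hg
  simp only [Real.rpow_two] at hI
  have hF := integrable_norm_rpow_of_memLp hp0 hf
  have hG := integrable_norm_rpow_of_memLp hp0 hg
  have h := ENNReal.lintegral_mul_norm_pow_le (μ := μ)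
    (f := fun x => ENNReal.ofReal (‖f x‖ ^ p)) (g := fun x => ENNReal.ofReal (‖g x‖ ^ p))
    hF.1.aemeasurable.ennreal_ofReal hG.1.aemeasurable.ennreal_ofReal
    (p := (p - 2) / p) (q := 2 / p) (div_nonneg (by linarith) hp0.le) (by positivity)
    (by field_simp; ring)
  have e1 : ∀ x, ENNReal.ofReal (‖f x‖ ^ p) ^ ((p - 2) / p) * ENNReal.ofReal (‖g x‖ ^ p) ^ (2 / p)
      = ENNReal.ofReal (‖f x‖ ^ (p - 2) * ‖g x‖ ^ 2) := fun x => by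
    rw [ENNReal.ofReal_rpow_of_nonneg (by positivity) (div_nonneg (by linarith) hp0.le),
      ENNReal.ofReal_rpow_of_nonneg (by positivity) (by positivity),
      ← ENNReal.ofReal_mul (by positivity), ← Real.rpow_mul (norm_nonneg _),
      ← Real.rpow_mul (norm_nonneg _), mul_div_cancel₀ _ hp0.ne', mul_div_cancel₀ _ hp0.ne',
      Real.rpow_two]
  simp only [e1] at h
  rw [← ofReal_integral_eq_lintegral_ofReal hI (ae_of_all _ fun x => by positivity),
    ← ofReal_integral_eq_lintegral_ofReal hF (ae_of_all _ fun x => by positivity),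
    ← ofReal_integral_eq_lintegral_ofReal hG (ae_of_all _ fun x => by positivity),
    ← realNorm_rpow hp0 hf, ← realNorm_rpow hp0 hg,
    ENNReal.ofReal_rpow_of_nonneg (Real.rpow_nonneg realNorm_nonneg _)
      (div_nonneg (by linarith) hp0.le),
    ENNReal.ofReal_rpow_of_nonneg (Real.rpow_nonneg realNorm_nonneg _) (by positivity),
    ← Real.rpow_mul realNorm_nonneg, ← Real.rpow_mul realNorm_nonneg, mul_div_cancel₀ _ hp0.ne',
    mul_div_cancel₀ _ hp0.ne', Real.rpow_two,
    ← ENNReal.ofReal_mul (Real.rpow_nonneg realNorm_nonneg _)] at h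
  exact (ENNReal.ofReal_le_ofReal_iff
    (mul_nonneg (Real.rpow_nonneg realNorm_nonneg _) (sq_nonneg _))).1 h

/-- The weight in the first order expansion of `‖F + e‖ ^ p`. -/
noncomputable def dualWeight (p : ℝ) (z : ℂ) : ℂ := ((‖z‖ ^ (p - 2) : ℝ) : ℂ) * starRingEnd ℂ z

theorem norm_dualWeight_le (hp : 2 ≤ p) (z : ℂ) : ‖dualWeight p z‖ ≤ ‖z‖ ^ (p - 1) := by
  rw [dualWeight, norm_mul, RCLike.norm_conj, Complex.norm_real,
    Real.norm_of_nonneg (by positivity)]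
  apply le_of_eq
  conv_lhs => rw [← Real.rpow_one ‖z‖, ← Real.rpow_mul (norm_nonneg _), one_mul]
  rw [← Real.rpow_add' (norm_nonneg _) (by linarith)]
  congr 1; ring

theorem measurable_dualWeight : Measurable (dualWeight p) := by
  unfold dualWeight
  exact (Complex.measurable_ofReal.comp (measurable_norm.pow_const _)).mul
    RCLike.continuous_conj.measurable

theorem integrable_dualWeight_mul (hp : 2 ≤ p) (hf : MemLp f (ENNReal.ofReal p) μ)
    (hg : MemLp g (ENNReal.ofReal p) μ) :
    Integrable (fun x => dualWeight p (f x) * g x) μ := by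
  have hI := integrable_norm_rpow_mul_rpow (r := p - 1) (s := 1) (by linarith) (by norm_num)
    (by ring) (by linarith) hf hg
  refine hI.mono' ((measurable_dualWeight.comp_aemeasurable
    hf.1.aemeasurable).aestronglyMeasurable.mul hg.1) ?_
  filter_upwards with x
  rw [norm_mul, Real.rpow_one]
  gcongr
  exact norm_dualWeight_le hp _

theorem exists_realNorm_add_sq_le (hp : 2 ≤ p) : ∃ c : ℝ, 0 ≤ c ∧
    ∀ {α : Type*} [MeasurableSpace α] {μ : Measure α} {F e : α → ℂ},
      MemLp F (ENNReal.ofReal p) μ → MemLp e (ENNReal.ofReal p) μ →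
      ∫ x, dualWeight p (F x) * e x ∂μ = 0 →
      realNorm μ p (F + e) ^ 2 ≤ realNorm μ p F ^ 2 + c * realNorm μ p e ^ 2 := by
  obtain ⟨C, hC, hineq⟩ := exists_norm_add_rpow_le hp
  refine ⟨1 + 2 * C, by linarith, fun {α} _ {μ F e} hF he h0 => ?_⟩
  have hp0 : 0 < p := by linarith
  set A := realNorm μ p F with hA
  set b := realNorm μ p e with hb
  have hA0 : 0 ≤ A := realNorm_nonneg
  have hb0 : 0 ≤ b := realNorm_nonneg
  have hIF := integrable_norm_rpow_of_memLp hp0 hF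
  have hIe := integrable_norm_rpow_of_memLp hp0 he
  have hIc := integrable_dualWeight_mul hp hF he
  have hIq := integrable_norm_rpow_mul_rpow (r := p - 2) (s := 2) (by linarith) (by norm_num)
    (by ring) hp0 hF he
  simp only [Real.rpow_two] at hIq
  have hre : ∫ x, (dualWeight p (F x) * e x).re ∂μ = 0 := by
    have h := integral_re hIc
    simp only [RCLike.re_to_complex] at h
    rw [h, h0, Complex.zero_re]
  have hIr : Integrable (fun x => (dualWeight p (F x) * e x).re) μ := hIc.re
  have hI₁ : Integrable (fun x => ‖F x‖ ^ p + p * (dualWeight p (F x) * e x).re) μ :=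
    hIF.add (hIr.const_mul p)
  have hI₂ : Integrable (fun x => ‖F x‖ ^ (p - 2) * ‖e x‖ ^ 2 + ‖e x‖ ^ p) μ := hIq.add hIe
  have hS : realNorm μ p (F + e) ^ p ≤ A ^ p + C * (A ^ (p - 2) * b ^ 2 + b ^ p) := by
    rw [realNorm_rpow hp0 (hF.add he)]
    calc ∫ x, ‖(F + e) x‖ ^ p ∂μ ≤ ∫ x, (‖F x‖ ^ p + p * (dualWeight p (F x) * e x).re
          + C * (‖F x‖ ^ (p - 2) * ‖e x‖ ^ 2 + ‖e x‖ ^ p)) ∂μ := by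
          refine integral_mono_ae (integrable_norm_rpow_of_memLp hp0 (hF.add he))
            (hI₁.add (hI₂.const_mul C)) ?_
          filter_upwards with x
          refine (hineq (F x) (e x)).trans (le_of_eq ?_)
          rw [dualWeight, mul_assoc ((_ : ℝ) : ℂ), Complex.re_ofReal_mul]
          ring
      _ = ∫ x, ‖F x‖ ^ p ∂μ + C * (∫ x, ‖F x‖ ^ (p - 2) * ‖e x‖ ^ 2 ∂μ + ∫ x, ‖e x‖ ^ p ∂μ) := by
          rw [integral_add hI₁ (hI₂.const_mul C),
            integral_add hIF (hIr.const_mul p), integral_const_mul, hre, integral_const_mul,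
            integral_add hIq hIe]
          ring
      _ ≤ _ := by
          rw [← realNorm_rpow hp0 hF, ← realNorm_rpow hp0 he]
          gcongr
          exact integral_norm_rpow_mul_sq_le hp hF he
  have hpow : ∀ t : ℝ, 0 ≤ t → ∀ s : ℝ, (t ^ 2) ^ (s / 2) = t ^ s := fun t ht s => by
    rw [← Real.rpow_natCast, ← Real.rpow_mul ht]; congr 1; push_cast; ring
  have hfin := rpow_add_mul_add_le_rpow (q := p / 2) (by linarith) hC (sq_nonneg A) (sq_nonneg b)
  rw [show p / 2 - 1 = (p - 2) / 2 by ring, hpow A hA0, hpow A hA0, hpow b hb0] at hfin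
  have h2 := hS.trans hfin
  rw [← hpow _ realNorm_nonneg] at h2
  exact (Real.rpow_le_rpow_iff (sq_nonneg _) (by positivity) (by linarith)).1 h2

end RealNorm

section Burkholder

variable {E : Type*} [MeasurableSpace E] {ν : Measure E} [IsProbabilityMeasure ν] {p : ℝ}
  {f : (ℕ → E) → ℂ}

theorem memLp_comp_shift {q : ℝ≥0∞} (hf : MemLp f q (iidLaw ν)) (k : ℕ) :
    MemLp (fun x => f (shift^[k] x)) q (iidLaw ν) :=
  hf.comp_measurePreserving (measurePreserving_shift_iterate ν k)

theorem eLpNorm_comp_shift {q : ℝ≥0∞} (hf : AEStronglyMeasurable f (iidLaw ν)) (k : ℕ) :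
    eLpNorm (fun x => f (shift^[k] x)) q (iidLaw ν) = eLpNorm f q (iidLaw ν) :=
  eLpNorm_comp_measurePreserving hf (measurePreserving_shift_iterate ν k)

/-- Burkholder's inequality for sums of stationary-type martingale differences. -/
theorem exists_realNorm_sum_sq_le (hp : 2 ≤ p) : ∃ c : ℝ, 0 ≤ c ∧
    ∀ (e : ℕ → (ℕ → E) → ℂ), (∀ n, MemLp (e n) (ENNReal.ofReal p) (iidLaw ν)) →
      (∀ n, transfer ν (e n) =ᵐ[iidLaw ν] 0) → ∀ N : ℕ,
      realNorm (iidLaw ν) p (fun x => ∑ n ∈ Finset.range N, e n (shift^[n] x)) ^ 2 ≤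
        c * ∑ n ∈ Finset.range N, realNorm (iidLaw ν) p (e n) ^ 2 := by
  obtain ⟨c, hc, h⟩ := exists_realNorm_add_sq_le hp
  refine ⟨c, hc, fun e he he0 N => ?_⟩
  induction N generalizing e with
  | zero => simp [realNorm, ← Pi.zero_def]
  | succ N ih =>
    set G : (ℕ → E) → ℂ := fun x => ∑ n ∈ Finset.range N, e (n + 1) (shift^[n] x) with hG
    have hGm : MemLp G (ENNReal.ofReal p) (iidLaw ν) :=
      memLp_finsetSum _ fun n _ => memLp_comp_shift (he (n + 1)) n
    have hGs : MemLp (G ∘ shift) (ENNReal.ofReal p) (iidLaw ν) := memLp_comp_shift hGm 1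
    have hsplit : (fun x => ∑ n ∈ Finset.range (N + 1), e n (shift^[n] x)) = G ∘ shift + e 0 := by
      ext x
      rw [Finset.sum_range_succ']
      rfl
    have hz : ∫ x, dualWeight p ((G ∘ shift) x) * e 0 x ∂iidLaw ν = 0 :=
      integral_shift_mul_eq_zero (f := fun x => dualWeight p (G x)) (he0 0)
        (integrable_dualWeight_mul hp hGs (he 0))
    have h1 := h hGs (he 0) hz
    have h2 := ih (fun n => e (n + 1)) (fun n => he (n + 1)) fun n => he0 (n + 1)
    have h3 : realNorm (iidLaw ν) p (G ∘ shift) = realNorm (iidLaw ν) p G := by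
      rw [realNorm, realNorm]; congr 1; exact eLpNorm_comp_shift hGm.1 1
    rw [hsplit, Finset.sum_range_succ', mul_add]
    rw [h3] at h1
    linarith

end Burkholder

section Reindex

variable {E : Type*} [MeasurableSpace E] {ν : Measure E} [IsProbabilityMeasure ν]

theorem map_eq_iidLaw {Ω ι : Type*} [MeasurableSpace Ω] {P : Measure Ω} [IsProbabilityMeasure P]
    {X : ι → Ω → E} (hX : ∀ i, Measurable (X i)) (hlaw : ∀ i, P.map (X i) = ν)
    (hind : iIndepFun X P) {g : ℕ → ι} (hg : Function.Injective g) :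
    P.map (fun ω k => X (g k) ω) = iidLaw ν := by
  rw [(hind.precomp hg).map_fun_eq_infinitePi_map fun k => hX (g k)]
  simp only [hlaw]

theorem measurePreserving_reindex {g : ℕ → ℕ} (hg : Function.Injective g) :
    MeasurePreserving (fun (x : ℕ → E) k => x (g k)) (iidLaw ν) (iidLaw ν) := by
  refine ⟨measurable_pi_lambda _ fun k => measurable_pi_apply (g k), ?_⟩
  refine map_eq_iidLaw (X := fun (k : ℕ) (x : ℕ → E) => x k) (fun k => measurable_pi_apply k)
    (fun k => Measure.infinitePi_map_eval (fun _ : ℕ => ν) k) ?_ hg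
  exact iIndepFun_infinitePi (X := fun _ x => x) fun k => measurable_id

/-- Move the most recent coordinate of the sequence to place `k` of its shift. -/
def replaceAt (k : ℕ) (y : ℕ → E) : ℕ → E := Function.update (shift y) k (y 0)

theorem measurePreserving_replaceAt (k : ℕ) :
    MeasurePreserving (replaceAt k) (iidLaw ν) (iidLaw ν) := by
  have hg : Function.Injective fun j => if j = k then 0 else j + 1 := by
    intro a b hab
    simp only at hab
    split_ifs at hab <;> omega
  have h := measurePreserving_reindex (ν := ν) hg
  have he : (fun (x : ℕ → E) j => x (if j = k then 0 else j + 1)) = replaceAt k := by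
    ext x j
    by_cases hj : j = k
    · subst hj; simp [replaceAt]
    · simp [replaceAt, shift, hj]
  rwa [he] at h

theorem measurePreserving_insertSecond :
    MeasurePreserving (fun q : E × (ℕ → E) => cons (q.2 0) (cons q.1 (shift q.2)))
      (ν.prod (iidLaw ν)) (iidLaw ν) := by
  have hg : Function.Injective (Equiv.swap 0 1 : ℕ → ℕ) := (Equiv.swap 0 1).injective
  have h := (measurePreserving_reindex (ν := ν) hg).comp (measurePreserving_cons ν)
  convert! h using 1
  ext q j
  match j with
  | 0 => simp
  | 1 => simp
  | j + 2 =>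
    have : Equiv.swap 0 1 (j + 2) = j + 2 :=
      Equiv.swap_apply_of_ne_of_ne (by omega) (by omega)
    simp [this, shift]

end Reindex

section Innovations

variable {E : Type*} [MeasurableSpace E] {ν : Measure E}
  {f g : (ℕ → E) → ℂ} {q : ℝ≥0∞}

/-- The component of `f` that is due to the coordinate `k`. -/
noncomputable def innov (ν : Measure E) (k : ℕ) (f : (ℕ → E) → ℂ) (x : ℕ → E) : ℂ :=
  (transfer ν)^[k] f x - (transfer ν)^[k + 1] f (shift x)

theorem sum_innov (f : (ℕ → E) → ℂ) (m : ℕ) (x : ℕ → E) :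
    ∑ k ∈ Finset.range m, innov ν k f (shift^[k] x) = f x - (transfer ν)^[m] f (shift^[m] x) := by
  have h := Finset.sum_range_sub' (fun k => (transfer ν)^[k] f (shift^[k] x)) m
  simp only [Function.iterate_zero, id] at h
  rw [← h]
  refine Finset.sum_congr rfl fun k _ => ?_
  rw [innov, ← Function.iterate_succ_apply' shift]

variable [IsProbabilityMeasure ν]

theorem memLp_iterate_transfer (hq : 1 ≤ q) (hq' : q ≠ ∞) (hf : MemLp f q (iidLaw ν)) (k : ℕ) :
    MemLp ((transfer ν)^[k] f) q (iidLaw ν) := by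
  induction k generalizing f with
  | zero => exact hf
  | succ k ih => exact ih (memLp_transfer hq hq' hf)

theorem eLpNorm_iterate_transfer_le (hq : 1 ≤ q) (hq' : q ≠ ∞) (hf : MemLp f q (iidLaw ν))
    (k : ℕ) : eLpNorm ((transfer ν)^[k] f) q (iidLaw ν) ≤ eLpNorm f q (iidLaw ν) := by
  induction k generalizing f with
  | zero => exact le_rfl
  | succ k ih => exact (ih (memLp_transfer hq hq' hf)).trans (eLpNorm_transfer_le hq hq' hf.1)

theorem iterate_transfer_congr (h : f =ᵐ[iidLaw ν] g) (k : ℕ) :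
    (transfer ν)^[k] f =ᵐ[iidLaw ν] (transfer ν)^[k] g := by
  induction k generalizing f g with
  | zero => exact h
  | succ k ih => exact ih (transfer_congr h)

theorem iterate_transfer_sub (hf : MemLp f 1 (iidLaw ν)) (hg : MemLp g 1 (iidLaw ν)) (k : ℕ) :
    (transfer ν)^[k] (f - g) =ᵐ[iidLaw ν] (transfer ν)^[k] f - (transfer ν)^[k] g := by
  induction k generalizing f g with
  | zero => exact ae_eq_rfl
  | succ k ih =>
    have h1 := transfer_sub (memLp_one_iff_integrable.1 hf) (memLp_one_iff_integrable.1 hg)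
    exact (iterate_transfer_congr h1 k).trans
      (ih (memLp_transfer le_rfl ENNReal.one_ne_top hf) (memLp_transfer le_rfl ENNReal.one_ne_top hg))

theorem memLp_innov (hq : 1 ≤ q) (hq' : q ≠ ∞) (hf : MemLp f q (iidLaw ν)) (k : ℕ) :
    MemLp (innov ν k f) q (iidLaw ν) :=
  (memLp_iterate_transfer hq hq' hf k).sub
    (memLp_comp_shift (memLp_iterate_transfer hq hq' hf (k + 1)) 1)

theorem transfer_innov (hf : MemLp f 1 (iidLaw ν)) (k : ℕ) :
    transfer ν (innov ν k f) =ᵐ[iidLaw ν] 0 := by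
  have h1 := memLp_iterate_transfer le_rfl ENNReal.one_ne_top hf k
  have h2 := memLp_comp_shift
    (memLp_iterate_transfer le_rfl ENNReal.one_ne_top hf (k + 1)) 1
  have h3 := transfer_sub (memLp_one_iff_integrable.1 h1) (memLp_one_iff_integrable.1 h2)
  refine (show transfer ν (innov ν k f) =ᵐ[iidLaw ν] _ from h3).trans ?_
  have h4 : transfer ν (fun x => (transfer ν)^[k + 1] f (shift^[1] x)) = (transfer ν)^[k + 1] f :=
    transfer_comp_shift _
  rw [h4, Function.iterate_succ_apply' (transfer ν), sub_self]

theorem eLpNorm_sub_transfer_shift_le (hq : 1 ≤ q) (hq' : q ≠ ∞) (hf : MemLp f q (iidLaw ν)) :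
    eLpNorm (fun x => f x - transfer ν f (shift x)) q (iidLaw ν) ≤ 2 * eLpNorm f q (iidLaw ν) := by
  have h := memLp_transfer hq hq' hf
  calc _ ≤ eLpNorm f q (iidLaw ν) + eLpNorm (fun x => transfer ν f (shift^[1] x)) q (iidLaw ν) :=
        eLpNorm_sub_le hf.1 (memLp_comp_shift h 1).1 hq
    _ ≤ eLpNorm f q (iidLaw ν) + eLpNorm f q (iidLaw ν) := by
        rw [eLpNorm_comp_shift h.1]; gcongr; exact eLpNorm_transfer_le hq hq' hf.1
    _ = _ := (two_mul _).symm

/-- The change of `f` when the coordinate `k` is replaced by an independent copy, which is stored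
as the most recent coordinate of the argument. -/
def copyDiff (k : ℕ) (f : (ℕ → E) → ℂ) (y : ℕ → E) : ℂ := f (shift y) - f (replaceAt k y)

theorem aestronglyMeasurable_copyDiff (k : ℕ) (hf : AEStronglyMeasurable f (iidLaw ν)) :
    AEStronglyMeasurable (copyDiff k f) (iidLaw ν) :=
  (hf.comp_measurePreserving (measurePreserving_shift ν)).sub
    (hf.comp_measurePreserving (measurePreserving_replaceAt k))

theorem eLpNorm_innov_zero_le (hq : 1 ≤ q) (hq' : q ≠ ∞) (hf : MemLp f q (iidLaw ν)) :
    eLpNorm (innov ν 0 f) q (iidLaw ν) ≤ eLpNorm (copyDiff 0 f) q (iidLaw ν) := by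
  have hm := measurePreserving_cons ν
  have hG := aestronglyMeasurable_copyDiff 0 hf.1
  have h := eLpNorm_integral_le_eLpNorm_prod ν (iidLaw ν) hq hq' (hG.comp_measurePreserving hm)
  rw [eLpNorm_comp_measurePreserving hG hm] at h
  refine le_of_eq_of_le (eLpNorm_congr_ae ?_) h
  have hi : Integrable f (iidLaw ν) := hf.integrable hq
  filter_upwards [(measurePreserving_shift ν).quasiMeasurePreserving.ae (ae_integrable_cons hi)]
    with x hx
  have hc : ∀ z, (copyDiff 0 f ∘ fun q : E × (ℕ → E) => cons q.1 q.2) (z, x)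
      = f x - f (cons z (shift x)) := fun z => by
    have : replaceAt 0 (cons z x) = cons z (shift x) := by
      ext j; cases j <;> simp [replaceAt, shift]
    simp [copyDiff, this]
  simp only [hc]
  rw [integral_sub (integrable_const _) hx]
  simp [innov, transfer]

theorem eLpNorm_copyDiff_transfer_le (hq : 1 ≤ q) (hq' : q ≠ ∞) (hf : MemLp f q (iidLaw ν))
    (k : ℕ) : eLpNorm (copyDiff k (transfer ν f)) q (iidLaw ν) ≤
      eLpNorm (copyDiff (k + 1) f) q (iidLaw ν) := by
  have hm := measurePreserving_insertSecond (ν := ν)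
  have hG := aestronglyMeasurable_copyDiff (k + 1) hf.1
  have h := eLpNorm_integral_le_eLpNorm_prod ν (iidLaw ν) hq hq' (hG.comp_measurePreserving hm)
  rw [eLpNorm_comp_measurePreserving hG hm] at h
  refine le_of_eq_of_le (eLpNorm_congr_ae ?_) h
  have hi : Integrable f (iidLaw ν) := hf.integrable hq
  filter_upwards [(measurePreserving_shift ν).quasiMeasurePreserving.ae (ae_integrable_cons hi),
    (measurePreserving_replaceAt k).quasiMeasurePreserving.ae (ae_integrable_cons hi)]
    with x hx hx'
  have hc : ∀ z, (copyDiff (k + 1) f ∘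
      fun q : E × (ℕ → E) => cons (q.2 0) (cons q.1 (shift q.2))) (z, x)
      = f (cons z (shift x)) - f (cons z (replaceAt k x)) := fun z => by
    have : replaceAt (k + 1) (cons (x 0) (cons z (shift x))) = cons z (replaceAt k x) := by
      ext j
      cases j with
      | zero => simp [replaceAt]
      | succ j =>
        by_cases hj : j = k
        · subst hj; simp [replaceAt]
        · simp [replaceAt, hj]
    simp [copyDiff, this]
  simp only [hc]
  rw [integral_sub hx hx']
  rfl

/-- The innovations are dominated by the functional dependence measure. -/
theorem eLpNorm_innov_le (hq : 1 ≤ q) (hq' : q ≠ ∞) (hf : MemLp f q (iidLaw ν)) (k : ℕ) :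
    eLpNorm (innov ν k f) q (iidLaw ν) ≤ eLpNorm (copyDiff k f) q (iidLaw ν) := by
  induction k generalizing f with
  | zero => exact eLpNorm_innov_zero_le hq hq' hf
  | succ k ih =>
    exact (ih (memLp_transfer hq hq' hf)).trans (eLpNorm_copyDiff_transfer_le hq hq' hf k)

end Innovations

section Cylinder

variable {E : Type*} [MeasurableSpace E] {ν : Measure E} [IsProbabilityMeasure ν]
  {f g : (ℕ → E) → ℂ} {q : ℝ≥0∞} {N M : ℕ}

/-- Bounded measurable functions of the first `N` coordinates. -/
structure IsBoundedCylinder (N : ℕ) (f : (ℕ → E) → ℂ) : Prop where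
  measurable : Measurable f
  bounded : ∃ C : ℝ, ∀ x, ‖f x‖ ≤ C
  congr : ∀ x y : ℕ → E, (∀ k < N, x k = y k) → f x = f y

namespace IsBoundedCylinder

theorem memLp (hf : IsBoundedCylinder N f) : MemLp f q (iidLaw ν) := by
  obtain ⟨C, hC⟩ := hf.bounded
  exact MemLp.of_bound hf.measurable.aestronglyMeasurable C (ae_of_all _ hC)

theorem const (c : ℂ) : IsBoundedCylinder N fun _ : ℕ → E => c :=
  ⟨measurable_const, ⟨‖c‖, fun _ => le_rfl⟩, fun _ _ _ => rfl⟩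

theorem add (hf : IsBoundedCylinder N f) (hg : IsBoundedCylinder M g) :
    IsBoundedCylinder (max N M) (f + g) := by
  obtain ⟨C, hC⟩ := hf.bounded
  obtain ⟨D, hD⟩ := hg.bounded
  refine ⟨hf.1.add hg.1, ⟨C + D, fun x => (norm_add_le _ _).trans (add_le_add (hC x) (hD x))⟩,
    fun x y h => ?_⟩
  simp only [Pi.add_apply]
  rw [hf.3 x y fun k hk => h k (lt_max_of_lt_left hk),
    hg.3 x y fun k hk => h k (lt_max_of_lt_right hk)]

theorem mul (hf : IsBoundedCylinder N f) (hg : IsBoundedCylinder M g) :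
    IsBoundedCylinder (max N M) (fun x => f x * g x) := by
  obtain ⟨C, hC⟩ := hf.bounded
  obtain ⟨D, hD⟩ := hg.bounded
  refine ⟨hf.1.mul hg.1, ⟨C * D, fun x => ?_⟩, fun x y h => ?_⟩
  · rw [norm_mul]
    exact mul_le_mul (hC x) (hD x) (norm_nonneg _) ((norm_nonneg _).trans (hC x))
  · rw [hf.3 x y fun k hk => h k (lt_max_of_lt_left hk),
      hg.3 x y fun k hk => h k (lt_max_of_lt_right hk)]

theorem sub (hf : IsBoundedCylinder N f) (hg : IsBoundedCylinder M g) :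
    IsBoundedCylinder (max N M) (fun x => f x - g x) := by
  have h := hf.add ((IsBoundedCylinder.const (E := E) (N := M) (-1)).mul hg)
  rw [max_self] at h
  convert! h using 1
  ext x; simp [sub_eq_add_neg]

theorem comp_shift (hf : IsBoundedCylinder N f) :
    IsBoundedCylinder (N + 1) (fun x => f (shift x)) := by
  obtain ⟨C, hC⟩ := hf.bounded
  exact ⟨hf.1.comp measurable_shift, ⟨C, fun x => hC _⟩,
    fun x y h => hf.3 _ _ fun k hk => h (k + 1) (by omega)⟩

theorem transfer (hf : IsBoundedCylinder N f) : IsBoundedCylinder (N - 1) (transfer ν f) := by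
  obtain ⟨C, hC⟩ := hf.bounded
  refine ⟨?_, ⟨C, fun x => ?_⟩, fun x y h => ?_⟩
  · have h := (hf.measurable.comp measurable_cons).stronglyMeasurable
    exact (h.integral_prod_left' (μ := ν)).measurable
  · refine (norm_integral_le_of_norm_le_const (ae_of_all _ fun z => hC (cons z x))).trans ?_
    simp
  · refine integral_congr_ae (ae_of_all _ fun z => hf.3 _ _ fun k hk => ?_)
    cases k with
    | zero => rfl
    | succ k => exact h k (by omega)

theorem iterate_transfer (hf : IsBoundedCylinder N f) (k : ℕ) :
    IsBoundedCylinder (N - k) ((LagWindow.transfer ν)^[k] f) := by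
  induction k with
  | zero => exact hf
  | succ k ih =>
    rw [Function.iterate_succ_apply', Nat.sub_succ]
    exact ih.transfer

theorem integral_iterate_transfer (hf : MemLp f 1 (iidLaw ν)) (k : ℕ) :
    ∫ x, (LagWindow.transfer ν)^[k] f x ∂iidLaw ν = ∫ x, f x ∂iidLaw ν := by
  induction k with
  | zero => rfl
  | succ k ih =>
    rw [Function.iterate_succ_apply', integral_transfer, ih]
    exact memLp_one_iff_integrable.1 (memLp_iterate_transfer le_rfl ENNReal.one_ne_top hf k)

theorem iterate_transfer_eq_integral (hf : IsBoundedCylinder N f) {k : ℕ} (hk : N ≤ k)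
    (x : ℕ → E) : (LagWindow.transfer ν)^[k] f x = ∫ y, f y ∂iidLaw ν := by
  have h := hf.iterate_transfer (ν := ν) k
  rw [Nat.sub_eq_zero_of_le hk] at h
  rw [← integral_iterate_transfer hf.memLp k]
  have h' : ∀ y, (LagWindow.transfer ν)^[k] f y = (LagWindow.transfer ν)^[k] f x :=
    fun y => h.3 y x fun k hk => by omega
  simp [h']

end IsBoundedCylinder

theorem exists_isBoundedCylinder_eLpNorm_sub_le (hq : q ≠ ∞) (hf : MemLp f q (iidLaw ν))
    {ε : ℝ≥0∞} (hε : ε ≠ 0) :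
    ∃ g N, eLpNorm (f - g) q (iidLaw ν) ≤ ε ∧ IsBoundedCylinder N g := by
  have ha : IsSetAlgebra (measurableCylinders fun _ : ℕ => E) :=
    ⟨empty_mem_measurableCylinders _, fun _ => compl_mem_measurableCylinders,
      fun _ _ => union_mem_measurableCylinders⟩
  have hd : (iidLaw ν).MeasureDense (measurableCylinders fun _ : ℕ => E) :=
    Measure.MeasureDense.of_generateFrom_isSetAlgebra_finite _ ha
      generateFrom_measurableCylinders.symm
  have key : ∃ g, eLpNorm (f - g) q (iidLaw ν) ≤ ε ∧ ∃ N, IsBoundedCylinder N g := by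
    refine hf.induction_dense hq (fun g => ∃ N, IsBoundedCylinder N g) ?_ ?_ ?_ hε
    · intro c s hs _ ε hε
      obtain ⟨η, hη, h⟩ := exists_eLpNorm_indicator_le hq c hε (μ := iidLaw ν)
      obtain ⟨t, ht, hst⟩ := hd.approx s hs (measure_ne_top _ _) η hη
      refine ⟨t.indicator fun _ => c, ?_, ?_⟩
      · rw [eLpNorm_indicator_sub_indicator]
        apply h
        rw [symmDiff_comm]
        simpa using hst.le
      · obtain ⟨I, S, hS, rfl⟩ := (mem_measurableCylinders t).1 ht
        refine ⟨I.sup id + 1, measurable_const.indicator (hS.cylinder _), ⟨‖c‖, fun x =>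
          norm_indicator_le_norm_self _ _⟩, fun x y hxy => ?_⟩
        have hr : I.restrict x = I.restrict y := by
          ext ⟨i, hi⟩
          exact hxy i (Nat.lt_succ_of_le (Finset.le_sup (f := id) hi))
        have hxy' : x ∈ cylinder I S ↔ y ∈ cylinder I S := by
          rw [mem_cylinder, mem_cylinder, hr]
        by_cases hx : x ∈ cylinder I S
        · rw [Set.indicator_of_mem hx, Set.indicator_of_mem (hxy'.1 hx)]
        · rw [Set.indicator_of_notMem hx, Set.indicator_of_notMem fun h => hx (hxy'.2 h)]
    · rintro f g ⟨N, hf⟩ ⟨M, hg⟩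
      exact ⟨_, hf.add hg⟩
    · rintro f ⟨N, hf⟩
      exact hf.measurable.aestronglyMeasurable
  obtain ⟨g, hg, N, hN⟩ := key
  exact ⟨g, N, hg, hN⟩

theorem exists_isBoundedCylinder_transfer_eq_zero (hq : 1 ≤ q) (hq' : q ≠ ∞)
    (hf : MemLp f q (iidLaw ν)) (hf0 : transfer ν f =ᵐ[iidLaw ν] 0) {ε : ℝ≥0∞} (hε : ε ≠ 0) :
    ∃ g N, eLpNorm (f - g) q (iidLaw ν) ≤ ε ∧ IsBoundedCylinder N g ∧
      transfer ν g =ᵐ[iidLaw ν] 0 := by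
  obtain ⟨h, N, hfh, hh⟩ := exists_isBoundedCylinder_eLpNorm_sub_le hq' hf
    (ENNReal.div_pos hε ENNReal.ofNat_ne_top : 0 < ε / 2).ne'
  have hhm : MemLp h q (iidLaw ν) := hh.memLp
  refine ⟨fun x => h x - transfer ν h (shift x), _, ?_, hh.sub hh.transfer.comp_shift, ?_⟩
  · have h1 := transfer_sub (hf.integrable hq) (hhm.integrable hq)
    have h2 := eLpNorm_sub_transfer_shift_le hq hq' (hf.sub hhm)
    calc _ = eLpNorm (fun x => (f - h) x - transfer ν (f - h) (shift x)) q (iidLaw ν) := by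
          refine eLpNorm_congr_ae ?_
          filter_upwards [(measurePreserving_shift ν).quasiMeasurePreserving.ae h1,
            (measurePreserving_shift ν).quasiMeasurePreserving.ae hf0] with x hx hx'
          simp only [Pi.sub_apply] at hx ⊢
          rw [hx, hx', Pi.zero_apply]
          ring
      _ ≤ 2 * eLpNorm (f - h) q (iidLaw ν) := h2
      _ ≤ 2 * (ε / 2) := by gcongr
      _ = ε := ENNReal.mul_div_cancel (by norm_num) ENNReal.ofNat_ne_top
  · exact transfer_innov (k := 0) hh.memLp

theorem tendsto_eLpNorm_iterate_transfer (hq : 1 ≤ q) (hq' : q ≠ ∞) (hf : MemLp f q (iidLaw ν))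
    (hf0 : ∫ x, f x ∂iidLaw ν = 0) :
    Tendsto (fun m => eLpNorm ((transfer ν)^[m] f) q (iidLaw ν)) atTop (𝓝 0) := by
  rw [ENNReal.tendsto_atTop_zero]
  intro ε hε
  obtain ⟨h, N, hfh, hh⟩ := exists_isBoundedCylinder_eLpNorm_sub_le hq' hf
    (ENNReal.div_pos hε.ne' ENNReal.ofNat_ne_top : 0 < ε / 2).ne'
  have hhm : MemLp h q (iidLaw ν) := hh.memLp
  refine ⟨N, fun m hm => ?_⟩
  set c := ∫ y, h y ∂iidLaw ν with hc
  have hcle : ‖c‖ₑ ≤ ε / 2 := by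
    have h1 : c = -∫ y, (f - h) y ∂iidLaw ν := by
      have := integral_sub (hf.integrable hq) (hhm.integrable hq)
      simp only [Pi.sub_apply]
      rw [this, hf0, zero_sub, neg_neg]
    rw [h1, enorm_neg]
    refine (enorm_integral_le_lintegral_enorm _).trans ?_
    rw [← eLpNorm_one_eq_lintegral_enorm]
    exact (eLpNorm_le_eLpNorm_of_exponent_le hq (hf.sub hhm).1).trans hfh
  have h2 := iterate_transfer_sub (hf.mono_exponent hq) (hhm.mono_exponent hq) m
  have h3 : (transfer ν)^[m] f =ᵐ[iidLaw ν] (transfer ν)^[m] (f - h) + fun _ => c := by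
    filter_upwards [h2] with x hx
    rw [Pi.add_apply, hx, Pi.sub_apply, hh.iterate_transfer_eq_integral hm]
    ring
  calc _ = _ := eLpNorm_congr_ae h3
    _ ≤ eLpNorm ((transfer ν)^[m] (f - h)) q (iidLaw ν) + eLpNorm (fun _ => c) q (iidLaw ν) :=
        eLpNorm_add_le (memLp_iterate_transfer hq hq' (hf.sub hhm) m).1
          aestronglyMeasurable_const hq
    _ ≤ ε / 2 + ε / 2 := by
        gcongr
        · exact (eLpNorm_iterate_transfer_le hq hq' (hf.sub hhm) m).trans hfh
        · rw [eLpNorm_const c (zero_lt_one.trans_le hq).ne' (IsProbabilityMeasure.ne_zero _)]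
          simpa using hcle
    _ = ε := ENNReal.add_halves ε

end Cylinder

section Minkowski

variable {α β : Type*} [MeasurableSpace α] [MeasurableSpace β]

theorem eLpNorm_integral_mul_le {μ : Measure α} [SFinite μ] {ρ : Measure β} [SFinite ρ]
    {q : ℝ≥0∞} (hq : 1 ≤ q) (hq' : q ≠ ∞) {κ : α → ℂ} (hκ : AEStronglyMeasurable κ μ)
    {F : α × β → ℂ} (hF : AEStronglyMeasurable F (μ.prod ρ)) {M : ℝ≥0∞}
    (hM : ∀ x, eLpNorm (fun y => F (x, y)) q ρ ≤ M) :
    eLpNorm (fun y => ∫ x, κ x * F (x, y) ∂μ) q ρ ≤ (∫⁻ x, ‖κ x‖ₑ ∂μ) * M := by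
  have hq0 : q ≠ 0 := (zero_lt_one.trans_le hq).ne'
  have hr1 : 1 ≤ q.toReal := by
    rw [← ENNReal.toReal_one]; exact ENNReal.toReal_mono hq' hq
  set r := q.toReal with hr
  have hr0 : 0 < r := by linarith
  have hM' : ∀ x, ∫⁻ y, ‖F (x, y)‖ₑ ^ r ∂ρ ≤ M ^ r := fun x => by
    have h := hM x
    rw [eLpNorm_eq_lintegral_rpow_enorm_toReal hq0 hq', one_div, ← hr] at h
    calc _ = ((∫⁻ y, ‖F (x, y)‖ₑ ^ r ∂ρ) ^ r⁻¹) ^ r := by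
          rw [← ENNReal.rpow_mul, inv_mul_cancel₀ hr0.ne', ENNReal.rpow_one]
      _ ≤ M ^ r := by gcongr
  set I := ∫⁻ x, ‖κ x‖ₑ ∂μ with hI
  have hs : AEStronglyMeasurable (fun z : β × α => F z.swap) (ρ.prod μ) := hF.prod_swap
  have hpt : ∀ᵐ y ∂ρ, ‖∫ x, κ x * F (x, y) ∂μ‖ₑ ^ r ≤
      I ^ (r - 1) * ∫⁻ x, ‖κ x‖ₑ * ‖F (x, y)‖ₑ ^ r ∂μ := by
    filter_upwards [hs.prodMk_left] with y hy
    have hy' : AEMeasurable (fun x => ‖F (x, y)‖ₑ) μ := hy.enorm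
    have h1 := ENNReal.lintegral_mul_norm_pow_le (μ := μ) (f := fun x => ‖κ x‖ₑ)
      (g := fun x => ‖κ x‖ₑ * ‖F (x, y)‖ₑ ^ r) hκ.enorm (hκ.enorm.mul (hy'.pow_const r))
      (p := 1 - r⁻¹) (q := r⁻¹) (sub_nonneg.2 (inv_le_one_of_one_le₀ hr1)) (by positivity)
      (by ring)
    have h2 : ∀ x, ‖κ x * F (x, y)‖ₑ =
        ‖κ x‖ₑ ^ (1 - r⁻¹) * (‖κ x‖ₑ * ‖F (x, y)‖ₑ ^ r) ^ r⁻¹ := fun x => by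
      rw [ENNReal.mul_rpow_of_nonneg _ _ (by positivity), ← mul_assoc,
        ← ENNReal.rpow_add_of_nonneg _ _ (sub_nonneg.2 (inv_le_one_of_one_le₀ hr1))
          (by positivity), sub_add_cancel, ENNReal.rpow_one, ← ENNReal.rpow_mul,
        mul_inv_cancel₀ hr0.ne', ENNReal.rpow_one, enorm_mul]
    calc ‖∫ x, κ x * F (x, y) ∂μ‖ₑ ^ r ≤ (∫⁻ x, ‖κ x * F (x, y)‖ₑ ∂μ) ^ r := by
          gcongr; exact enorm_integral_le_lintegral_enorm _
      _ ≤ (I ^ (1 - r⁻¹) * (∫⁻ x, ‖κ x‖ₑ * ‖F (x, y)‖ₑ ^ r ∂μ) ^ r⁻¹) ^ r := by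
          simp only [h2]; gcongr
      _ = _ := by
          rw [ENNReal.mul_rpow_of_nonneg _ _ hr0.le, ← ENNReal.rpow_mul, ← ENNReal.rpow_mul,
            inv_mul_cancel₀ hr0.ne', ENNReal.rpow_one]
          congr 2
          field_simp
  rw [eLpNorm_eq_lintegral_rpow_enorm_toReal hq0 hq', one_div, ← hr]
  have hmeas : AEMeasurable (fun z : α × β => ‖κ z.1‖ₑ * ‖F z‖ₑ ^ r) (μ.prod ρ) :=
    hκ.enorm.comp_fst.mul (hF.enorm.pow_const r)
  have hmain : ∫⁻ y, ‖∫ x, κ x * F (x, y) ∂μ‖ₑ ^ r ∂ρ ≤ (I * M) ^ r := by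
    calc _ ≤ ∫⁻ y, I ^ (r - 1) * ∫⁻ x, ‖κ x‖ₑ * ‖F (x, y)‖ₑ ^ r ∂μ ∂ρ := lintegral_mono_ae hpt
      _ = I ^ (r - 1) * ∫⁻ y, ∫⁻ x, ‖κ x‖ₑ * ‖F (x, y)‖ₑ ^ r ∂μ ∂ρ :=
          lintegral_const_mul'' _ hmeas.lintegral_prod_left'
      _ = I ^ (r - 1) * ∫⁻ x, ∫⁻ y, ‖κ x‖ₑ * ‖F (x, y)‖ₑ ^ r ∂ρ ∂μ := by
          rw [lintegral_lintegral_swap (f := fun x y => ‖κ x‖ₑ * ‖F (x, y)‖ₑ ^ r) hmeas]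
      _ ≤ I ^ (r - 1) * ∫⁻ x, ‖κ x‖ₑ * M ^ r ∂μ := by
          gcongr with x
          rw [lintegral_const_mul' _ _ enorm_ne_top]
          gcongr
          exact hM' x
      _ = I ^ (r - 1) * (I * M ^ r) := by rw [lintegral_mul_const'' _ hκ.enorm]
      _ = (I * M) ^ r := by
          rw [ENNReal.mul_rpow_of_nonneg _ _ hr0.le, ← mul_assoc]
          congr 1
          conv_lhs => rw [← ENNReal.rpow_one I, ← ENNReal.rpow_mul, one_mul]
          rw [← ENNReal.rpow_add_of_nonneg _ _ (by linarith) zero_le_one, sub_add_cancel]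
  calc _ ≤ ((I * M) ^ r) ^ r⁻¹ := by gcongr
    _ = _ := by rw [← ENNReal.rpow_mul, mul_inv_cancel₀ hr0.ne', ENNReal.rpow_one]

end Minkowski

section Sums

theorem sum_range_add_eq_sum_ite {M : Type*} [AddCommMonoid M] {T k N : ℕ} (h : T + k ≤ N)
    (F : ℕ → M) : ∑ a ∈ Finset.range T, F (a + k) =
      ∑ n ∈ Finset.range N, if k ≤ n ∧ n < k + T then F n else 0 := by
  rw [← Finset.sum_filter]
  refine Finset.sum_bij' (fun a _ => a + k) (fun n _ => n - k) ?_ ?_ ?_ ?_ ?_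
  · intro a ha
    simp only [Finset.mem_range, Finset.mem_filter] at ha ⊢
    omega
  · intro n hn
    simp only [Finset.mem_range, Finset.mem_filter] at hn ⊢
    omega
  · intro a _; simp
  · intro n hn
    simp only [Finset.mem_range, Finset.mem_filter] at hn ⊢
    omega
  · intro a _; rfl

end Sums

section Martingale

variable {E : Type*} [MeasurableSpace E] {ν : Measure E} [IsProbabilityMeasure ν] {p c : ℝ}
  {d d' f g : (ℕ → E) → ℂ}

/-- `c` is an admissible constant in the `L^p` Burkholder inequality. -/
def IsBurkholderConst (ν : Measure E) [IsProbabilityMeasure ν] (p c : ℝ) : Prop :=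
  0 ≤ c ∧ ∀ (e : ℕ → (ℕ → E) → ℂ), (∀ n, MemLp (e n) (ENNReal.ofReal p) (iidLaw ν)) →
    (∀ n, transfer ν (e n) =ᵐ[iidLaw ν] 0) → ∀ N : ℕ,
    realNorm (iidLaw ν) p (fun x => ∑ n ∈ Finset.range N, e n (shift^[n] x)) ^ 2 ≤
      c * ∑ n ∈ Finset.range N, realNorm (iidLaw ν) p (e n) ^ 2

/-- Martingale differences in `L^p`. -/
def IsMartingaleDiff (ν : Measure E) [IsProbabilityMeasure ν] (p : ℝ) (d : (ℕ → E) → ℂ) : Prop :=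
  MemLp d (ENNReal.ofReal p) (iidLaw ν) ∧ transfer ν d =ᵐ[iidLaw ν] 0

theorem realNorm_const_mul (a : ℂ) (d : (ℕ → E) → ℂ) :
    realNorm (iidLaw ν) p (fun x => a * d x) = ‖a‖ * realNorm (iidLaw ν) p d := by
  rw [realNorm, realNorm]
  have h := eLpNorm_const_smul a d (ENNReal.ofReal p) (iidLaw ν)
  have h2 : (fun x => a * d x) = a • d := rfl
  rw [h2, h, ENNReal.toReal_mul, toReal_enorm]

theorem IsMartingaleDiff.const_mul (hd : IsMartingaleDiff ν p d) (a : ℂ) :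
    IsMartingaleDiff ν p (fun x => a * d x) := by
  refine ⟨hd.1.const_mul a, ?_⟩
  filter_upwards [hd.2] with x hx
  have : transfer ν (fun x => a * d x) x = a * transfer ν d x := integral_const_mul _ _
  rw [this, hx]; simp

theorem IsBurkholderConst.realNorm_sum_le (hc : IsBurkholderConst ν p c)
    (hd : IsMartingaleDiff ν p d) (a : ℕ → ℂ) (N : ℕ) :
    realNorm (iidLaw ν) p (fun x => ∑ n ∈ Finset.range N, a n * d (shift^[n] x)) ^ 2 ≤
      c * (∑ n ∈ Finset.range N, ‖a n‖ ^ 2) * realNorm (iidLaw ν) p d ^ 2 := by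
  refine (hc.2 (fun n x => a n * d x) (fun n => (hd.const_mul (a n)).1)
    (fun n => (hd.const_mul (a n)).2) N).trans (le_of_eq ?_)
  rw [mul_assoc, Finset.sum_mul]
  congr 1
  refine Finset.sum_congr rfl fun n _ => ?_
  rw [realNorm_const_mul, mul_pow]

theorem memLp_sum_shift {q : ℝ≥0∞} (hd : MemLp d q (iidLaw ν)) (a : ℕ → ℂ) (N k : ℕ) :
    MemLp (fun x => ∑ n ∈ Finset.range N, a n * d (shift^[n + k] x)) q (iidLaw ν) :=
  memLp_finsetSum _ fun n _ => (memLp_comp_shift hd (n + k)).const_mul (a n)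

theorem IsBurkholderConst.eLpNorm_sum_le (hc : IsBurkholderConst ν p c)
    (hd : IsMartingaleDiff ν p d) (a : ℕ → ℂ) (N k : ℕ) :
    eLpNorm (fun x => ∑ n ∈ Finset.range N, a n * d (shift^[n + k] x)) (ENNReal.ofReal p)
      (iidLaw ν) ≤ ENNReal.ofReal √(c * ∑ n ∈ Finset.range N, ‖a n‖ ^ 2) *
        eLpNorm d (ENNReal.ofReal p) (iidLaw ν) := by
  have h0 := memLp_sum_shift hd.1 a N 0
  have h1 : (fun x => ∑ n ∈ Finset.range N, a n * d (shift^[n + k] x)) = fun x =>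
      (fun y => ∑ n ∈ Finset.range N, a n * d (shift^[n + 0] y)) (shift^[k] x) := by
    ext x
    simp only [Function.iterate_add_apply, add_zero]
  rw [h1, eLpNorm_comp_shift h0.1, ← ofReal_realNorm h0, ← ofReal_realNorm hd.1,
    ← ENNReal.ofReal_mul (Real.sqrt_nonneg _)]
  apply ENNReal.ofReal_le_ofReal
  have h2 := hc.realNorm_sum_le hd a N
  simp only [add_zero]
  have h3 : 0 ≤ c * ∑ n ∈ Finset.range N, ‖a n‖ ^ 2 :=
    mul_nonneg hc.1 (Finset.sum_nonneg fun _ _ => sq_nonneg _)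
  refine le_of_sq_le_sq ?_ (mul_nonneg (Real.sqrt_nonneg _) realNorm_nonneg)
  rwa [mul_pow, Real.sq_sqrt h3]

theorem realNorm_mul_le_of_bound {M : ℝ} (hM : ∀ x, ‖d x‖ ≤ M)
    (hf : MemLp f (ENNReal.ofReal p) (iidLaw ν)) :
    realNorm (iidLaw ν) p (fun x => d x * f x) ≤ M * realNorm (iidLaw ν) p f := by
  have hM0 : 0 ≤ M := (norm_nonneg _).trans (hM fun _ => (nonempty_of_isProbabilityMeasure ν).some)
  have h : eLpNorm (fun x => d x * f x) (ENNReal.ofReal p) (iidLaw ν) ≤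
      ENNReal.ofReal M * eLpNorm f (ENNReal.ofReal p) (iidLaw ν) := by
    refine eLpNorm_le_mul_eLpNorm_of_ae_le_mul (ae_of_all _ fun x => ?_) _
    rw [norm_mul]
    exact mul_le_mul_of_nonneg_right (hM x) (norm_nonneg _)
  have h2 := ENNReal.toReal_mono (ENNReal.mul_ne_top ENNReal.ofReal_ne_top hf.2.ne) h
  rwa [ENNReal.toReal_mul, ENNReal.toReal_ofReal hM0] at h2

/-- Quadratic forms in martingale differences without diagonal terms. -/
theorem IsBurkholderConst.eLpNorm_strictUpper_le (hc : IsBurkholderConst ν p c)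
    (hd : IsMartingaleDiff ν p d) (hd' : IsMartingaleDiff ν p d') {M : ℝ} (hM : ∀ x, ‖d x‖ ≤ M)
    (W : ℕ → ℕ → ℂ) (N : ℕ) :
    eLpNorm (fun x => ∑ n ∈ Finset.range N, ∑ m ∈ Finset.range N,
      if n < m then W n m * (d (shift^[n] x) * d' (shift^[m] x)) else 0)
      (ENNReal.ofReal p) (iidLaw ν) ≤
      ENNReal.ofReal (c * M * √(∑ n ∈ Finset.range N, ∑ m ∈ Finset.range N, ‖W n m‖ ^ 2)) *
        eLpNorm d' (ENNReal.ofReal p) (iidLaw ν) := by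
  have hM0 : 0 ≤ M := (norm_nonneg _).trans (hM fun _ => (nonempty_of_isProbabilityMeasure ν).some)
  set H : ℕ → (ℕ → E) → ℂ := fun n x =>
    ∑ j ∈ Finset.range (N - (n + 1)), W n (j + (n + 1)) * d' (shift^[j] x) with hH
  have hHm : ∀ n, MemLp (H n) (ENNReal.ofReal p) (iidLaw ν) := fun n =>
    memLp_sum_shift hd'.1 _ _ 0
  set e : ℕ → (ℕ → E) → ℂ := fun n x => d x * H n (shift x) with he
  have hem : ∀ n, MemLp (e n) (ENNReal.ofReal p) (iidLaw ν) := fun n =>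
    (memLp_comp_shift (hHm n) 1).of_le_mul (c := M)
      (hd.1.1.mul (memLp_comp_shift (hHm n) 1).1) (ae_of_all _ fun x => by
        rw [norm_mul]
        exact mul_le_mul_of_nonneg_right (hM x) (norm_nonneg _))
  have he0 : ∀ n, transfer ν (e n) =ᵐ[iidLaw ν] 0 := fun n => by
    have h1 : e n = fun x => H n (shift x) * d x := by ext x; simp only [he]; ring
    rw [h1, transfer_shift_mul]
    filter_upwards [hd.2] with x hx
    simp [hx]
  have hsum : (fun x => ∑ n ∈ Finset.range N, ∑ m ∈ Finset.range N,
      if n < m then W n m * (d (shift^[n] x) * d' (shift^[m] x)) else 0) =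
      fun x => ∑ n ∈ Finset.range N, e n (shift^[n] x) := by
    ext x
    refine Finset.sum_congr rfl fun n hn => ?_
    have hn' := Finset.mem_range.1 hn
    have h1 := sum_range_add_eq_sum_ite (T := N - (n + 1)) (k := n + 1) (N := N) (by omega)
      fun m => W n m * (d (shift^[n] x) * d' (shift^[m] x))
    simp only [he, hH]
    rw [Finset.mul_sum]
    trans ∑ a ∈ Finset.range (N - (n + 1)),
      W n (a + (n + 1)) * (d (shift^[n] x) * d' (shift^[a + (n + 1)] x))
    · rw [h1]
      refine Finset.sum_congr rfl fun m hm => ?_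
      have hm' := Finset.mem_range.1 hm
      congr 1
      apply propext
      omega
    · refine Finset.sum_congr rfl fun a _ => ?_
      rw [Function.iterate_add_apply shift a (n + 1), Function.iterate_succ_apply' shift n]
      ring
  have hmem : MemLp (fun x => ∑ n ∈ Finset.range N, e n (shift^[n] x)) (ENNReal.ofReal p)
      (iidLaw ν) := memLp_finsetSum _ fun n _ => memLp_comp_shift (hem n) n
  rw [hsum, ← ofReal_realNorm hmem, ← ofReal_realNorm hd'.1,
    ← ENNReal.ofReal_mul (mul_nonneg (mul_nonneg hc.1 hM0) (Real.sqrt_nonneg _))]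
  apply ENNReal.ofReal_le_ofReal
  set S := ∑ n ∈ Finset.range N, ∑ m ∈ Finset.range N, ‖W n m‖ ^ 2 with hS
  have hS0 : 0 ≤ S := Finset.sum_nonneg fun _ _ => Finset.sum_nonneg fun _ _ => sq_nonneg _
  set D := realNorm (iidLaw ν) p d' with hD
  have hD0 : 0 ≤ D := realNorm_nonneg
  have hen : ∀ n ∈ Finset.range N, realNorm (iidLaw ν) p (e n) ^ 2 ≤
      M ^ 2 * (c * (∑ m ∈ Finset.range N, ‖W n m‖ ^ 2) * D ^ 2) := fun n hn => by
    have hn' := Finset.mem_range.1 hn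
    have h1 : realNorm (iidLaw ν) p (e n) ≤ M * realNorm (iidLaw ν) p (H n) := by
      have h2 := realNorm_mul_le_of_bound hM (memLp_comp_shift (hHm n) 1)
      have h3 : realNorm (iidLaw ν) p (fun x => H n (shift^[1] x)) = realNorm (iidLaw ν) p (H n) := by
        rw [realNorm, realNorm, eLpNorm_comp_shift (hHm n).1]
      rw [h3] at h2
      exact h2
    have h4 := hc.realNorm_sum_le hd' (fun j => W n (j + (n + 1))) (N - (n + 1))
    have h5 : ∑ j ∈ Finset.range (N - (n + 1)), ‖W n (j + (n + 1))‖ ^ 2 ≤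
        ∑ m ∈ Finset.range N, ‖W n m‖ ^ 2 := by
      rw [sum_range_add_eq_sum_ite (N := N) (by omega) fun m => ‖W n m‖ ^ 2]
      refine Finset.sum_le_sum fun m _ => ?_
      split_ifs
      · exact le_rfl
      · positivity
    calc realNorm (iidLaw ν) p (e n) ^ 2 ≤ (M * realNorm (iidLaw ν) p (H n)) ^ 2 :=
          pow_le_pow_left₀ realNorm_nonneg h1 2
      _ = M ^ 2 * realNorm (iidLaw ν) p (H n) ^ 2 := mul_pow _ _ _
      _ ≤ M ^ 2 * (c * (∑ j ∈ Finset.range (N - (n + 1)), ‖W n (j + (n + 1))‖ ^ 2) * D ^ 2) := by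
          gcongr
      _ ≤ _ := by
          have := hc.1
          gcongr
  refine le_of_sq_le_sq ?_ (by have := hc.1; positivity)
  calc _ ≤ c * ∑ n ∈ Finset.range N, realNorm (iidLaw ν) p (e n) ^ 2 := hc.2 e hem he0 N
    _ ≤ c * ∑ n ∈ Finset.range N, M ^ 2 * (c * (∑ m ∈ Finset.range N, ‖W n m‖ ^ 2) * D ^ 2) :=
        mul_le_mul_of_nonneg_left (Finset.sum_le_sum hen) hc.1
    _ = (c * M * √S * D) ^ 2 := by
        rw [mul_pow, mul_pow (c * M), Real.sq_sqrt hS0, ← Finset.mul_sum, ← Finset.sum_mul,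
          ← Finset.mul_sum, ← hS]
        ring

end Martingale

section Kernel

/-- Lag-window kernels that are Fourier transforms of an integrable function `κ`. -/
structure IsFourierKernel (K : ℝ → ℝ) (κ : ℝ → ℂ) : Prop where
  map_zero : K 0 = 1
  continuous : Continuous K
  integrable : Integrable κ
  eq_integral : ∀ y : ℝ, (K y : ℂ) = ∫ x : ℝ, κ x * Complex.exp ((2 * Real.pi * x * y : ℝ) * Complex.I)
  tendsto_zero : Tendsto K (cocompact ℝ) (𝓝 0)

theorem IsFourierKernel.abs_le {K : ℝ → ℝ} {κ : ℝ → ℂ} (hK : IsFourierKernel K κ) (y : ℝ) :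
    |K y| ≤ ∫ x, ‖κ x‖ := by
  rw [← Real.norm_eq_abs, ← Complex.norm_real, hK.eq_integral]
  refine (norm_integral_le_integral_norm _).trans (le_of_eq ?_)
  simp_rw [norm_mul, Complex.norm_exp_ofReal_mul_I, mul_one]

/-- The coefficient of `Z_s Z_{s+u}` in the lag-window estimate. -/
noncomputable def lagWeight (K : ℝ → ℝ) (B : ℝ) (T : ℕ) (lam : ℝ) (u : ℤ) : ℂ :=
  1 / (2 * (Real.pi : ℂ)) * ((K ((u : ℝ) / B) : ℂ) *
    Complex.exp (-(Complex.I * (u : ℂ) * (lam : ℂ))) * (1 / (T : ℂ)))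

theorem norm_exp_neg_I_mul (u : ℤ) (lam : ℝ) :
    ‖Complex.exp (-(Complex.I * (u : ℂ) * (lam : ℂ)))‖ = 1 := by
  have : -(Complex.I * (u : ℂ) * (lam : ℂ)) = ((-(u * lam) : ℝ) : ℂ) * Complex.I := by
    push_cast; ring
  rw [this, Complex.norm_exp_ofReal_mul_I]

theorem norm_one_div_two_pi : ‖(1 / (2 * (Real.pi : ℂ)) : ℂ)‖ = 1 / (2 * Real.pi) := by
  rw [norm_div, norm_mul, Complex.norm_real, Real.norm_of_nonneg Real.pi_pos.le]
  simp

theorem norm_lagWeight (K : ℝ → ℝ) (B : ℝ) (T : ℕ) (lam : ℝ) (u : ℤ) :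
    ‖lagWeight K B T lam u‖ = 1 / (2 * Real.pi) * (|K ((u : ℝ) / B)| * (1 / T)) := by
  rw [lagWeight, norm_mul, norm_mul, norm_mul, norm_one_div_two_pi, norm_exp_neg_I_mul,
    Complex.norm_real, Real.norm_eq_abs, norm_div, Complex.norm_natCast]
  simp

theorem tendsto_sum_sq_kernel {K : ℝ → ℝ} {κ : ℝ → ℂ} (hK : IsFourierKernel K κ) {B : ℕ → ℝ}
    (hB0 : ∀ T : ℕ, 1 ≤ T → 0 < B T) (hB : Tendsto (fun T : ℕ => B T / T) atTop (𝓝 0)) :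
    Tendsto (fun T : ℕ => ∑ a ∈ Finset.range T, ∑ b ∈ Finset.range T,
      (|K (((a : ℤ) - b : ℤ) / B T)| * (1 / (T : ℝ))) ^ 2) atTop (𝓝 0) := by
  set k := ∫ x, ‖κ x‖ with hk
  have hk0 : 0 ≤ k := integral_nonneg fun _ => norm_nonneg _
  rw [Metric.tendsto_atTop]
  intro ε hε
  have hsmall : ∃ A : ℝ, 0 < A ∧ ∀ y : ℝ, A ≤ |y| → |K y| ^ 2 ≤ ε / 2 := by
    have h1 : Tendsto (fun y => |K y| ^ 2) (cocompact ℝ) (𝓝 0) := by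
      simpa using (hK.tendsto_zero.abs.pow 2)
    have h2 := h1.eventually (ge_mem_nhds (by positivity : (0 : ℝ) < ε / 2))
    obtain ⟨A, hA⟩ := (Metric.hasBasis_cobounded_compl_closedBall (0 : ℝ)).eventually_iff.1
      (by rwa [Metric.cobounded_eq_cocompact]) |>.imp fun _ h => h.2
    refine ⟨|A| + 1, by positivity, fun y hy => hA ?_⟩
    simp only [Set.mem_compl_iff, Metric.mem_closedBall, dist_zero_right, Real.norm_eq_abs, not_le]
    linarith [le_abs_self A]
  obtain ⟨A, hA0, hA⟩ := hsmall
  have hlim : Tendsto (fun T : ℕ => k ^ 2 * (2 * A * (B T / T) + 1 / (T : ℝ))) atTop (𝓝 0) := by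
    have h1 := ((hB.const_mul (2 * A)).add tendsto_one_div_atTop_nhds_zero_nat).const_mul (k ^ 2)
    simpa using h1
  have hev := hlim.eventually (gt_mem_nhds (by positivity : (0 : ℝ) < ε / 2))
  obtain ⟨T₀, hT₀⟩ := eventually_atTop.1 hev
  refine ⟨max T₀ 1, fun T hT => ?_⟩
  have hT1 : 1 ≤ T := le_of_max_le_right hT
  have hT0 : (0 : ℝ) < T := by exact_mod_cast hT1
  have hBT := hB0 T hT1
  have hrow : ∀ a ∈ Finset.range T, ∑ b ∈ Finset.range T,
      (|K (((a : ℤ) - b : ℤ) / B T)| * (1 / (T : ℝ))) ^ 2 ≤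
      (k ^ 2 * (2 * A * B T + 1) + T * (ε / 2)) * (1 / (T : ℝ)) ^ 2 := fun a _ => by
    set m := ⌊A * B T⌋₊ with hm
    have hmle : (m : ℝ) ≤ A * B T := Nat.floor_le (by positivity)
    have hterm : ∀ b ∈ Finset.range T, (|K (((a : ℤ) - b : ℤ) / B T)| * (1 / (T : ℝ))) ^ 2 ≤
        ((if b ∈ Finset.Icc (a - m) (a + m) then k ^ 2 else 0) + ε / 2) * (1 / (T : ℝ)) ^ 2 := by
      intro b _
      rw [mul_pow]
      gcongr
      split_ifs with h
      · have : |K (((a : ℤ) - b : ℤ) / B T)| ^ 2 ≤ k ^ 2 := by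
          gcongr; exact hK.abs_le _
        linarith
      · rw [zero_add]
        apply hA
        rw [abs_div, abs_of_pos hBT, le_div_iff₀ hBT]
        by_contra! hlt
        apply h
        have h3 : (((a : ℤ) - b).natAbs : ℝ) < A * B T := by
          rw [Nat.cast_natAbs]; exact_mod_cast hlt
        have h4 : ((a : ℤ) - b).natAbs ≤ m := Nat.le_floor h3.le
        rw [Finset.mem_Icc]
        omega
    calc _ ≤ ∑ b ∈ Finset.range T,
          ((if b ∈ Finset.Icc (a - m) (a + m) then k ^ 2 else 0) + ε / 2) * (1 / (T : ℝ)) ^ 2 :=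
          Finset.sum_le_sum hterm
      _ = (∑ b ∈ Finset.range T, (if b ∈ Finset.Icc (a - m) (a + m) then k ^ 2 else 0)
          + T * (ε / 2)) * (1 / (T : ℝ)) ^ 2 := by
          rw [← Finset.sum_mul, Finset.sum_add_distrib]; simp
      _ ≤ _ := by
          gcongr
          rw [← Finset.sum_filter, Finset.sum_const, nsmul_eq_mul, mul_comm]
          gcongr
          have hcard : ((Finset.range T).filter fun b => b ∈ Finset.Icc (a - m) (a + m)).card
              ≤ 2 * m + 1 := by
            calc _ ≤ (Finset.Icc (a - m) (a + m)).card :=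
                  Finset.card_le_card fun b hb => (Finset.mem_filter.1 hb).2
              _ ≤ _ := by rw [Nat.card_Icc]; omega
          calc (_ : ℝ) ≤ ((2 * m + 1 : ℕ) : ℝ) := by exact_mod_cast hcard
            _ ≤ _ := by push_cast; linarith
  have hnn : 0 ≤ ∑ a ∈ Finset.range T, ∑ b ∈ Finset.range T,
      (|K (((a : ℤ) - b : ℤ) / B T)| * (1 / (T : ℝ))) ^ 2 :=
    Finset.sum_nonneg fun _ _ => Finset.sum_nonneg fun _ _ => sq_nonneg _
  rw [dist_zero_right, Real.norm_of_nonneg hnn]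
  calc _ ≤ ∑ a ∈ Finset.range T,
        (k ^ 2 * (2 * A * B T + 1) + T * (ε / 2)) * (1 / (T : ℝ)) ^ 2 := Finset.sum_le_sum hrow
    _ = k ^ 2 * (2 * A * (B T / T) + 1 / (T : ℝ)) + ε / 2 := by
        rw [Finset.sum_const, Finset.card_range, nsmul_eq_mul]; field_simp
    _ < ε := by linarith [hT₀ T (le_of_max_le_left hT)]

end Kernel

section Quad

variable {E : Type*} [MeasurableSpace E] {ν : Measure E} [IsProbabilityMeasure ν] {p c : ℝ}
  {d d' f g : (ℕ → E) → ℂ} {K : ℝ → ℝ} {κ : ℝ → ℂ}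

/-- The Toeplitz quadratic form with coefficients `w`. -/
def quad (w : ℤ → ℂ) (T : ℕ) (f g : (ℕ → E) → ℂ) (x : ℕ → E) : ℂ :=
  ∑ a ∈ Finset.range T, ∑ b ∈ Finset.range T,
    w ((a : ℤ) - b) * (f (shift^[a] x) * g (shift^[b] x))

theorem holderTriple_half (hp : 2 ≤ p) :
    ENNReal.HolderTriple (ENNReal.ofReal p) (ENNReal.ofReal p) (ENNReal.ofReal (p / 2)) := by
  constructor
  rw [← ENNReal.ofReal_inv_of_pos (by linarith), ← ENNReal.ofReal_inv_of_pos (by linarith),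
    ← ENNReal.ofReal_add (by positivity) (by positivity)]
  congr 1
  field_simp
  norm_num

theorem eLpNorm_mul_le_half {α : Type*} [MeasurableSpace α] {μ : Measure α} {f g : α → ℂ}
    (hp : 2 ≤ p) (hf : AEStronglyMeasurable f μ) (hg : AEStronglyMeasurable g μ) :
    eLpNorm (fun x => f x * g x) (ENNReal.ofReal (p / 2)) μ ≤
      eLpNorm f (ENNReal.ofReal p) μ * eLpNorm g (ENNReal.ofReal p) μ := by
  have := holderTriple_half hp
  have h := eLpNorm_le_eLpNorm_mul_eLpNorm_of_nnnorm (p := ENNReal.ofReal p)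
    (q := ENNReal.ofReal p) (r := ENNReal.ofReal (p / 2)) hf hg (fun a b => a * b) 1
    (ae_of_all _ fun x => by simp)
  simpa using h

section

variable {E : Type*}

/-- A finite Fourier sum of the stationary process generated by `d`. -/
noncomputable def phaseSum (θ : ℕ → ℝ) (T k : ℕ) (d : (ℕ → E) → ℂ) (y : ℕ → E) : ℂ :=
  ∑ a ∈ Finset.range T, Complex.exp ((θ a : ℝ) * Complex.I) * d (shift^[a + k] y)

theorem quad_lagWeight_eq_integral (hK : IsFourierKernel K κ) (B : ℝ) (T : ℕ) (lam : ℝ) (k l : ℕ)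
    (d d' : (ℕ → E) → ℂ) (y : ℕ → E) :
    quad (lagWeight K B T lam) T (fun x => d (shift^[k] x)) (fun x => d' (shift^[l] x)) y =
      ∫ x : ℝ, κ x * (1 / (2 * (Real.pi : ℂ)) * (1 / (T : ℂ)) *
        (phaseSum (fun a => a * (2 * Real.pi * x / B - lam)) T k d y *
          phaseSum (fun b => -(b * (2 * Real.pi * x / B - lam))) T l d' y)) := by
  have hexp : ∀ (a b : ℕ) (x : ℝ),
      Complex.exp ((2 * Real.pi * x * (((a : ℤ) - b : ℤ) / B) : ℝ) * Complex.I) *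
        Complex.exp (-(Complex.I * (((a : ℤ) - b : ℤ) : ℂ) * (lam : ℂ))) =
      Complex.exp ((a * (2 * Real.pi * x / B - lam) : ℝ) * Complex.I) *
        Complex.exp ((-(b * (2 * Real.pi * x / B - lam)) : ℝ) * Complex.I) := fun a b x => by
    rw [← Complex.exp_add, ← Complex.exp_add]
    congr 1
    push_cast
    ring
  have hint : ∀ y : ℝ, Integrable fun x : ℝ =>
      κ x * Complex.exp ((2 * Real.pi * x * y : ℝ) * Complex.I) := fun y => by
    refine hK.integrable.mul_bdd (c := 1) (by fun_prop) (ae_of_all _ fun x => ?_)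
    rw [Complex.norm_exp_ofReal_mul_I]
  set G : ℕ → ℕ → ℝ → ℂ := fun a b x =>
      κ x * Complex.exp ((2 * Real.pi * x * (((a : ℤ) - b : ℤ) / B) : ℝ) * Complex.I) *
        (Complex.exp (-(Complex.I * (((a : ℤ) - b : ℤ) : ℂ) * (lam : ℂ))) *
          (1 / (2 * (Real.pi : ℂ)) * (1 / (T : ℂ)) *
            (d (shift^[a + k] y) * d' (shift^[b + l] y)))) with hG
  have hGi : ∀ a b, Integrable (G a b) := fun a b => (hint _).mul_const _
  have hterm : ∀ a b : ℕ, lagWeight K B T lam ((a : ℤ) - b) *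
      (d (shift^[k] (shift^[a] y)) * d' (shift^[l] (shift^[b] y))) = ∫ x : ℝ, G a b x :=
      fun a b => by
    rw [hG, integral_mul_const, ← hK.eq_integral, lagWeight, add_comm a k, add_comm b l,
      Function.iterate_add_apply, Function.iterate_add_apply]
    ring
  calc _ = ∑ a ∈ Finset.range T, ∑ b ∈ Finset.range T, ∫ x : ℝ, G a b x :=
        Finset.sum_congr rfl fun a _ => Finset.sum_congr rfl fun b _ => hterm a b
    _ = ∫ x : ℝ, ∑ a ∈ Finset.range T, ∑ b ∈ Finset.range T, G a b x := by
        rw [integral_finsetSum _ fun a _ => integrable_finsetSum _ fun b _ => hGi a b]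
        exact Finset.sum_congr rfl fun a _ => (integral_finsetSum _ fun b _ => hGi a b).symm
    _ = _ := by
        congr 1
        ext x
        rw [phaseSum, phaseSum, Finset.sum_mul_sum, Finset.mul_sum, Finset.mul_sum]
        refine Finset.sum_congr rfl fun a _ => ?_
        rw [Finset.mul_sum, Finset.mul_sum]
        refine Finset.sum_congr rfl fun b _ => ?_
        linear_combination (κ x * (1 / (2 * (Real.pi : ℂ)) * (1 / (T : ℂ)) *
          (d (shift^[a + k] y) * d' (shift^[b + l] y)))) * hexp a b x

end

theorem IsBurkholderConst.eLpNorm_phaseSum_le (hc : IsBurkholderConst ν p c)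
    (hd : IsMartingaleDiff ν p d) (θ : ℕ → ℝ) (T k : ℕ) :
    eLpNorm (phaseSum θ T k d) (ENNReal.ofReal p) (iidLaw ν) ≤
      ENNReal.ofReal √(c * T) * eLpNorm d (ENNReal.ofReal p) (iidLaw ν) := by
  have h := hc.eLpNorm_sum_le hd (fun a => Complex.exp ((θ a : ℝ) * Complex.I)) T k
  simp only [Complex.norm_exp_ofReal_mul_I, one_pow, Finset.sum_const, Finset.card_range,
    nsmul_eq_mul, mul_one] at h
  exact h

theorem IsBurkholderConst.eLpNorm_phaseSum_mul_le (hc : IsBurkholderConst ν p c) (hp : 2 ≤ p)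
    (hd : IsMartingaleDiff ν p d) (hd' : IsMartingaleDiff ν p d') (θ θ' : ℕ → ℝ) (T k l : ℕ) :
    eLpNorm (fun y => 1 / (2 * (Real.pi : ℂ)) * (1 / (T : ℂ)) *
      (phaseSum θ T k d y * phaseSum θ' T l d' y)) (ENNReal.ofReal (p / 2)) (iidLaw ν) ≤
      ENNReal.ofReal c *
        (eLpNorm d (ENNReal.ofReal p) (iidLaw ν) * eLpNorm d' (ENNReal.ofReal p) (iidLaw ν)) := by
  have h1 := hc.eLpNorm_phaseSum_le hd θ T k
  have h2 := hc.eLpNorm_phaseSum_le hd' θ' T l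
  have h3 := eLpNorm_mul_le_half hp (memLp_sum_shift hd.1 _ T k).1 (memLp_sum_shift hd'.1 _ T l).1
    (f := phaseSum θ T k d) (g := phaseSum θ' T l d')
  have h4 : ‖(1 / (2 * (Real.pi : ℂ)) * (1 / (T : ℂ)) : ℂ)‖ₑ =
      ENNReal.ofReal (1 / (2 * Real.pi) * (1 / T)) := by
    rw [← ofReal_norm, norm_mul, norm_one_div_two_pi, norm_div, Complex.norm_natCast]
    simp
  have hpi : 1 / (2 * Real.pi) ≤ 1 := by
    rw [div_le_one (by positivity)]; linarith [Real.pi_gt_three]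
  calc _ = ‖(1 / (2 * (Real.pi : ℂ)) * (1 / (T : ℂ)) : ℂ)‖ₑ *
        eLpNorm (fun y => phaseSum θ T k d y * phaseSum θ' T l d' y) (ENNReal.ofReal (p / 2))
        (iidLaw ν) := eLpNorm_const_smul _ _ _ _
    _ ≤ ENNReal.ofReal (1 / (2 * Real.pi) * (1 / T)) *
        ((ENNReal.ofReal √(c * T) * eLpNorm d (ENNReal.ofReal p) (iidLaw ν)) *
        (ENNReal.ofReal √(c * T) * eLpNorm d' (ENNReal.ofReal p) (iidLaw ν))) := by
        rw [h4]
        gcongr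
        exact h3.trans (mul_le_mul' h1 h2)
    _ = ENNReal.ofReal (1 / (2 * Real.pi) * (1 / T) * (c * T)) *
        (eLpNorm d (ENNReal.ofReal p) (iidLaw ν) * eLpNorm d' (ENNReal.ofReal p) (iidLaw ν)) := by
        have h5 : c * (T : ℝ) = √(c * T) * √(c * T) :=
          (Real.mul_self_sqrt (mul_nonneg hc.1 (Nat.cast_nonneg T))).symm
        conv_rhs => rw [h5]
        rw [ENNReal.ofReal_mul (p := 1 / (2 * Real.pi) * (1 / T)) (by positivity),
          ENNReal.ofReal_mul (Real.sqrt_nonneg _)]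
        ring
    _ ≤ _ := by
        gcongr
        rcases Nat.eq_zero_or_pos T with rfl | hT
        · simpa using hc.1
        · have hT' : (0 : ℝ) < T := by exact_mod_cast hT
          have : 1 / (2 * Real.pi) * (1 / (T : ℝ)) * (c * T) = 1 / (2 * Real.pi) * c := by
            field_simp
          rw [this]
          exact mul_le_of_le_one_left hc.1 hpi

theorem aestronglyMeasurable_phaseSum (hd : AEStronglyMeasurable d (iidLaw ν)) {θ : ℝ → ℕ → ℝ}
    (hθ : ∀ a, Measurable fun x => θ x a) (T k : ℕ) :
    AEStronglyMeasurable (fun z : ℝ × (ℕ → E) => phaseSum (θ z.1) T k d z.2)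
      ((volume : Measure ℝ).prod (iidLaw ν)) := by
  refine Finset.aestronglyMeasurable_fun_sum _ fun a _ => AEStronglyMeasurable.mul ?_ ?_
  · have h : Measurable fun x : ℝ => Complex.exp ((θ x a : ℝ) * Complex.I) :=
      Complex.measurable_exp.comp ((Complex.measurable_ofReal.comp (hθ a)).mul_const _)
    exact (h.comp measurable_fst).aestronglyMeasurable
  · have h : AEStronglyMeasurable (fun y => d (shift^[a + k] y)) (iidLaw ν) :=
      hd.comp_measurePreserving (measurePreserving_shift_iterate ν (a + k))
    exact h.comp_snd

/-- The lag-window quadratic form is bounded on `L^p × L^p`, uniformly in all parameters. -/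
theorem IsBurkholderConst.eLpNorm_quad_le (hc : IsBurkholderConst ν p c) (hp : 2 ≤ p)
    (hK : IsFourierKernel K κ) (hd : IsMartingaleDiff ν p d) (hd' : IsMartingaleDiff ν p d')
    (B : ℝ) (T : ℕ) (lam : ℝ) (k l : ℕ) :
    eLpNorm (quad (lagWeight K B T lam) T (fun x => d (shift^[k] x)) fun x => d' (shift^[l] x))
      (ENNReal.ofReal (p / 2)) (iidLaw ν) ≤
      (∫⁻ x, ‖κ x‖ₑ) * (ENNReal.ofReal c *
        (eLpNorm d (ENNReal.ofReal p) (iidLaw ν) * eLpNorm d' (ENNReal.ofReal p) (iidLaw ν))) := by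
  have hq : 1 ≤ ENNReal.ofReal (p / 2) := by
    rw [← ENNReal.ofReal_one]; exact ENNReal.ofReal_le_ofReal (by linarith)
  set F : ℝ × (ℕ → E) → ℂ := fun z => 1 / (2 * (Real.pi : ℂ)) * (1 / (T : ℂ)) *
    (phaseSum (fun a => a * (2 * Real.pi * z.1 / B - lam)) T k d z.2 *
      phaseSum (fun b => -(b * (2 * Real.pi * z.1 / B - lam))) T l d' z.2) with hF
  have hFm : AEStronglyMeasurable F ((volume : Measure ℝ).prod (iidLaw ν)) := by
    have h1 := aestronglyMeasurable_phaseSum hd.1.1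
      (θ := fun x a => a * (2 * Real.pi * x / B - lam)) (fun a => by fun_prop) T k
    have h2 := aestronglyMeasurable_phaseSum hd'.1.1
      (θ := fun x b => -(b * (2 * Real.pi * x / B - lam))) (fun a => by fun_prop) T l
    exact (h1.mul h2).const_mul _
  have heq : quad (lagWeight K B T lam) T (fun x => d (shift^[k] x)) (fun x => d' (shift^[l] x)) =
      fun y => ∫ x : ℝ, κ x * F (x, y) := by
    ext y; exact quad_lagWeight_eq_integral hK B T lam k l d d' y
  rw [heq]
  refine eLpNorm_integral_mul_le hq ENNReal.ofReal_ne_top hK.integrable.1 hFm fun x => ?_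
  exact hc.eLpNorm_phaseSum_mul_le hp hd hd' (fun a => a * (2 * Real.pi * x / B - lam))
    (fun b => -(b * (2 * Real.pi * x / B - lam))) T k l

end Quad

section Decomposition

variable {E : Type*}

/-- Membership of the pair of indices `(n, m)` in the square `[k, k + T) × [l, l + T)`. -/
def inSquare (T k l n m : ℕ) : Prop := (k ≤ n ∧ n < k + T) ∧ l ≤ m ∧ m < l + T

instance (T k l n m : ℕ) : Decidable (inSquare T k l n m) := by unfold inSquare; infer_instance

/-- The coefficients of the quadratic form after translating the two arguments by `k` and `l`. -/
def shiftedWeight (w : ℤ → ℂ) (T k l n m : ℕ) : ℂ :=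
  if inSquare T k l n m then w (((n : ℤ) - k) - ((m : ℤ) - l)) else 0

theorem sum_square_eq {M : Type*} [AddCommMonoid M] (T k l : ℕ) (F : ℕ → ℕ → M) :
    ∑ a ∈ Finset.range T, ∑ b ∈ Finset.range T, F (a + k) (b + l) =
      ∑ n ∈ Finset.range (T + k + l), ∑ m ∈ Finset.range (T + k + l),
        if inSquare T k l n m then F n m else 0 := by
  rw [sum_range_add_eq_sum_ite (N := T + k + l) (by omega)
    fun n => ∑ b ∈ Finset.range T, F n (b + l)]
  refine Finset.sum_congr rfl fun n _ => ?_
  rw [sum_range_add_eq_sum_ite (N := T + k + l) (by omega) fun m => F n m]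
  by_cases h : k ≤ n ∧ n < k + T
  · rw [if_pos h]
    refine Finset.sum_congr rfl fun m _ => ?_
    simp only [inSquare, h, true_and]
  · rw [if_neg h, Finset.sum_eq_zero]
    intro m _
    rw [if_neg fun h' => h h'.1]

theorem quad_shift_eq (w : ℤ → ℂ) (T k l : ℕ) (d d' : (ℕ → E) → ℂ) (x : ℕ → E) :
    quad w T (fun x => d (shift^[k] x)) (fun x => d' (shift^[l] x)) x =
      ∑ n ∈ Finset.range (T + k + l), ∑ m ∈ Finset.range (T + k + l),
        shiftedWeight w T k l n m * (d (shift^[n] x) * d' (shift^[m] x)) := by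
  have h := sum_square_eq T k l fun n m =>
    w (((n : ℤ) - k) - ((m : ℤ) - l)) * (d (shift^[n] x) * d' (shift^[m] x))
  rw [quad]
  trans ∑ a ∈ Finset.range T, ∑ b ∈ Finset.range T,
    w ((((a + k : ℕ) : ℤ) - k) - (((b + l : ℕ) : ℤ) - l)) *
      (d (shift^[a + k] x) * d' (shift^[b + l] x))
  · refine Finset.sum_congr rfl fun a _ => Finset.sum_congr rfl fun b _ => ?_
    rw [add_comm a k, add_comm b l, Function.iterate_add_apply, Function.iterate_add_apply]
    congr 2
    push_cast
    ring
  · rw [h]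
    refine Finset.sum_congr rfl fun n _ => Finset.sum_congr rfl fun m _ => ?_
    rw [shiftedWeight]
    split_ifs <;> simp

theorem sum_norm_sq_shiftedWeight (w : ℤ → ℂ) (T k l : ℕ) :
    ∑ n ∈ Finset.range (T + k + l), ∑ m ∈ Finset.range (T + k + l),
      ‖shiftedWeight w T k l n m‖ ^ 2 =
    ∑ a ∈ Finset.range T, ∑ b ∈ Finset.range T, ‖w ((a : ℤ) - b)‖ ^ 2 := by
  have h := sum_square_eq T k l fun n m => ‖w (((n : ℤ) - k) - ((m : ℤ) - l))‖ ^ 2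
  trans ∑ n ∈ Finset.range (T + k + l), ∑ m ∈ Finset.range (T + k + l),
    if inSquare T k l n m then ‖w (((n : ℤ) - k) - ((m : ℤ) - l))‖ ^ 2 else 0
  · refine Finset.sum_congr rfl fun n _ => Finset.sum_congr rfl fun m _ => ?_
    rw [shiftedWeight]
    split_ifs <;> simp
  · rw [← h]
    refine Finset.sum_congr rfl fun a _ => Finset.sum_congr rfl fun b _ => ?_
    congr 3
    push_cast
    ring

theorem sum_sum_eq_upper_add_lower_add_diag {M : Type*} [AddCommMonoid M] (N : ℕ) (F : ℕ → ℕ → M) :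
    ∑ n ∈ Finset.range N, ∑ m ∈ Finset.range N, F n m =
      ∑ n ∈ Finset.range N, ∑ m ∈ Finset.range N, (if n < m then F n m else 0) +
      ∑ m ∈ Finset.range N, ∑ n ∈ Finset.range N, (if m < n then F n m else 0) +
      ∑ n ∈ Finset.range N, F n n := by
  rw [Finset.sum_comm (s := Finset.range N) (t := Finset.range N)
    (f := fun m n => if m < n then F n m else 0), ← Finset.sum_add_distrib,
    ← Finset.sum_add_distrib]
  refine Finset.sum_congr rfl fun n hn => ?_
  have h1 : F n n = ∑ m ∈ Finset.range N, if n = m then F n m else 0 := by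
    rw [Finset.sum_ite_eq, if_pos hn]
  rw [h1, ← Finset.sum_add_distrib, ← Finset.sum_add_distrib]
  refine Finset.sum_congr rfl fun m _ => ?_
  rcases lt_trichotomy n m with h | h | h
  · simp [h, h.ne, h.not_gt]
  · simp [h]
  · simp [h, h.ne', h.not_gt]

end Decomposition

section Diagonal

variable {E : Type*} [MeasurableSpace E] {ν : Measure E} [IsProbabilityMeasure ν] {p c : ℝ}
  {d d' f g h : (ℕ → E) → ℂ} {K : ℝ → ℝ} {κ : ℝ → ℂ} {N M : ℕ}

theorem one_le_ofReal {p : ℝ} (hp : 1 ≤ p) : 1 ≤ ENNReal.ofReal p := by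
  rw [← ENNReal.ofReal_one]; exact ENNReal.ofReal_le_ofReal hp

theorem isMartingaleDiff_innov (hp : 2 ≤ p) (hf : MemLp f (ENNReal.ofReal p) (iidLaw ν)) (j : ℕ) :
    IsMartingaleDiff ν p (innov ν j f) :=
  ⟨memLp_innov (one_le_ofReal (by linarith)) ENNReal.ofReal_ne_top hf j,
    transfer_innov (hf.mono_exponent (one_le_ofReal (by linarith))) j⟩

/-- Weighted sums of a centred bounded cylinder function are of the order of a square root. -/
theorem IsBurkholderConst.eLpNorm_cylinder_sum_le (hc : IsBurkholderConst ν p c) (hp : 2 ≤ p)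
    (hh : IsBoundedCylinder M h) (h0 : ∫ x, h x ∂iidLaw ν = 0) (a : ℕ → ℂ) (N : ℕ) :
    eLpNorm (fun x => ∑ n ∈ Finset.range N, a n * h (shift^[n] x)) (ENNReal.ofReal p)
      (iidLaw ν) ≤ ENNReal.ofReal √(c * ∑ n ∈ Finset.range N, ‖a n‖ ^ 2) *
        ∑ j ∈ Finset.range M, eLpNorm (innov ν j h) (ENNReal.ofReal p) (iidLaw ν) := by
  have hd := fun j => isMartingaleDiff_innov (ν := ν) hp hh.memLp j
  have heq : (fun x => ∑ n ∈ Finset.range N, a n * h (shift^[n] x)) =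
      ∑ j ∈ Finset.range M, fun x => ∑ n ∈ Finset.range N, a n * innov ν j h (shift^[n + j] x) := by
    ext x
    rw [Finset.sum_apply, Finset.sum_comm]
    refine Finset.sum_congr rfl fun n _ => ?_
    rw [← Finset.mul_sum]
    congr 1
    have h1 := sum_innov (ν := ν) h M (shift^[n] x)
    rw [hh.iterate_transfer_eq_integral le_rfl, h0, sub_zero] at h1
    rw [← h1]
    refine Finset.sum_congr rfl fun j _ => ?_
    rw [add_comm n j, Function.iterate_add_apply]
  rw [heq, Finset.mul_sum]
  refine (MeasureTheory.eLpNorm_sum_le (fun j _ => (memLp_sum_shift (hd j).1 a N j).1)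
    (one_le_ofReal (by linarith))).trans ?_
  exact Finset.sum_le_sum fun j _ => hc.eLpNorm_sum_le (hd j) a N j

/-- The indicator of the diagonal indices. -/
def diagIndicator (T k l n : ℕ) : ℂ := if inSquare T k l n n then 1 else 0

theorem sum_norm_sq_diagIndicator_le (T k l N : ℕ) :
    ∑ n ∈ Finset.range N, ‖diagIndicator T k l n‖ ^ 2 ≤ T := by
  have h1 : ∀ n, ‖diagIndicator T k l n‖ ^ 2 = if inSquare T k l n n then (1 : ℝ) else 0 :=
    fun n => by rw [diagIndicator]; split_ifs <;> simp
  simp only [h1]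
  rw [← Finset.sum_filter, Finset.sum_const, nsmul_eq_mul, mul_one]
  have h2 : ((Finset.range N).filter fun n => inSquare T k l n n).card ≤ (Finset.Ico k (k + T)).card :=
    Finset.card_le_card fun n hn => Finset.mem_Ico.2 (Finset.mem_filter.1 hn).2.1
  rw [Nat.card_Ico] at h2
  exact_mod_cast h2.trans (by omega)

theorem sum_diagIndicator (T k l : ℕ) :
    ∑ n ∈ Finset.range (T + k + l), diagIndicator T k l n = ((T + min k l - max k l : ℕ) : ℂ) := by
  simp only [diagIndicator]
  rw [← Finset.sum_filter, Finset.sum_const, nsmul_eq_mul, mul_one]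
  have : (Finset.range (T + k + l)).filter (fun n => inSquare T k l n n) =
      Finset.Ico (max k l) (T + min k l) := by
    ext n
    rw [Finset.mem_filter, Finset.mem_range, Finset.mem_Ico, inSquare]
    omega
  rw [this, Nat.card_Ico]

theorem shiftedWeight_diag (w : ℤ → ℂ) (T k l n : ℕ) :
    shiftedWeight w T k l n n = w ((l : ℤ) - k) * diagIndicator T k l n := by
  rw [shiftedWeight, diagIndicator]
  split_ifs
  · rw [mul_one]; congr 1; ring
  · simp

/-- The limit coefficient of the pair of innovations with delays `k` and `l`. -/
noncomputable def limitPhase (k l : ℕ) (lam : ℝ) : ℂ :=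
  1 / (2 * (Real.pi : ℂ)) * Complex.exp (-(Complex.I * (((l : ℤ) - k : ℤ) : ℂ) * (lam : ℂ)))

theorem norm_limitPhase (k l : ℕ) (lam : ℝ) : ‖limitPhase k l lam‖ = 1 / (2 * Real.pi) := by
  rw [limitPhase, norm_mul, norm_one_div_two_pi, norm_exp_neg_I_mul, mul_one]

theorem norm_limitPhase_le (k l : ℕ) (lam : ℝ) : ‖limitPhase k l lam‖ ≤ 1 := by
  rw [norm_limitPhase, div_le_one (by positivity)]; linarith [Real.pi_gt_three]

/-- The deviation of the diagonal coefficient from its limit. -/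
noncomputable def diagDeviation (K : ℝ → ℝ) (B : ℝ) (T k l : ℕ) : ℝ :=
  K ((((l : ℤ) - k : ℤ) : ℝ) / B) * (((T + min k l - max k l : ℕ) : ℝ) / T) - 1

theorem tendsto_diagDeviation (hK : IsFourierKernel K κ) {B : ℕ → ℝ}
    (hB : Tendsto (fun T : ℕ => 1 / B T) atTop (𝓝 0)) (k l : ℕ) :
    Tendsto (fun T => diagDeviation K (B T) T k l) atTop (𝓝 0) := by
  have h1 : Tendsto (fun T => K ((((l : ℤ) - k : ℤ) : ℝ) / B T)) atTop (𝓝 1) := by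
    have h2 := (hB.const_mul (((l : ℤ) - k : ℤ) : ℝ))
    rw [mul_zero] at h2
    have h3 := (hK.continuous.tendsto 0).comp h2
    rw [hK.map_zero] at h3
    refine h3.congr fun T => ?_
    simp [div_eq_mul_inv]
  have h4 : Tendsto (fun T : ℕ => ((T + min k l - max k l : ℕ) : ℝ) / T) atTop (𝓝 1) := by
    have h5 : Tendsto (fun T : ℕ => 1 + ((min k l : ℝ) - (max k l : ℝ)) * (1 / (T : ℝ)))
        atTop (𝓝 1) := by
      simpa using (tendsto_one_div_atTop_nhds_zero_nat.const_mul
        ((min k l : ℝ) - (max k l : ℝ))).const_add 1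
    refine h5.congr' ?_
    filter_upwards [eventually_ge_atTop (max k l + 1)] with T hT
    have hT0 : (T : ℝ) ≠ 0 := by
      have : 0 < T := by omega
      exact_mod_cast this.ne'
    rw [Nat.cast_sub (by omega)]
    push_cast
    field_simp
    ring
  have := (h1.mul h4).sub_const 1
  simpa [diagDeviation] using this

/-- The part of a quadratic form that lies strictly above the diagonal. -/
def strictUpper (W : ℕ → ℕ → ℂ) (N : ℕ) (d d' : (ℕ → E) → ℂ) (x : ℕ → E) : ℂ :=
  ∑ n ∈ Finset.range N, ∑ m ∈ Finset.range N,
    if n < m then W n m * (d (shift^[n] x) * d' (shift^[m] x)) else 0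

/-- The centred diagonal part of the lag-window form. -/
def diagForm (w : ℤ → ℂ) (T k l : ℕ) (h : (ℕ → E) → ℂ) (x : ℕ → E) : ℂ :=
  w ((l : ℤ) - k) * ∑ n ∈ Finset.range (T + k + l), diagIndicator T k l n * h (shift^[n] x)

theorem quad_eq_strictUpper_add {E : Type*} (w : ℤ → ℂ) (T k l : ℕ) (d d' : (ℕ → E) → ℂ) (c₀ : ℂ)
    (x : ℕ → E) :
    quad w T (fun x => d (shift^[k] x)) (fun x => d' (shift^[l] x)) x =
      strictUpper (shiftedWeight w T k l) (T + k + l) d d' x +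
      strictUpper (fun m n => shiftedWeight w T k l n m) (T + k + l) d' d x +
      (diagForm w T k l (fun x => d x * d' x - c₀) x +
        w ((l : ℤ) - k) * ((T + min k l - max k l : ℕ) : ℂ) * c₀) := by
  rw [quad_shift_eq, sum_sum_eq_upper_add_lower_add_diag]
  have hdiag : ∑ n ∈ Finset.range (T + k + l), shiftedWeight w T k l n n *
      (d (shift^[n] x) * d' (shift^[n] x)) =
      diagForm w T k l (fun x => d x * d' x - c₀) x +
        w ((l : ℤ) - k) * ((T + min k l - max k l : ℕ) : ℂ) * c₀ := by
    rw [diagForm, ← sum_diagIndicator, Finset.mul_sum, Finset.mul_sum, Finset.sum_mul,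
      ← Finset.sum_add_distrib]
    refine Finset.sum_congr rfl fun n _ => ?_
    rw [shiftedWeight_diag]
    ring
  rw [hdiag]
  congr 2
  rw [strictUpper]
  refine Finset.sum_congr rfl fun m _ => Finset.sum_congr rfl fun n _ => ?_
  rw [mul_comm (d (shift^[n] x))]

theorem aestronglyMeasurable_strictUpper (hd : AEStronglyMeasurable d (iidLaw ν))
    (hd' : AEStronglyMeasurable d' (iidLaw ν)) (W : ℕ → ℕ → ℂ) (N : ℕ) :
    AEStronglyMeasurable (strictUpper W N d d') (iidLaw ν) := by
  refine Finset.aestronglyMeasurable_fun_sum _ fun n _ =>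
    Finset.aestronglyMeasurable_fun_sum _ fun m _ => ?_
  have h1 := hd.comp_measurePreserving (measurePreserving_shift_iterate ν n)
  have h2 := hd'.comp_measurePreserving (measurePreserving_shift_iterate ν m)
  split_ifs
  · exact (h1.mul h2).const_mul _
  · exact aestronglyMeasurable_const

theorem aestronglyMeasurable_diagForm (hh : AEStronglyMeasurable h (iidLaw ν)) (w : ℤ → ℂ)
    (T k l : ℕ) : AEStronglyMeasurable (diagForm w T k l h) (iidLaw ν) := by
  refine AEStronglyMeasurable.const_mul ?_ _
  refine Finset.aestronglyMeasurable_fun_sum _ fun n _ => ?_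
  exact (hh.comp_measurePreserving (measurePreserving_shift_iterate ν n)).const_mul _

theorem one_div_two_pi_le_one : 1 / (2 * Real.pi) ≤ 1 := by
  rw [div_le_one (by positivity)]; linarith [Real.pi_gt_three]

/-- The sum of the squared coefficients of the lag-window form, up to a constant. -/
noncomputable def kernelSquareSum (K : ℝ → ℝ) (B : ℝ) (T : ℕ) : ℝ :=
  ∑ a ∈ Finset.range T, ∑ b ∈ Finset.range T, (|K (((a : ℤ) - b : ℤ) / B)| * (1 / (T : ℝ))) ^ 2

theorem sum_norm_sq_shiftedWeight_lagWeight_le (K : ℝ → ℝ) (B : ℝ) (T : ℕ) (lam : ℝ) (k l : ℕ) :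
    ∑ n ∈ Finset.range (T + k + l), ∑ m ∈ Finset.range (T + k + l),
      ‖shiftedWeight (lagWeight K B T lam) T k l n m‖ ^ 2 ≤ kernelSquareSum K B T := by
  rw [sum_norm_sq_shiftedWeight]
  refine Finset.sum_le_sum fun a _ => Finset.sum_le_sum fun b _ => ?_
  rw [norm_lagWeight]
  exact pow_le_pow_left₀ (by positivity)
    (mul_le_of_le_one_left (by positivity) one_div_two_pi_le_one) 2

theorem IsBurkholderConst.eLpNorm_strictUpper_le_of_le (hc : IsBurkholderConst ν p c)
    (hd : IsMartingaleDiff ν p d) (hd' : IsMartingaleDiff ν p d') {M : ℝ} (hM : ∀ x, ‖d x‖ ≤ M)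
    {W : ℕ → ℕ → ℂ} {N : ℕ} {S : ℝ}
    (hS : ∑ n ∈ Finset.range N, ∑ m ∈ Finset.range N, ‖W n m‖ ^ 2 ≤ S) :
    eLpNorm (strictUpper W N d d') (ENNReal.ofReal p) (iidLaw ν) ≤
      ENNReal.ofReal (c * M * √S) * eLpNorm d' (ENNReal.ofReal p) (iidLaw ν) := by
  refine (hc.eLpNorm_strictUpper_le hd hd' hM W N).trans ?_
  have hM0 : 0 ≤ M :=
    (norm_nonneg _).trans (hM fun _ => (nonempty_of_isProbabilityMeasure ν).some)
  have := hc.1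
  gcongr

theorem IsBurkholderConst.eLpNorm_diagForm_le (hc : IsBurkholderConst ν p c) (hp : 2 ≤ p) {J : ℕ}
    (hJ : IsBoundedCylinder J h) (h0 : ∫ x, h x ∂iidLaw ν = 0) (B : ℝ) (T : ℕ) (hT : 1 ≤ T)
    (lam : ℝ) (k l : ℕ) :
    eLpNorm (diagForm (lagWeight K B T lam) T k l h) (ENNReal.ofReal p) (iidLaw ν) ≤
      ENNReal.ofReal (|K ((((l : ℤ) - k : ℤ) : ℝ) / B)| * √(c * (1 / T))) *
        ∑ j ∈ Finset.range J, eLpNorm (innov ν j h) (ENNReal.ofReal p) (iidLaw ν) := by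
  have hT0 : (0 : ℝ) < T := by exact_mod_cast hT
  have h1 := hc.eLpNorm_cylinder_sum_le hp hJ h0 (diagIndicator T k l) (T + k + l)
  calc _ = ‖lagWeight K B T lam ((l : ℤ) - k)‖ₑ *
        eLpNorm (fun x => ∑ n ∈ Finset.range (T + k + l), diagIndicator T k l n * h (shift^[n] x))
          (ENNReal.ofReal p) (iidLaw ν) := eLpNorm_const_smul _ _ _ _
    _ ≤ ENNReal.ofReal (|K ((((l : ℤ) - k : ℤ) : ℝ) / B)| * (1 / T)) *
        (ENNReal.ofReal √(c * T) *
        ∑ j ∈ Finset.range J, eLpNorm (innov ν j h) (ENNReal.ofReal p) (iidLaw ν)) := by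
        gcongr
        · rw [← ofReal_norm, norm_lagWeight]
          apply ENNReal.ofReal_le_ofReal
          exact mul_le_of_le_one_left (by positivity) one_div_two_pi_le_one
        · refine h1.trans ?_
          have := hc.1
          gcongr
          exact sum_norm_sq_diagIndicator_le T k l _
    _ = _ := by
        rw [← mul_assoc, ← ENNReal.ofReal_mul (by positivity)]
        congr 2
        rw [mul_assoc]
        congr 1
        have h2 : c * (1 / (T : ℝ)) = (1 / T) ^ 2 * (c * T) := by field_simp
        rw [h2, Real.sqrt_mul (by positivity : (0 : ℝ) ≤ (1 / (T : ℝ)) ^ 2),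
          Real.sqrt_sq (by positivity)]

theorem lagWeight_mul_sub_limitPhase (K : ℝ → ℝ) (B : ℝ) {T : ℕ} (hT : 1 ≤ T) (lam : ℝ)
    (k l : ℕ) :
    lagWeight K B T lam ((l : ℤ) - k) * ((T + min k l - max k l : ℕ) : ℂ) - limitPhase k l lam =
      limitPhase k l lam * (diagDeviation K B T k l : ℂ) := by
  have hT' : (T : ℂ) ≠ 0 := by exact_mod_cast (by omega : T ≠ 0)
  rw [lagWeight, limitPhase, diagDeviation]
  push_cast
  ring

/-- The lag-window form of two bounded martingale differences, compared with its limit. -/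
theorem IsBurkholderConst.eLpNorm_quad_sub_le (hc : IsBurkholderConst ν p c) (hp : 2 ≤ p)
    (hd : IsMartingaleDiff ν p d) (hd' : IsMartingaleDiff ν p d') {M M' : ℝ}
    (hM : ∀ x, ‖d x‖ ≤ M) (hM' : ∀ x, ‖d' x‖ ≤ M') {J : ℕ}
    (hJ : IsBoundedCylinder J fun x => d x * d' x - ∫ y, d y * d' y ∂iidLaw ν)
    (B : ℝ) (T : ℕ) (hT : 1 ≤ T) (lam : ℝ) (k l : ℕ) :
    eLpNorm (fun x => quad (lagWeight K B T lam) T (fun x => d (shift^[k] x))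
        (fun x => d' (shift^[l] x)) x - limitPhase k l lam * ∫ y, d y * d' y ∂iidLaw ν)
      (ENNReal.ofReal p) (iidLaw ν) ≤
      ENNReal.ofReal (c * M * √(kernelSquareSum K B T)) *
        eLpNorm d' (ENNReal.ofReal p) (iidLaw ν) +
      ENNReal.ofReal (c * M' * √(kernelSquareSum K B T)) *
        eLpNorm d (ENNReal.ofReal p) (iidLaw ν) +
      (ENNReal.ofReal (|K ((((l : ℤ) - k : ℤ) : ℝ) / B)| * √(c * (1 / T))) *
        ∑ j ∈ Finset.range J, eLpNorm (innov ν j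
          fun x => d x * d' x - ∫ y, d y * d' y ∂iidLaw ν) (ENNReal.ofReal p) (iidLaw ν) +
      ENNReal.ofReal (|diagDeviation K B T k l| * ‖∫ y, d y * d' y ∂iidLaw ν‖)) := by
  have hp1 : 1 ≤ ENNReal.ofReal p := one_le_ofReal (by linarith)
  have hi : Integrable (fun x => d x * d' x) (iidLaw ν) :=
    (hd'.1.integrable hp1).bdd_mul (c := M) hd.1.1 (ae_of_all _ hM)
  have hh0 : ∫ x, (d x * d' x - ∫ y, d y * d' y ∂iidLaw ν) ∂iidLaw ν = 0 := by
    rw [integral_sub hi (integrable_const _)]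
    simp
  generalize hc₀ : ∫ y, d y * d' y ∂iidLaw ν = c₀ at hJ hh0 ⊢
  have hS := sum_norm_sq_shiftedWeight_lagWeight_le K B T lam k l
  have hS' := hS
  rw [Finset.sum_comm] at hS'
  have hUle := hc.eLpNorm_strictUpper_le_of_le hd hd' hM hS
  have hLle := hc.eLpNorm_strictUpper_le_of_le
    (W := fun m n => shiftedWeight (lagWeight K B T lam) T k l n m) hd' hd hM' hS'
  have hHle := hc.eLpNorm_diagForm_le (K := K) hp hJ hh0 B T hT lam k l
  have hUm := aestronglyMeasurable_strictUpper hd.1.1 hd'.1.1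
    (shiftedWeight (lagWeight K B T lam) T k l) (T + k + l)
  have hLm := aestronglyMeasurable_strictUpper hd'.1.1 hd.1.1
    (fun m n => shiftedWeight (lagWeight K B T lam) T k l n m) (T + k + l)
  have hHm := aestronglyMeasurable_diagForm (ν := ν) hJ.measurable.aestronglyMeasurable
    (lagWeight K B T lam) T k l
  have hRle : eLpNorm (fun _ : ℕ → E => limitPhase k l lam * (diagDeviation K B T k l : ℂ) * c₀)
      (ENNReal.ofReal p) (iidLaw ν) ≤ ENNReal.ofReal (|diagDeviation K B T k l| * ‖c₀‖) := by
    rw [eLpNorm_const _ (zero_lt_one.trans_le hp1).ne' (IsProbabilityMeasure.ne_zero _),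
      measure_univ, ENNReal.one_rpow, mul_one, ← ofReal_norm]
    apply ENNReal.ofReal_le_ofReal
    rw [norm_mul, norm_mul, Complex.norm_real, Real.norm_eq_abs]
    gcongr
    exact mul_le_of_le_one_left (abs_nonneg _) (norm_limitPhase_le _ _ _)
  have hsplit : (fun x => quad (lagWeight K B T lam) T (fun x => d (shift^[k] x))
      (fun x => d' (shift^[l] x)) x - limitPhase k l lam * c₀) =
      strictUpper (shiftedWeight (lagWeight K B T lam) T k l) (T + k + l) d d' +
      strictUpper (fun m n => shiftedWeight (lagWeight K B T lam) T k l n m) (T + k + l) d' d +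
      (diagForm (lagWeight K B T lam) T k l (fun x => d x * d' x - c₀) +
        fun _ => limitPhase k l lam * (diagDeviation K B T k l : ℂ) * c₀) := by
    ext x
    rw [quad_eq_strictUpper_add _ _ _ _ _ _ c₀, ← lagWeight_mul_sub_limitPhase K B hT]
    simp only [Pi.add_apply]
    ring
  rw [hsplit]
  refine (eLpNorm_add_le (hUm.add hLm) (hHm.add aestronglyMeasurable_const) hp1).trans ?_
  refine add_le_add ((eLpNorm_add_le hUm hLm hp1).trans (add_le_add hUle hLle)) ?_
  exact (eLpNorm_add_le hHm aestronglyMeasurable_const hp1).trans (add_le_add hHle hRle)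

theorem IsBurkholderConst.tendsto_iSup_quad_sub_of_cylinder (hc : IsBurkholderConst ν p c)
    (hp : 2 ≤ p) (hK : IsFourierKernel K κ) {B : ℕ → ℝ} (hB0 : ∀ T : ℕ, 1 ≤ T → 0 < B T)
    (hB1 : Tendsto (fun T : ℕ => 1 / B T) atTop (𝓝 0))
    (hB2 : Tendsto (fun T : ℕ => B T / T) atTop (𝓝 0)) {N N' : ℕ} (hdN : IsBoundedCylinder N d)
    (hdN' : IsBoundedCylinder N' d') (hd : transfer ν d =ᵐ[iidLaw ν] 0)
    (hd' : transfer ν d' =ᵐ[iidLaw ν] 0) (k l : ℕ) :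
    Tendsto (fun T : ℕ => ⨆ lam : ℝ, eLpNorm (fun x => quad (lagWeight K (B T) T lam) T
      (fun x => d (shift^[k] x)) (fun x => d' (shift^[l] x)) x -
        limitPhase k l lam * ∫ y, d y * d' y ∂iidLaw ν) (ENNReal.ofReal p) (iidLaw ν))
      atTop (𝓝 0) := by
  obtain ⟨M, hM⟩ := hdN.bounded
  obtain ⟨M', hM'⟩ := hdN'.bounded
  have hJ := (hdN.mul hdN').sub (IsBoundedCylinder.const (N := 0) (∫ y, d y * d' y ∂iidLaw ν))
  have hdp : IsMartingaleDiff ν p d := ⟨hdN.memLp, hd⟩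
  have hdp' : IsMartingaleDiff ν p d' := ⟨hdN'.memLp, hd'⟩
  have hmemh : MemLp (fun x => d x * d' x - ∫ y, d y * d' y ∂iidLaw ν) (ENNReal.ofReal p)
      (iidLaw ν) := hJ.memLp
  have hS := (Real.continuous_sqrt.tendsto 0).comp (tendsto_sum_sq_kernel hK hB0 hB2)
  rw [Real.sqrt_zero] at hS
  have hlim1 : ∀ m : ℝ, ∀ e : (ℕ → E) → ℂ, MemLp e (ENNReal.ofReal p) (iidLaw ν) →
      Tendsto (fun T : ℕ => ENNReal.ofReal (c * m * √(kernelSquareSum K (B T) T)) *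
        eLpNorm e (ENNReal.ofReal p) (iidLaw ν)) atTop (𝓝 0) := fun m e he => by
    have h1 := ENNReal.tendsto_ofReal (hS.const_mul (c * m))
    rw [mul_zero, ENNReal.ofReal_zero] at h1
    have h2 := ENNReal.Tendsto.mul_const (b := eLpNorm e (ENNReal.ofReal p) (iidLaw ν)) h1
      (Or.inr he.2.ne)
    rwa [zero_mul] at h2
  have hlim2 : Tendsto (fun T : ℕ => ENNReal.ofReal
      (|K ((((l : ℤ) - k : ℤ) : ℝ) / B T)| * √(c * (1 / T))) * ∑ j ∈ Finset.range
        (max (max N N') 0), eLpNorm (innov ν j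
          fun x => d x * d' x - ∫ y, d y * d' y ∂iidLaw ν) (ENNReal.ofReal p) (iidLaw ν))
      atTop (𝓝 0) := by
    have h1 : Tendsto (fun T : ℕ => √(c * (1 / (T : ℝ)))) atTop (𝓝 0) := by
      have h2 := (Real.continuous_sqrt.tendsto 0).comp (f := fun T : ℕ => c * (1 / (T : ℝ)))
        (by simpa using (tendsto_one_div_atTop_nhds_zero_nat (𝕜 := ℝ)).const_mul c)
      rwa [Real.sqrt_zero] at h2
    have h3 : Tendsto (fun T : ℕ => |K ((((l : ℤ) - k : ℤ) : ℝ) / B T)| * √(c * (1 / T)))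
        atTop (𝓝 0) := by
      refine squeeze_zero (fun T => by positivity)
        (fun T => mul_le_mul_of_nonneg_right (hK.abs_le _) (Real.sqrt_nonneg _)) ?_
      simpa using h1.const_mul (∫ x, ‖κ x‖)
    have h4 := ENNReal.tendsto_ofReal h3
    rw [ENNReal.ofReal_zero] at h4
    have h5 := ENNReal.Tendsto.mul_const (b := ∑ j ∈ Finset.range (max (max N N') 0),
      eLpNorm (innov ν j fun x => d x * d' x - ∫ y, d y * d' y ∂iidLaw ν) (ENNReal.ofReal p)
        (iidLaw ν)) h4 (Or.inr (ENNReal.sum_lt_top.2 fun j _ =>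
          (isMartingaleDiff_innov hp hmemh j).1.2).ne)
    rwa [zero_mul] at h5
  have hlim3 : Tendsto (fun T : ℕ => ENNReal.ofReal (|diagDeviation K (B T) T k l| *
      ‖∫ y, d y * d' y ∂iidLaw ν‖)) atTop (𝓝 0) := by
    have h1 := ENNReal.tendsto_ofReal
      ((tendsto_diagDeviation hK hB1 k l).abs.mul_const ‖∫ y, d y * d' y ∂iidLaw ν‖)
    simpa using h1
  have hlim := ((hlim1 M d' hdp'.1).add (hlim1 M' d hdp.1)).add (hlim2.add hlim3)
  simp only [add_zero] at hlim
  refine tendsto_of_tendsto_of_tendsto_of_le_of_le' tendsto_const_nhds hlim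
    (Eventually.of_forall fun _ => zero_le) ?_
  filter_upwards [eventually_ge_atTop 1] with T hT
  exact iSup_le fun lam => hc.eLpNorm_quad_sub_le hp hdp hdp' hM hM' hJ (B T) T hT lam k l

end Diagonal

section Bilinear

variable {E : Type*} [MeasurableSpace E] {ν : Measure E} [IsProbabilityMeasure ν] {p c : ℝ}
  {d d' e e' f g : (ℕ → E) → ℂ} {K : ℝ → ℝ} {κ : ℝ → ℂ}

theorem memLp_mul_half (hp : 2 ≤ p) (hf : MemLp f (ENNReal.ofReal p) (iidLaw ν))
    (hg : MemLp g (ENNReal.ofReal p) (iidLaw ν)) :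
    MemLp (fun x => f x * g x) (ENNReal.ofReal (p / 2)) (iidLaw ν) :=
  ⟨hf.1.mul hg.1, (eLpNorm_mul_le_half hp hf.1 hg.1).trans_lt (ENNReal.mul_lt_top hf.2 hg.2)⟩

theorem integrable_mul_of_memLp (hp : 2 ≤ p) (hf : MemLp f (ENNReal.ofReal p) (iidLaw ν))
    (hg : MemLp g (ENNReal.ofReal p) (iidLaw ν)) : Integrable (fun x => f x * g x) (iidLaw ν) :=
  (memLp_mul_half hp hf hg).integrable (one_le_ofReal (by linarith))

theorem enorm_integral_mul_le (hp : 2 ≤ p) (hf : MemLp f (ENNReal.ofReal p) (iidLaw ν))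
    (hg : MemLp g (ENNReal.ofReal p) (iidLaw ν)) :
    ‖∫ x, f x * g x ∂iidLaw ν‖ₑ ≤
      eLpNorm f (ENNReal.ofReal p) (iidLaw ν) * eLpNorm g (ENNReal.ofReal p) (iidLaw ν) := by
  refine (enorm_integral_le_lintegral_enorm _).trans ?_
  rw [← eLpNorm_one_eq_lintegral_enorm]
  exact (eLpNorm_le_eLpNorm_of_exponent_le (one_le_ofReal (by linarith))
    (hf.1.mul hg.1)).trans (eLpNorm_mul_le_half hp hf.1 hg.1)

theorem quad_sub_left {E : Type*} (w : ℤ → ℂ) (T : ℕ) (f f' g : (ℕ → E) → ℂ) (x : ℕ → E) :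
    quad w T (fun x => f x - f' x) g x = quad w T f g x - quad w T f' g x := by
  simp only [quad, ← Finset.sum_sub_distrib]
  exact Finset.sum_congr rfl fun a _ => Finset.sum_congr rfl fun b _ => by ring

theorem quad_sub_right {E : Type*} (w : ℤ → ℂ) (T : ℕ) (f g g' : (ℕ → E) → ℂ) (x : ℕ → E) :
    quad w T f (fun x => g x - g' x) x = quad w T f g x - quad w T f g' x := by
  simp only [quad, ← Finset.sum_sub_distrib]
  exact Finset.sum_congr rfl fun a _ => Finset.sum_congr rfl fun b _ => by ring

theorem quad_sum_left {E ι : Type*} (w : ℤ → ℂ) (T : ℕ) (s : Finset ι) (f : ι → (ℕ → E) → ℂ)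
    (g : (ℕ → E) → ℂ) (x : ℕ → E) :
    quad w T (fun x => ∑ k ∈ s, f k x) g x = ∑ k ∈ s, quad w T (f k) g x := by
  simp only [quad, Finset.sum_mul, Finset.mul_sum]
  rw [Finset.sum_comm (s := s)]
  exact Finset.sum_congr rfl fun a _ => Finset.sum_comm

theorem quad_sum_right {E ι : Type*} (w : ℤ → ℂ) (T : ℕ) (s : Finset ι) (f : (ℕ → E) → ℂ)
    (g : ι → (ℕ → E) → ℂ) (x : ℕ → E) :
    quad w T f (fun x => ∑ l ∈ s, g l x) x = ∑ l ∈ s, quad w T f (g l) x := by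
  simp only [quad, Finset.mul_sum]
  rw [Finset.sum_comm (s := s)]
  exact Finset.sum_congr rfl fun a _ => Finset.sum_comm

theorem aestronglyMeasurable_quad (hf : AEStronglyMeasurable f (iidLaw ν))
    (hg : AEStronglyMeasurable g (iidLaw ν)) (w : ℤ → ℂ) (T : ℕ) :
    AEStronglyMeasurable (quad w T f g) (iidLaw ν) := by
  refine Finset.aestronglyMeasurable_fun_sum _ fun n _ =>
    Finset.aestronglyMeasurable_fun_sum _ fun m _ => ?_
  have h1 := hf.comp_measurePreserving (measurePreserving_shift_iterate ν n)
  have h2 := hg.comp_measurePreserving (measurePreserving_shift_iterate ν m)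
  exact (h1.mul h2).const_mul _

theorem eLpNorm_quad_le_sum (hp : 2 ≤ p) (hf : MemLp f (ENNReal.ofReal p) (iidLaw ν))
    (hg : MemLp g (ENNReal.ofReal p) (iidLaw ν)) (w : ℤ → ℂ) (T : ℕ) :
    eLpNorm (quad w T f g) (ENNReal.ofReal (p / 2)) (iidLaw ν) ≤
      (∑ a ∈ Finset.range T, ∑ b ∈ Finset.range T, ‖w ((a : ℤ) - b)‖ₑ) *
        (eLpNorm f (ENNReal.ofReal p) (iidLaw ν) * eLpNorm g (ENNReal.ofReal p) (iidLaw ν)) := by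
  have hq : 1 ≤ ENNReal.ofReal (p / 2) := one_le_ofReal (by linarith)
  have hterm : ∀ a b : ℕ, AEStronglyMeasurable
      (fun x => w ((a : ℤ) - b) * (f (shift^[a] x) * g (shift^[b] x))) (iidLaw ν) := fun a b =>
    ((memLp_comp_shift hf a).1.mul (memLp_comp_shift hg b).1).const_mul _
  have heq : quad w T f g = ∑ a ∈ Finset.range T, ∑ b ∈ Finset.range T,
      fun x => w ((a : ℤ) - b) * (f (shift^[a] x) * g (shift^[b] x)) := by
    ext x; simp [quad, Finset.sum_apply]
  rw [heq, Finset.sum_mul]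
  refine (MeasureTheory.eLpNorm_sum_le (fun a _ =>
    Finset.aestronglyMeasurable_sum _ fun b _ => hterm a b) hq).trans ?_
  refine Finset.sum_le_sum fun a _ => ?_
  rw [Finset.sum_mul]
  refine (MeasureTheory.eLpNorm_sum_le (fun b _ => hterm a b) hq).trans ?_
  refine Finset.sum_le_sum fun b _ => ?_
  calc _ = ‖w ((a : ℤ) - b)‖ₑ * eLpNorm (fun x => f (shift^[a] x) * g (shift^[b] x))
        (ENNReal.ofReal (p / 2)) (iidLaw ν) := eLpNorm_const_smul _ _ _ _
    _ ≤ _ := by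
        gcongr
        refine (eLpNorm_mul_le_half hp (memLp_comp_shift hf a).1 (memLp_comp_shift hg b).1).trans ?_
        rw [eLpNorm_comp_shift hf.1, eLpNorm_comp_shift hg.1]

theorem IsMartingaleDiff.sub (hp : 2 ≤ p) (hd : IsMartingaleDiff ν p d)
    (hd' : IsMartingaleDiff ν p d') : IsMartingaleDiff ν p (fun x => d x - d' x) := by
  have hp1 : 1 ≤ ENNReal.ofReal p := one_le_ofReal (by linarith)
  refine ⟨hd.1.sub hd'.1, ?_⟩
  have h := transfer_sub (hd.1.integrable hp1) (hd'.1.integrable hp1)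
  filter_upwards [h, hd.2, hd'.2] with x hx h1 h2
  have : transfer ν (fun x => d x - d' x) x = transfer ν (d - d') x := rfl
  rw [this, hx, Pi.sub_apply, h1, h2]; simp

/-- The deviation of the lag-window form from its limit for a pair of martingale differences with
delays `k` and `l`. -/
noncomputable def formDev (ν : Measure E) [IsProbabilityMeasure ν] (K : ℝ → ℝ) (B : ℝ) (T k l : ℕ)
    (lam : ℝ) (d d' : (ℕ → E) → ℂ) (x : ℕ → E) : ℂ :=
  quad (lagWeight K B T lam) T (fun x => d (shift^[k] x)) (fun x => d' (shift^[l] x)) x -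
    limitPhase k l lam * ∫ y, d y * d' y ∂iidLaw ν

theorem aestronglyMeasurable_formDev (hd : AEStronglyMeasurable d (iidLaw ν))
    (hd' : AEStronglyMeasurable d' (iidLaw ν)) (B : ℝ) (T k l : ℕ) (lam : ℝ) :
    AEStronglyMeasurable (formDev ν K B T k l lam d d') (iidLaw ν) := by
  have h1 := hd.comp_measurePreserving (measurePreserving_shift_iterate ν k)
  have h2 := hd'.comp_measurePreserving (measurePreserving_shift_iterate ν l)
  exact (aestronglyMeasurable_quad h1 h2 _ T).sub aestronglyMeasurable_const

theorem eLpNorm_fun_const_le {q : ℝ≥0∞} (hq : 1 ≤ q) (a : ℂ) :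
    eLpNorm (fun _ : ℕ → E => a) q (iidLaw ν) = ‖a‖ₑ := by
  rw [eLpNorm_const _ (zero_lt_one.trans_le hq).ne' (IsProbabilityMeasure.ne_zero _),
    measure_univ, ENNReal.one_rpow, mul_one]

theorem IsBurkholderConst.eLpNorm_formDev_le (hc : IsBurkholderConst ν p c) (hp : 2 ≤ p)
    (hK : IsFourierKernel K κ) (hd : IsMartingaleDiff ν p d) (hd' : IsMartingaleDiff ν p d')
    (B : ℝ) (T k l : ℕ) (lam : ℝ) :
    eLpNorm (formDev ν K B T k l lam d d') (ENNReal.ofReal (p / 2)) (iidLaw ν) ≤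
      ((∫⁻ x, ‖κ x‖ₑ) * ENNReal.ofReal c + 1) *
        (eLpNorm d (ENNReal.ofReal p) (iidLaw ν) * eLpNorm d' (ENNReal.ofReal p) (iidLaw ν)) := by
  have hq : 1 ≤ ENNReal.ofReal (p / 2) := one_le_ofReal (by linarith)
  have h1 := hc.eLpNorm_quad_le hp hK hd hd' B T lam k l
  have hqm : AEStronglyMeasurable (quad (lagWeight K B T lam) T (fun x => d (shift^[k] x))
      fun x => d' (shift^[l] x)) (iidLaw ν) :=
    aestronglyMeasurable_quad (memLp_comp_shift hd.1 k).1 (memLp_comp_shift hd'.1 l).1 _ T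
  refine (eLpNorm_sub_le hqm aestronglyMeasurable_const hq).trans ?_
  rw [add_mul, one_mul, mul_assoc]
  refine add_le_add h1 ?_
  rw [eLpNorm_fun_const_le hq, enorm_mul]
  have h2 : ‖limitPhase k l lam‖ₑ ≤ 1 := by
    rw [← ofReal_norm, ← ENNReal.ofReal_one]
    exact ENNReal.ofReal_le_ofReal (norm_limitPhase_le k l lam)
  calc _ ≤ 1 * _ := mul_le_mul' h2 (enorm_integral_mul_le hp hd.1 hd'.1)
    _ = _ := one_mul _

theorem formDev_split (hp : 2 ≤ p) (hd : MemLp d (ENNReal.ofReal p) (iidLaw ν))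
    (hd' : MemLp d' (ENNReal.ofReal p) (iidLaw ν)) (he : MemLp e (ENNReal.ofReal p) (iidLaw ν))
    (he' : MemLp e' (ENNReal.ofReal p) (iidLaw ν)) (B : ℝ) (T k l : ℕ) (lam : ℝ) :
    formDev ν K B T k l lam d d' = formDev ν K B T k l lam (fun x => d x - e x) d' +
      formDev ν K B T k l lam e (fun x => d' x - e' x) + formDev ν K B T k l lam e e' := by
  ext x
  simp only [formDev, Pi.add_apply]
  rw [quad_sub_left _ _ (fun x => d (shift^[k] x)), quad_sub_right _ _ _ fun x => d' (shift^[l] x)]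
  have h1 : ∫ y, (d y - e y) * d' y ∂iidLaw ν =
      ∫ y, d y * d' y ∂iidLaw ν - ∫ y, e y * d' y ∂iidLaw ν := by
    rw [← integral_sub (integrable_mul_of_memLp hp hd hd') (integrable_mul_of_memLp hp he hd')]
    simp only [sub_mul]
  have h2 : ∫ y, e y * (d' y - e' y) ∂iidLaw ν =
      ∫ y, e y * d' y ∂iidLaw ν - ∫ y, e y * e' y ∂iidLaw ν := by
    rw [← integral_sub (integrable_mul_of_memLp hp he hd') (integrable_mul_of_memLp hp he he')]
    simp only [mul_sub]
  rw [h1, h2]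
  ring

/-- Uniform convergence of the lag-window form for a pair of martingale differences. -/
theorem IsBurkholderConst.tendsto_iSup_formDev (hc : IsBurkholderConst ν p c) (hp : 2 ≤ p)
    (hK : IsFourierKernel K κ) {B : ℕ → ℝ} (hB0 : ∀ T : ℕ, 1 ≤ T → 0 < B T)
    (hB1 : Tendsto (fun T : ℕ => 1 / B T) atTop (𝓝 0))
    (hB2 : Tendsto (fun T : ℕ => B T / T) atTop (𝓝 0)) (hd : IsMartingaleDiff ν p d)
    (hd' : IsMartingaleDiff ν p d') (k l : ℕ) :
    Tendsto (fun T : ℕ => ⨆ lam : ℝ, eLpNorm (formDev ν K (B T) T k l lam d d')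
      (ENNReal.ofReal (p / 2)) (iidLaw ν)) atTop (𝓝 0) := by
  have hq : 1 ≤ ENNReal.ofReal (p / 2) := one_le_ofReal (by linarith)
  have hp1 : 1 ≤ ENNReal.ofReal p := one_le_ofReal (by linarith)
  set C : ℝ≥0∞ := (∫⁻ x, ‖κ x‖ₑ) * ENNReal.ofReal c + 1 with hC
  have hCtop : C ≠ ∞ := ENNReal.add_ne_top.2
    ⟨ENNReal.mul_ne_top hK.integrable.2.ne ENNReal.ofReal_ne_top, ENNReal.one_ne_top⟩
  rw [ENNReal.tendsto_atTop_zero]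
  intro ε hε
  have hε3 : ε / 3 ≠ 0 := (ENNReal.div_pos hε.ne' ENNReal.ofNat_ne_top).ne'
  obtain ⟨e, N, hde, heN, he0⟩ := exists_isBoundedCylinder_transfer_eq_zero hp1
    ENNReal.ofReal_ne_top hd.1 hd.2 (ENNReal.div_pos hε3 (ENNReal.mul_ne_top hCtop hd'.1.2.ne)).ne'
  have he : IsMartingaleDiff ν p e := ⟨heN.memLp, he0⟩
  obtain ⟨e', N', hde', heN', he0'⟩ := exists_isBoundedCylinder_transfer_eq_zero hp1
    ENNReal.ofReal_ne_top hd'.1 hd'.2 (ENNReal.div_pos hε3 (ENNReal.mul_ne_top hCtop he.1.2.ne)).ne'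
  have he' : IsMartingaleDiff ν p e' := ⟨heN'.memLp, he0'⟩
  obtain ⟨T₀, hT₀⟩ := ENNReal.tendsto_atTop_zero.1
    (hc.tendsto_iSup_quad_sub_of_cylinder hp hK hB0 hB1 hB2 heN heN' he0 he0' k l) (ε / 3)
    (pos_iff_ne_zero.2 hε3)
  refine ⟨T₀, fun T hT => iSup_le fun lam => ?_⟩
  have h1 := hc.eLpNorm_formDev_le hp hK (hd.sub hp he) hd' (B T) T k l lam
  have h2 := hc.eLpNorm_formDev_le hp hK he (hd'.sub hp he') (B T) T k l lam
  have h3 : eLpNorm (formDev ν K (B T) T k l lam e e') (ENNReal.ofReal (p / 2)) (iidLaw ν) ≤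
      ε / 3 := by
    have hle : ENNReal.ofReal (p / 2) ≤ ENNReal.ofReal p :=
      ENNReal.ofReal_le_ofReal (by linarith)
    refine (eLpNorm_le_eLpNorm_of_exponent_le hle
      (aestronglyMeasurable_formDev he.1.1 he'.1.1 _ _ _ _ _)).trans ?_
    exact (le_iSup (fun lam => eLpNorm (formDev ν K (B T) T k l lam e e') (ENNReal.ofReal p)
      (iidLaw ν)) lam).trans (hT₀ T hT)
  rw [← hC] at h1 h2
  have h1' : C * (eLpNorm (fun x => d x - e x) (ENNReal.ofReal p) (iidLaw ν) *
      eLpNorm d' (ENNReal.ofReal p) (iidLaw ν)) ≤ ε / 3 := by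
    calc _ ≤ C * ((ε / 3 / (C * eLpNorm d' (ENNReal.ofReal p) (iidLaw ν))) *
          eLpNorm d' (ENNReal.ofReal p) (iidLaw ν)) := by gcongr; exact hde
      _ = (C * eLpNorm d' (ENNReal.ofReal p) (iidLaw ν)) *
          (ε / 3 / (C * eLpNorm d' (ENNReal.ofReal p) (iidLaw ν))) := by ring
      _ ≤ _ := ENNReal.mul_div_le
  have h2' : C * (eLpNorm e (ENNReal.ofReal p) (iidLaw ν) *
      eLpNorm (fun x => d' x - e' x) (ENNReal.ofReal p) (iidLaw ν)) ≤ ε / 3 := by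
    calc _ ≤ C * (eLpNorm e (ENNReal.ofReal p) (iidLaw ν) *
          (ε / 3 / (C * eLpNorm e (ENNReal.ofReal p) (iidLaw ν)))) := by gcongr; exact hde'
      _ = (C * eLpNorm e (ENNReal.ofReal p) (iidLaw ν)) *
          (ε / 3 / (C * eLpNorm e (ENNReal.ofReal p) (iidLaw ν))) := by ring
      _ ≤ _ := ENNReal.mul_div_le
  have hm1 := aestronglyMeasurable_formDev (K := K) (hd.sub hp he).1.1 hd'.1.1 (B T) T k l lam
  have hm2 := aestronglyMeasurable_formDev (K := K) he.1.1 (hd'.sub hp he').1.1 (B T) T k l lam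
  have hm3 := aestronglyMeasurable_formDev (K := K) he.1.1 he'.1.1 (B T) T k l lam
  rw [formDev_split hp hd.1 hd'.1 he.1 he'.1]
  calc _ ≤ ε / 3 + ε / 3 + ε / 3 := (eLpNorm_add_le (hm1.add hm2) hm3 hq).trans
        (add_le_add ((eLpNorm_add_le hm1 hm2 hq).trans
          (add_le_add (h1.trans h1') (h2.trans h2'))) h3)
    _ = ε := ENNReal.add_thirds ε

end Bilinear

section Series

variable {E : Type*} [MeasurableSpace E] {ν : Measure E} [IsProbabilityMeasure ν] {p c : ℝ}
  {d d' f g : (ℕ → E) → ℂ} {K : ℝ → ℝ} {κ : ℝ → ℂ}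

/-- Covariance of the innovations with delays `kl.1` and `kl.2`. -/
noncomputable def innovCov (ν : Measure E) [IsProbabilityMeasure ν] (f g : (ℕ → E) → ℂ)
    (kl : ℕ × ℕ) : ℂ :=
  ∫ x, innov ν kl.1 f x * innov ν kl.2 g x ∂iidLaw ν

/-- The sum of the `L^p` norms of the innovations. -/
noncomputable def innovSum (ν : Measure E) [IsProbabilityMeasure ν] (p : ℝ) (f : (ℕ → E) → ℂ) :
    ℝ≥0∞ :=
  ∑' k, eLpNorm (innov ν k f) (ENNReal.ofReal p) (iidLaw ν)

theorem tsum_innov_mul (ν : Measure E) [IsProbabilityMeasure ν] (p : ℝ) (f g : (ℕ → E) → ℂ) :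
    ∑' kl : ℕ × ℕ, eLpNorm (innov ν kl.1 f) (ENNReal.ofReal p) (iidLaw ν) *
      eLpNorm (innov ν kl.2 g) (ENNReal.ofReal p) (iidLaw ν) =
      innovSum ν p f * innovSum ν p g := by
  rw [ENNReal.tsum_prod', innovSum, ← ENNReal.tsum_mul_right]
  congr 1
  ext k
  rw [innovSum, ← ENNReal.tsum_mul_left]

theorem summable_norm_innovCov (hp : 2 ≤ p) (hf : MemLp f (ENNReal.ofReal p) (iidLaw ν))
    (hg : MemLp g (ENNReal.ofReal p) (iidLaw ν)) (hfs : innovSum ν p f ≠ ∞)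
    (hgs : innovSum ν p g ≠ ∞) : Summable fun kl => ‖innovCov ν f g kl‖ := by
  have h1 : ∑' kl, ‖innovCov ν f g kl‖ₑ ≤ innovSum ν p f * innovSum ν p g := by
    rw [← tsum_innov_mul]
    exact ENNReal.tsum_le_tsum fun kl => enorm_integral_mul_le hp
      (isMartingaleDiff_innov hp hf kl.1).1 (isMartingaleDiff_innov hp hg kl.2).1
  have h2 : ∑' kl, ‖innovCov ν f g kl‖ₑ ≠ ∞ :=
    (h1.trans_lt (ENNReal.mul_lt_top hfs.lt_top hgs.lt_top)).ne
  have h3 := ENNReal.summable_toReal h2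
  simpa using h3

/-- The part of `f` that is due to the `m` most recent coordinates. -/
noncomputable def truncated (ν : Measure E) (m : ℕ) (f : (ℕ → E) → ℂ) (x : ℕ → E) : ℂ :=
  ∑ k ∈ Finset.range m, innov ν k f (shift^[k] x)

theorem memLp_truncated (hp : 2 ≤ p) (hf : MemLp f (ENNReal.ofReal p) (iidLaw ν)) (m : ℕ) :
    MemLp (truncated ν m f) (ENNReal.ofReal p) (iidLaw ν) :=
  memLp_finsetSum _ fun k _ => memLp_comp_shift (isMartingaleDiff_innov hp hf k).1 k

theorem tendsto_eLpNorm_sub_truncated (hp : 2 ≤ p) (hf : MemLp f (ENNReal.ofReal p) (iidLaw ν))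
    (hf0 : ∫ x, f x ∂iidLaw ν = 0) :
    Tendsto (fun m => eLpNorm (fun x => f x - truncated ν m f x) (ENNReal.ofReal p) (iidLaw ν))
      atTop (𝓝 0) := by
  have hp1 : 1 ≤ ENNReal.ofReal p := one_le_ofReal (by linarith)
  refine (tendsto_eLpNorm_iterate_transfer hp1 ENNReal.ofReal_ne_top hf hf0).congr fun m => ?_
  have h1 : (fun x => f x - truncated ν m f x) = fun x => (transfer ν)^[m] f (shift^[m] x) := by
    ext x; rw [truncated, sum_innov]; ring
  rw [h1, eLpNorm_comp_shift (memLp_iterate_transfer hp1 ENNReal.ofReal_ne_top hf m).1]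

theorem eLpNorm_truncated_le (hp : 2 ≤ p) (hf : MemLp f (ENNReal.ofReal p) (iidLaw ν)) (m : ℕ) :
    eLpNorm (truncated ν m f) (ENNReal.ofReal p) (iidLaw ν) ≤
      2 * eLpNorm f (ENNReal.ofReal p) (iidLaw ν) := by
  have hp1 : 1 ≤ ENNReal.ofReal p := one_le_ofReal (by linarith)
  have hm := memLp_iterate_transfer hp1 ENNReal.ofReal_ne_top hf m
  have h1 : truncated ν m f = f - fun x => (transfer ν)^[m] f (shift^[m] x) := by
    ext x; rw [truncated, sum_innov]; rfl
  rw [h1, two_mul]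
  refine (eLpNorm_sub_le hf.1 (memLp_comp_shift hm m).1 hp1).trans ?_
  rw [eLpNorm_comp_shift hm.1]
  gcongr
  exact eLpNorm_iterate_transfer_le hp1 ENNReal.ofReal_ne_top hf m

theorem tendsto_finset_range_product :
    Tendsto (fun m : ℕ => Finset.range m ×ˢ Finset.range m) atTop atTop := by
  refine tendsto_atTop_finset_of_monotone (fun a b hab => ?_) fun x => ⟨max x.1 x.2 + 1, ?_⟩
  · exact Finset.product_subset_product (Finset.range_mono hab) (Finset.range_mono hab)
  · rw [Finset.mem_product, Finset.mem_range, Finset.mem_range]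
    omega

/-- The limit of the lag-window form of `f` and `g`. -/
noncomputable def limitForm (ν : Measure E) [IsProbabilityMeasure ν] (f g : (ℕ → E) → ℂ)
    (lam : ℝ) : ℂ :=
  ∑' kl : ℕ × ℕ, limitPhase kl.1 kl.2 lam * innovCov ν f g kl

theorem summable_limitPhase_mul (hp : 2 ≤ p) (hf : MemLp f (ENNReal.ofReal p) (iidLaw ν))
    (hg : MemLp g (ENNReal.ofReal p) (iidLaw ν)) (hfs : innovSum ν p f ≠ ∞)
    (hgs : innovSum ν p g ≠ ∞) (lam : ℝ) :
    Summable fun kl : ℕ × ℕ => limitPhase kl.1 kl.2 lam * innovCov ν f g kl := by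
  refine Summable.of_norm_bounded (summable_norm_innovCov hp hf hg hfs hgs) fun kl => ?_
  rw [norm_mul]
  exact mul_le_of_le_one_left (norm_nonneg _) (norm_limitPhase_le _ _ _)

theorem quad_truncated_sub (w : ℝ) (T m : ℕ) (lam : ℝ) (x : ℕ → E) :
    quad (lagWeight K w T lam) T (truncated ν m f) (truncated ν m g) x -
      ∑ kl ∈ Finset.range m ×ˢ Finset.range m, limitPhase kl.1 kl.2 lam * innovCov ν f g kl =
    ∑ kl ∈ Finset.range m ×ˢ Finset.range m,
      formDev ν K w T kl.1 kl.2 lam (innov ν kl.1 f) (innov ν kl.2 g) x := by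
  have h1 : quad (lagWeight K w T lam) T (truncated ν m f) (truncated ν m g) x =
      ∑ kl ∈ Finset.range m ×ˢ Finset.range m, quad (lagWeight K w T lam) T
        (fun x => innov ν kl.1 f (shift^[kl.1] x)) (fun x => innov ν kl.2 g (shift^[kl.2] x)) x := by
    rw [Finset.sum_product]
    refine (quad_sum_left _ T (Finset.range m) (fun k x => innov ν k f (shift^[k] x))
      (truncated ν m g) x).trans ?_
    exact Finset.sum_congr rfl fun k _ => quad_sum_right _ T (Finset.range m) _
      (fun l x => innov ν l g (shift^[l] x)) x
  rw [h1, ← Finset.sum_sub_distrib]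
  rfl

theorem eLpNorm_quad_sub_limitForm_le (hp : 2 ≤ p) (hf : MemLp f (ENNReal.ofReal p) (iidLaw ν))
    (hg : MemLp g (ENNReal.ofReal p) (iidLaw ν)) (hf0 : ∫ x, f x ∂iidLaw ν = 0)
    (hg0 : ∫ x, g x ∂iidLaw ν = 0) (hfs : innovSum ν p f ≠ ∞) (hgs : innovSum ν p g ≠ ∞)
    (B : ℝ) (T : ℕ) (lam : ℝ) :
    eLpNorm (fun x => quad (lagWeight K B T lam) T f g x - limitForm ν f g lam)
      (ENNReal.ofReal (p / 2)) (iidLaw ν) ≤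
    ∑' kl : ℕ × ℕ, eLpNorm (formDev ν K B T kl.1 kl.2 lam (innov ν kl.1 f) (innov ν kl.2 g))
      (ENNReal.ofReal (p / 2)) (iidLaw ν) := by
  have hq : 1 ≤ ENNReal.ofReal (p / 2) := one_le_ofReal (by linarith)
  set W := lagWeight K B T lam with hW
  set A : ℝ≥0∞ := ∑ a ∈ Finset.range T, ∑ b ∈ Finset.range T, ‖W ((a : ℤ) - b)‖ₑ with hA
  have hAtop : A ≠ ∞ :=
    (ENNReal.sum_lt_top.2 fun a _ => ENNReal.sum_lt_top.2 fun b _ => enorm_lt_top).ne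
  set r := fun m => eLpNorm (fun x => f x - truncated ν m f x) (ENNReal.ofReal p) (iidLaw ν) with hr
  set r' := fun m => eLpNorm (fun x => g x - truncated ν m g x) (ENNReal.ofReal p) (iidLaw ν)
    with hr'
  set s : ℕ → Finset (ℕ × ℕ) := fun m => Finset.range m ×ˢ Finset.range m with hs
  set Φ : ℕ → ℂ := fun m => ∑ kl ∈ s m, limitPhase kl.1 kl.2 lam * innovCov ν f g kl with hΦ
  set S := ∑' kl : ℕ × ℕ, eLpNorm (formDev ν K B T kl.1 kl.2 lam (innov ν kl.1 f)
    (innov ν kl.2 g)) (ENNReal.ofReal (p / 2)) (iidLaw ν) with hS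
  have hbound : ∀ m, eLpNorm (fun x => quad W T f g x - limitForm ν f g lam)
      (ENNReal.ofReal (p / 2)) (iidLaw ν) ≤
      A * (r m * eLpNorm g (ENNReal.ofReal p) (iidLaw ν)) +
      A * (2 * eLpNorm f (ENNReal.ofReal p) (iidLaw ν) * r' m) + S +
      ‖Φ m - limitForm ν f g lam‖ₑ := fun m => by
    have hfm := memLp_truncated hp hf m
    have hgm := memLp_truncated hp hg m
    have hdev : ∀ kl : ℕ × ℕ, AEStronglyMeasurable (formDev ν K B T kl.1 kl.2 lam
        (innov ν kl.1 f) (innov ν kl.2 g)) (iidLaw ν) := fun kl =>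
      aestronglyMeasurable_formDev (isMartingaleDiff_innov hp hf kl.1).1.1
        (isMartingaleDiff_innov hp hg kl.2).1.1 _ _ _ _ _
    have hsplit : (fun x => quad W T f g x - limitForm ν f g lam) =
        quad W T (fun x => f x - truncated ν m f x) g +
        quad W T (truncated ν m f) (fun x => g x - truncated ν m g x) +
        ∑ kl ∈ s m, formDev ν K B T kl.1 kl.2 lam (innov ν kl.1 f) (innov ν kl.2 g) +
        fun _ => Φ m - limitForm ν f g lam := by
      ext x
      simp only [Pi.add_apply]
      rw [Finset.sum_apply, ← quad_truncated_sub, quad_sub_left, quad_sub_right]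
      ring
    have hm1 : AEStronglyMeasurable (quad W T (fun x => f x - truncated ν m f x) g) (iidLaw ν) :=
      aestronglyMeasurable_quad (hf.sub hfm).1 hg.1 W T
    have hm2 : AEStronglyMeasurable (quad W T (truncated ν m f) (fun x => g x - truncated ν m g x))
      (iidLaw ν) := aestronglyMeasurable_quad hfm.1 (hg.sub hgm).1 W T
    have hm3 : AEStronglyMeasurable (∑ kl ∈ s m, formDev ν K B T kl.1 kl.2 lam (innov ν kl.1 f)
      (innov ν kl.2 g)) (iidLaw ν) := Finset.aestronglyMeasurable_sum _ fun kl _ => hdev kl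
    have h1 : eLpNorm (quad W T (fun x => f x - truncated ν m f x) g) (ENNReal.ofReal (p / 2))
        (iidLaw ν) ≤ A * (r m * eLpNorm g (ENNReal.ofReal p) (iidLaw ν)) :=
      eLpNorm_quad_le_sum hp (hf.sub hfm) hg W T
    have h2 : eLpNorm (quad W T (truncated ν m f) (fun x => g x - truncated ν m g x))
        (ENNReal.ofReal (p / 2)) (iidLaw ν) ≤
        A * (2 * eLpNorm f (ENNReal.ofReal p) (iidLaw ν) * r' m) := by
      refine (eLpNorm_quad_le_sum hp hfm (hg.sub hgm) W T).trans ?_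
      gcongr
      · exact eLpNorm_truncated_le hp hf m
      · exact le_rfl
    have h3 : eLpNorm (∑ kl ∈ s m, formDev ν K B T kl.1 kl.2 lam (innov ν kl.1 f)
        (innov ν kl.2 g)) (ENNReal.ofReal (p / 2)) (iidLaw ν) ≤ S :=
      (MeasureTheory.eLpNorm_sum_le (fun kl _ => hdev kl) hq).trans (ENNReal.sum_le_tsum _)
    rw [hsplit]
    refine (eLpNorm_add_le ((hm1.add hm2).add hm3) aestronglyMeasurable_const hq).trans ?_
    refine add_le_add ((eLpNorm_add_le (hm1.add hm2) hm3 hq).trans (add_le_add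
      ((eLpNorm_add_le hm1 hm2 hq).trans (add_le_add h1 h2)) h3)) ?_
    exact (eLpNorm_fun_const_le hq _).le
  have hr0 : Tendsto r atTop (𝓝 0) := tendsto_eLpNorm_sub_truncated hp hf hf0
  have hr0' : Tendsto r' atTop (𝓝 0) := tendsto_eLpNorm_sub_truncated hp hg hg0
  have hl1 : Tendsto (fun m => A * (r m * eLpNorm g (ENNReal.ofReal p) (iidLaw ν))) atTop (𝓝 0) := by
    have := ENNReal.Tendsto.const_mul (a := A)
      (ENNReal.Tendsto.mul_const hr0 (Or.inr hg.2.ne)) (Or.inr hAtop)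
    simpa using this
  have hl2 : Tendsto (fun m => A * (2 * eLpNorm f (ENNReal.ofReal p) (iidLaw ν) * r' m)) atTop
      (𝓝 0) := by
    have h2 : 2 * eLpNorm f (ENNReal.ofReal p) (iidLaw ν) ≠ ∞ :=
      ENNReal.mul_ne_top ENNReal.ofNat_ne_top hf.2.ne
    have := ENNReal.Tendsto.const_mul (a := A) (ENNReal.Tendsto.const_mul hr0'
      (Or.inr h2)) (Or.inr hAtop)
    simpa using this
  have hl3 : Tendsto (fun m => ‖Φ m - limitForm ν f g lam‖ₑ) atTop (𝓝 0) := by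
    have h1 : Tendsto Φ atTop (𝓝 (limitForm ν f g lam)) :=
      (summable_limitPhase_mul hp hf hg hfs hgs lam).hasSum.comp tendsto_finset_range_product
    have h2 := (h1.sub_const (limitForm ν f g lam)).enorm
    simpa using h2
  have hl := ((hl1.add hl2).add (tendsto_const_nhds (x := S))).add hl3
  simp only [zero_add, add_zero] at hl
  exact ge_of_tendsto' hl hbound

/-- Uniform convergence of the lag-window form to its limit. -/
theorem tendsto_iSup_quad_sub_limitForm (hp : 2 ≤ p) (hK : IsFourierKernel K κ)
    (hf : MemLp f (ENNReal.ofReal p) (iidLaw ν)) (hg : MemLp g (ENNReal.ofReal p) (iidLaw ν))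
    (hf0 : ∫ x, f x ∂iidLaw ν = 0) (hg0 : ∫ x, g x ∂iidLaw ν = 0)
    (hfs : innovSum ν p f ≠ ∞) (hgs : innovSum ν p g ≠ ∞)
    {B : ℕ → ℝ} (hB0 : ∀ T : ℕ, 1 ≤ T → 0 < B T)
    (hB1 : Tendsto (fun T : ℕ => 1 / B T) atTop (𝓝 0))
    (hB2 : Tendsto (fun T : ℕ => B T / T) atTop (𝓝 0)) :
    Tendsto (fun T : ℕ => ⨆ lam : ℝ,
      eLpNorm (fun x => quad (lagWeight K (B T) T lam) T f g x - limitForm ν f g lam)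
        (ENNReal.ofReal (p / 2)) (iidLaw ν)) atTop (𝓝 0) := by
  obtain ⟨c, hc⟩ := exists_realNorm_sum_sq_le (ν := ν) hp
  have hc : IsBurkholderConst ν p c := hc
  set C : ℝ≥0∞ := (∫⁻ x, ‖κ x‖ₑ) * ENNReal.ofReal c + 1 with hC
  have hCtop : C ≠ ∞ := ENNReal.add_ne_top.2
    ⟨ENNReal.mul_ne_top hK.integrable.2.ne ENNReal.ofReal_ne_top, ENNReal.one_ne_top⟩
  set A : ℕ → ℕ × ℕ → ℝ≥0∞ := fun T kl => ⨆ lam : ℝ, eLpNorm (formDev ν K (B T) T kl.1 kl.2 lam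
    (innov ν kl.1 f) (innov ν kl.2 g)) (ENNReal.ofReal (p / 2)) (iidLaw ν) with hA
  have hdom : ∀ T kl, A T kl ≤ C * (eLpNorm (innov ν kl.1 f) (ENNReal.ofReal p) (iidLaw ν) *
      eLpNorm (innov ν kl.2 g) (ENNReal.ofReal p) (iidLaw ν)) := fun T kl =>
    iSup_le fun lam => hc.eLpNorm_formDev_le hp hK (isMartingaleDiff_innov hp hf kl.1)
      (isMartingaleDiff_innov hp hg kl.2) _ _ _ _ _
  have hlim : Tendsto (fun T => ∑' kl, A T kl) atTop (𝓝 0) := by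
    simp only [← lintegral_count]
    have h := tendsto_lintegral_filter_of_dominated_convergence (μ := Measure.count)
      (F := A) (f := fun _ => 0) (l := atTop) (fun kl => C * (eLpNorm (innov ν kl.1 f)
        (ENNReal.ofReal p) (iidLaw ν) * eLpNorm (innov ν kl.2 g) (ENNReal.ofReal p) (iidLaw ν)))
      (Eventually.of_forall fun T => Measurable.of_discrete)
      (Eventually.of_forall fun T => ae_of_all _ (hdom T)) ?_ ?_
    · simpa using h
    · rw [lintegral_count, ENNReal.tsum_mul_left, tsum_innov_mul]
      exact ENNReal.mul_ne_top hCtop (ENNReal.mul_ne_top hfs hgs)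
    · exact ae_of_all _ fun kl => hc.tendsto_iSup_formDev hp hK hB0 hB1 hB2
        (isMartingaleDiff_innov hp hf kl.1) (isMartingaleDiff_innov hp hg kl.2) _ _
  refine tendsto_of_tendsto_of_tendsto_of_le_of_le tendsto_const_nhds hlim
    (fun _ => zero_le) fun T => iSup_le fun lam => ?_
  refine (eLpNorm_quad_sub_limitForm_le hp hf hg hf0 hg0 hfs hgs (B T) T lam).trans ?_
  exact ENNReal.tsum_le_tsum fun kl => le_iSup (fun lam => eLpNorm (formDev ν K (B T) T kl.1 kl.2
    lam (innov ν kl.1 f) (innov ν kl.2 g)) (ENNReal.ofReal (p / 2)) (iidLaw ν)) lam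

end Series

section Covariance

variable {E : Type*} [MeasurableSpace E] {ν : Measure E} [IsProbabilityMeasure ν] {p : ℝ}
  {d d' f g : (ℕ → E) → ℂ}

theorem integral_shift_mul_shift_of_lt (hp : 2 ≤ p) (hd : IsMartingaleDiff ν p d)
    (hd' : MemLp d' (ENNReal.ofReal p) (iidLaw ν)) {n m : ℕ} (h : n < m) :
    ∫ x, d (shift^[n] x) * d' (shift^[m] x) ∂iidLaw ν = 0 := by
  obtain ⟨j, rfl⟩ := Nat.exists_eq_add_of_lt h
  have hm := memLp_comp_shift hd' (j + 1)
  have hi := integrable_mul_of_memLp hp hm hd.1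
  have h1 : ∀ x, d (shift^[n] x) * d' (shift^[n + j + 1] x) =
      (fun y => d' (shift^[j + 1] y) * d y) (shift^[n] x) := fun x => by
    simp only
    rw [← Function.iterate_add_apply, mul_comm]
    congr 3
    omega
  simp only [h1]
  rw [integral_comp_shift (fun y => d' (shift^[j + 1] y) * d y) hi.1 n]
  exact integral_shift_mul_eq_zero (f := fun y => d' (shift^[j] y)) hd.2 hi

theorem integral_shift_mul_shift (hp : 2 ≤ p) (hd : IsMartingaleDiff ν p d)
    (hd' : IsMartingaleDiff ν p d') (n m : ℕ) :
    ∫ x, d (shift^[n] x) * d' (shift^[m] x) ∂iidLaw ν =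
      if n = m then ∫ x, d x * d' x ∂iidLaw ν else 0 := by
  rcases lt_trichotomy n m with h | h | h
  · rw [if_neg h.ne, integral_shift_mul_shift_of_lt hp hd hd'.1 h]
  · subst h
    rw [if_pos rfl]
    exact integral_comp_shift (fun y => d y * d' y) (hd.1.1.mul hd'.1.1) n
  · rw [if_neg h.ne', ← integral_shift_mul_shift_of_lt hp hd' hd.1 h]
    simp only [mul_comm]

/-- The covariance of `f` and `g` at two places in terms of the innovations. -/
theorem integral_shift_mul_shift_eq_tsum (hp : 2 ≤ p)
    (hf : MemLp f (ENNReal.ofReal p) (iidLaw ν)) (hg : MemLp g (ENNReal.ofReal p) (iidLaw ν))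
    (hf0 : ∫ x, f x ∂iidLaw ν = 0) (hg0 : ∫ x, g x ∂iidLaw ν = 0)
    (hfs : innovSum ν p f ≠ ∞) (hgs : innovSum ν p g ≠ ∞) (a b : ℕ) :
    ∫ x, f (shift^[a] x) * g (shift^[b] x) ∂iidLaw ν =
      ∑' kl : ℕ × ℕ, if (kl.2 : ℤ) - kl.1 = a - b then innovCov ν f g kl else 0 := by
  set c : ℕ × ℕ → ℂ := fun kl => if (kl.2 : ℤ) - kl.1 = a - b then innovCov ν f g kl else 0 with hc
  have hsum : Summable c := by
    refine Summable.of_norm_bounded (summable_norm_innovCov hp hf hg hfs hgs) fun kl => ?_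
    rw [hc]
    simp only
    split_ifs <;> simp
  have hfa := memLp_comp_shift hf a
  have hgb := memLp_comp_shift hg b
  have hfin : ∀ m, ∫ x, truncated ν m f (shift^[a] x) * truncated ν m g (shift^[b] x) ∂iidLaw ν =
      ∑ kl ∈ Finset.range m ×ˢ Finset.range m, c kl := fun m => by
    have hi : ∀ k l, Integrable (fun x => innov ν k f (shift^[a + k] x) *
        innov ν l g (shift^[b + l] x)) (iidLaw ν) := fun k l =>
      integrable_mul_of_memLp hp (memLp_comp_shift (isMartingaleDiff_innov hp hf k).1 (a + k))
        (memLp_comp_shift (isMartingaleDiff_innov hp hg l).1 (b + l))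
    have h1 : ∀ x, truncated ν m f (shift^[a] x) * truncated ν m g (shift^[b] x) =
        ∑ k ∈ Finset.range m, ∑ l ∈ Finset.range m,
          innov ν k f (shift^[a + k] x) * innov ν l g (shift^[b + l] x) := fun x => by
      rw [truncated, truncated, Finset.sum_mul_sum]
      refine Finset.sum_congr rfl fun k _ => Finset.sum_congr rfl fun l _ => ?_
      rw [add_comm a k, add_comm b l, Function.iterate_add_apply, Function.iterate_add_apply]
    simp only [h1]
    rw [integral_finsetSum _ fun k _ => integrable_finsetSum _ fun l _ => hi k l,
      Finset.sum_product]
    refine Finset.sum_congr rfl fun k _ => ?_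
    rw [integral_finsetSum _ fun l _ => hi k l]
    refine Finset.sum_congr rfl fun l _ => ?_
    rw [integral_shift_mul_shift hp (isMartingaleDiff_innov hp hf k)
      (isMartingaleDiff_innov hp hg l), hc]
    simp only [innovCov]
    by_cases h : a + k = b + l
    · rw [if_pos h, if_pos (by omega)]
    · rw [if_neg h, if_neg (by omega)]
  have hlim1 : Tendsto (fun m => ∫ x, truncated ν m f (shift^[a] x) *
      truncated ν m g (shift^[b] x) ∂iidLaw ν) atTop (𝓝 (∑' kl, c kl)) := by
    simp only [hfin]
    exact hsum.hasSum.comp tendsto_finset_range_product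
  have hlim2 : Tendsto (fun m => ∫ x, truncated ν m f (shift^[a] x) *
      truncated ν m g (shift^[b] x) ∂iidLaw ν) atTop
      (𝓝 (∫ x, f (shift^[a] x) * g (shift^[b] x) ∂iidLaw ν)) := by
    rw [tendsto_iff_edist_tendsto_0]
    have hr0 := tendsto_eLpNorm_sub_truncated hp hf hf0
    have hr0' := tendsto_eLpNorm_sub_truncated hp hg hg0
    have hl := (ENNReal.Tendsto.mul_const hr0 (Or.inr hg.2.ne)).add
      (ENNReal.Tendsto.const_mul (a := 2 * eLpNorm f (ENNReal.ofReal p) (iidLaw ν)) hr0'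
      (Or.inr (ENNReal.mul_ne_top ENNReal.ofNat_ne_top hf.2.ne)))
    simp only [zero_mul, mul_zero, add_zero] at hl
    refine tendsto_of_tendsto_of_tendsto_of_le_of_le tendsto_const_nhds hl
      (fun _ => zero_le) fun m => ?_
    have hfm := memLp_truncated hp hf m
    have hgm := memLp_truncated hp hg m
    have hfma := memLp_comp_shift hfm a
    have hgmb := memLp_comp_shift hgm b
    have hdf : MemLp (fun x => f x - truncated ν m f x) (ENNReal.ofReal p) (iidLaw ν) := hf.sub hfm
    have hdg : MemLp (fun x => g x - truncated ν m g x) (ENNReal.ofReal p) (iidLaw ν) := hg.sub hgm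
    have hdfa := memLp_comp_shift hdf a
    have hdgb := memLp_comp_shift hdg b
    have h1 := enorm_integral_mul_le hp hdfa hgb
    have h2 := enorm_integral_mul_le hp hfma hdgb
    rw [eLpNorm_comp_shift hdf.1, eLpNorm_comp_shift hg.1] at h1
    rw [eLpNorm_comp_shift hfm.1, eLpNorm_comp_shift hdg.1] at h2
    have h3 : ∫ x, f (shift^[a] x) * g (shift^[b] x) ∂iidLaw ν -
        ∫ x, truncated ν m f (shift^[a] x) * truncated ν m g (shift^[b] x) ∂iidLaw ν =
        ∫ x, (f (shift^[a] x) - truncated ν m f (shift^[a] x)) * g (shift^[b] x) ∂iidLaw ν +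
        ∫ x, truncated ν m f (shift^[a] x) *
          (g (shift^[b] x) - truncated ν m g (shift^[b] x)) ∂iidLaw ν := by
      rw [← integral_sub (integrable_mul_of_memLp hp hfa hgb)
        (integrable_mul_of_memLp hp hfma hgmb),
        ← integral_add (integrable_mul_of_memLp hp hdfa hgb)
        (integrable_mul_of_memLp hp hfma hdgb)]
      congr 1
      ext x
      ring
    rw [edist_comm, edist_eq_enorm_sub, h3]
    refine (enorm_add_le _ _).trans (add_le_add h1 (h2.trans ?_))
    gcongr
    exact eLpNorm_truncated_le hp hf m
  exact tendsto_nhds_unique hlim2 hlim1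

/-- Autocovariances that are given by the innovations are summable, and their Fourier series is
the limit of the lag-window form. -/
theorem summable_and_tsum_eq_limitForm (hp : 2 ≤ p)
    (hf : MemLp f (ENNReal.ofReal p) (iidLaw ν)) (hg : MemLp g (ENNReal.ofReal p) (iidLaw ν))
    (hfs : innovSum ν p f ≠ ∞) (hgs : innovSum ν p g ≠ ∞) {γ : ℤ → ℂ}
    (hγ : ∀ u, γ u = ∑' kl : ℕ × ℕ, if (kl.2 : ℤ) - kl.1 = u then innovCov ν f g kl else 0) :
    (Summable fun u => ‖γ u‖) ∧ ∀ lam : ℝ, 1 / (2 * (Real.pi : ℂ)) *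
      ∑' u : ℤ, Complex.exp (-(Complex.I * (u : ℂ) * (lam : ℂ))) * γ u = limitForm ν f g lam := by
  set s : ℕ × ℕ → ℤ := fun kl => (kl.2 : ℤ) - kl.1 with hs
  have hfib : ∀ u, γ u = ∑' kl : s ⁻¹' {u}, innovCov ν f g kl := fun u => by
    rw [hγ, tsum_subtype]
    refine tsum_congr fun kl => ?_
    simp [Set.indicator, hs]
  have hsn := summable_norm_innovCov hp hf hg hfs hgs
  refine ⟨?_, fun lam => ?_⟩
  · have h1 := (hsn.hasSum.tsum_fiberwise s).summable
    refine Summable.of_nonneg_of_le (fun _ => norm_nonneg _) (fun u => ?_) h1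
    rw [hfib]
    exact norm_tsum_le_tsum_norm (hsn.comp_injective Subtype.val_injective)
  · have h1 := ((summable_limitPhase_mul hp hf hg hfs hgs lam).hasSum.tsum_fiberwise s).tsum_eq
    rw [limitForm, ← h1, ← tsum_mul_left]
    refine tsum_congr fun u => ?_
    rw [hfib, ← tsum_mul_left, ← tsum_mul_left]
    refine tsum_congr fun kl => ?_
    have hu : (((kl : ℕ × ℕ).2 : ℤ) - (kl : ℕ × ℕ).1) = u := kl.2
    rw [limitPhase, hu]
    ring

end Covariance

open SchwartzMap in
/-- A continuous square integrable function whose `L²` Fourier transform is integrable is given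
everywhere by the Fourier inversion formula. -/
theorem eq_fourierInv_of_integrable_fourier {K : ℝ → ℂ} (hc : Continuous K)
    (h : MemLp K 2 (volume : Measure ℝ))
    (hi : Integrable (𝓕 (h.toLp K) : Lp ℂ 2 (volume : Measure ℝ))) (y : ℝ) :
    K y = 𝓕⁻ ((𝓕 (h.toLp K) : Lp ℂ 2 (volume : Measure ℝ)) : ℝ → ℂ) y := by
  set κ := (𝓕 (h.toLp K) : Lp ℂ 2 (volume : Measure ℝ)) with hκ
  have hflip (ψ : 𝓢(ℝ, ℂ)) : ∫ x, (𝓕 ψ) x * K x = ∫ x, ψ x * κ x := by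
    have h1 := DFunLike.congr_fun (Lp.fourier_toTemperedDistribution_eq (h.toLp K)) ψ
    rw [TemperedDistribution.fourier_apply, Lp.toTemperedDistribution_apply,
      Lp.toTemperedDistribution_apply] at h1
    simp only [smul_eq_mul] at h1
    rw [← h1]
    refine integral_congr_ae ?_
    filter_upwards [h.coeFn_toLp] with x hx
    rw [hx]
  have hinv (ψ : 𝓢(ℝ, ℂ)) : ∫ x, ψ x * 𝓕⁻ (κ : ℝ → ℂ) x = ∫ x, (𝓕⁻ ψ) x * κ x := by
    have := VectorFourier.integral_fourierIntegral_smul_eq_flip (L := -innerₗ ℝ)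
      (μ := volume) (ν := volume) Real.continuous_fourierChar
      (by simp only [LinearMap.neg_apply, innerₗ_apply_apply]; fun_prop) ψ.integrable hi
    have e1 : ∀ x, (𝓕⁻ ψ) x = VectorFourier.fourierIntegral Real.fourierChar volume (-innerₗ ℝ) ψ x := by
      intro x
      rw [fourierInv_coe]
      rfl
    have e2 : ∀ x, 𝓕⁻ (κ : ℝ → ℂ) x =
        VectorFourier.fourierIntegral Real.fourierChar volume (-innerₗ ℝ).flip κ x := by
      intro x
      rw [Real.fourierInv_eq, VectorFourier.fourierIntegral]
      simp [mul_comm]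
    simp_rw [e1, e2]
    simpa using this.symm
  have hcont : Continuous (𝓕⁻ (κ : ℝ → ℂ)) :=
    VectorFourier.fourierIntegral_continuous (L := -innerₗ ℝ) Real.continuous_fourierChar
      (by simp only [LinearMap.neg_apply, innerₗ_apply_apply]; fun_prop) hi
  refine congrFun ((hc.ae_eq_iff_eq volume hcont).1 ?_) y
  refine ae_eq_of_integral_contDiff_smul_eq hc.locallyIntegrable hcont.locallyIntegrable
    fun g hg hgc => ?_
  have hg₁ : HasCompactSupport (Complex.ofRealCLM ∘ g) := hgc.comp_left rfl
  have hg₂ : ContDiff ℝ ((⊤ : ℕ∞) : WithTop ℕ∞) (Complex.ofRealCLM ∘ g) := Complex.ofRealCLM.contDiff.comp hg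
  set φ : 𝓢(ℝ, ℂ) := hg₁.toSchwartzMap hg₂ with hφ
  have hφg : ∀ x, φ x = (g x : ℂ) := fun x => by simp [hφ]
  have h1 := hflip (𝓕⁻ φ)
  rw [FourierTransform.fourier_fourierInv_eq, ← hinv φ] at h1
  simpa [hφg] using h1

theorem IsLagKernel.exists_isFourierKernel {K : ℝ → ℝ} (hK : IsLagKernel K) :
    ∃ κ : ℝ → ℂ, IsFourierKernel K κ := by
  obtain ⟨h, hi⟩ := hK.fourier_integrable
  have heq (y : ℝ) : (K y : ℂ) = 𝓕⁻ ((𝓕 (h.toLp fun u => (K u : ℂ)) :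
      Lp ℂ 2 (volume : Measure ℝ)) : ℝ → ℂ) y :=
    eq_fourierInv_of_integrable_fourier (Complex.continuous_ofReal.comp hK.continuous) h hi y
  refine ⟨_, hK.map_zero, hK.continuous, hi, fun y => ?_, ?_⟩
  · rw [heq y, Real.fourierInv_eq']
    refine integral_congr_ae (Eventually.of_forall fun x => ?_)
    simp only [smul_eq_mul, RCLike.inner_apply, conj_trivial]
    rw [mul_comm]
    congr 4
    ring
  · have h1 : Tendsto (fun y => (K y : ℂ)) (cocompact ℝ) (𝓝 0) := by
      have h2 := (Real.zero_at_infty_fourier ((𝓕 (h.toLp fun u => (K u : ℂ)) :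
        Lp ℂ 2 (volume : Measure ℝ)) : ℝ → ℂ)).comp
          (Homeomorph.neg ℝ).isClosedEmbedding.tendsto_cocompact
      refine h2.congr fun y => ?_
      rw [heq y, Real.fourierInv_eq_fourier_neg]
      rfl
    exact (Complex.continuous_re.tendsto 0).comp h1

section History

variable {Ω : Type*} {b n : ℕ} {R : (ℕ → Fin b → ℝ) → Fin n → ℝ} {ε ε' : ℤ → Ω → Fin b → ℝ}

/-- The past of the innovations at time `t`, most recent first. -/
def history {Ω : Type*} {b : ℕ} (ε : ℤ → Ω → Fin b → ℝ) (t : ℤ) (ω : Ω) : ℕ → Fin b → ℝ :=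
  fun k => ε (t - k) ω

/-- A coordinate of `R` as a complex function of the past. -/
def coordinate {b n : ℕ} (R : (ℕ → Fin b → ℝ) → Fin n → ℝ) (i : Fin n) (x : ℕ → Fin b → ℝ) : ℂ :=
  (R x i : ℂ)

theorem measurable_coordinate (hR : Measurable R) (i : Fin n) : Measurable (coordinate R i) :=
  Complex.measurable_ofReal.comp ((measurable_pi_apply i).comp hR)

theorem coordinate_history (i : Fin n) (t : ℤ) (ω : Ω) :
    coordinate R i (history ε t ω) = (causalProcess R ε t ω i : ℂ) := rfl

theorem shift_iterate_history (s : ℕ) (t : ℤ) (ω : Ω) :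
    shift^[s] (history ε t ω) = history ε (t - s) ω := by
  ext k : 1
  rw [shift_iterate_apply, history, history]
  congr 1
  push_cast
  ring

theorem sum_lags_eq {M : Type*} [AddCommMonoid M] (T : ℕ) (G : ℤ → ℤ → M) :
    ∑ u ∈ Finset.Icc (-(T : ℤ) + 1) ((T : ℤ) - 1),
      ∑ t ∈ (Finset.Icc (1 : ℤ) T).filter (fun t => t + u ∈ Finset.Icc (1 : ℤ) T), G t (t + u) =
    ∑ a ∈ Finset.range T, ∑ b ∈ Finset.range T, G ((T : ℤ) - a) ((T : ℤ) - b) := by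
  rw [Finset.sum_sigma', ← Finset.sum_product']
  refine Finset.sum_nbij' (fun x => (((T : ℤ) - x.2).toNat, ((T : ℤ) - (x.2 + x.1)).toNat))
    (fun y => ⟨(y.1 : ℤ) - y.2, (T : ℤ) - y.1⟩) ?_ ?_ ?_ ?_ ?_
  · rintro ⟨u, t⟩ h
    simp only [Finset.mem_sigma, Finset.mem_filter, Finset.mem_Icc] at h
    simp only [Finset.mem_product, Finset.mem_range]
    omega
  · rintro ⟨a, b⟩ h
    simp only [Finset.mem_product, Finset.mem_range] at h
    simp only [Finset.mem_sigma, Finset.mem_filter, Finset.mem_Icc]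
    omega
  · rintro ⟨u, t⟩ h
    simp only [Finset.mem_sigma, Finset.mem_filter, Finset.mem_Icc] at h
    simp only [Sigma.mk.injEq, heq_eq_eq]
    omega
  · rintro ⟨a, b⟩ h
    simp only [Prod.mk.injEq]
    omega
  · rintro ⟨u, t⟩ h
    simp only [Finset.mem_sigma, Finset.mem_filter, Finset.mem_Icc] at h
    dsimp only
    congr 1 <;> omega

/-- The spectral estimate is a Toeplitz quadratic form in the innovations. -/
theorem specEstimate_eq_quad (K : ℝ → ℝ) (B : ℝ) (T : ℕ) (i j : Fin n) (lam : ℝ) (ω : Ω) :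
    specEstimate K B (causalProcess R ε) T i j lam ω =
      quad (lagWeight K B T lam) T (coordinate R i) (coordinate R j) (history ε T ω) := by
  simp only [quad, shift_iterate_history, coordinate_history]
  have h := sum_lags_eq T fun t s => lagWeight K B T lam (s - t) *
    ((causalProcess R ε t ω i : ℂ) * (causalProcess R ε s ω j : ℂ))
  simp only [sub_sub_sub_cancel_left] at h
  rw [← h, specEstimate, Finset.mul_sum]
  refine Finset.sum_congr rfl fun u _ => ?_
  rw [sampleAutocov, Complex.ofReal_mul, Complex.ofReal_sum, Finset.mul_sum, Finset.mul_sum,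
    Finset.mul_sum]
  refine Finset.sum_congr rfl fun t _ => ?_
  rw [add_sub_cancel_left, lagWeight]
  push_cast
  ring

variable [MeasurableSpace Ω] {P : Measure Ω} [IsProbabilityMeasure P]
  [IsProbabilityMeasure (P.map (ε 0))] {p : ℝ}

theorem IsIIDPair.measurePreserving_reindex (hε : IsIIDPair P ε ε') {g : ℕ → ℤ ⊕ ℤ}
    (hg : Function.Injective g) :
    MeasurePreserving (fun ω k => Sum.elim ε ε' (g k) ω) P (iidLaw (P.map (ε 0))) := by
  have hX : ∀ i, Measurable (Sum.elim ε ε' i) := by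
    rintro (t | t)
    exacts [hε.measurable t, hε.measurable' t]
  refine ⟨measurable_pi_lambda _ fun k => hX (g k), map_eq_iidLaw hX ?_ hε.indep hg⟩
  rintro (t | t)
  exacts [(hε.identDistrib t).map_eq, (hε.identDistrib' t).map_eq]

theorem IsIIDPair.measurePreserving_history (hε : IsIIDPair P ε ε') (t : ℤ) :
    MeasurePreserving (history ε t) P (iidLaw (P.map (ε 0))) := by
  refine hε.measurePreserving_reindex (g := fun k : ℕ => Sum.inl (t - k)) fun k l h => ?_
  have := Sum.inl_injective h
  omega

theorem IsIIDPair.depMeasure_eq (hε : IsIIDPair P ε ε') (hR : Measurable R) (i : Fin n) (t : ℕ) :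
    depMeasure P R ε ε' p i t =
      eLpNorm (copyDiff t (coordinate R i)) (ENNReal.ofReal p) (iidLaw (P.map (ε 0))) := by
  set g : ℕ → ℤ ⊕ ℤ := fun k => Nat.casesOn k (Sum.inr 0) fun l => Sum.inl ((t : ℤ) - l) with hg
  have hginj : Function.Injective g := by
    rintro (_ | k) (_ | l) h
    · rfl
    · simp [hg] at h
    · simp [hg] at h
    · simp only [hg, Sum.inl.injEq] at h
      omega
  have hmp := hε.measurePreserving_reindex hginj
  rw [depMeasure, ← eLpNorm_comp_measurePreserving
    (aestronglyMeasurable_copyDiff t (measurable_coordinate hR i).aestronglyMeasurable) hmp]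
  refine eLpNorm_congr_norm_ae (Eventually.of_forall fun ω => ?_)
  have h1 : shift (fun k => Sum.elim ε ε' (g k) ω) = history ε t ω := by
    ext k : 1
    simp [shift, hg, history]
  have h2 : replaceAt t (fun k => Sum.elim ε ε' (g k) ω) =
      fun k : ℕ => Function.update ε 0 (ε' 0) ((t : ℤ) - k) ω := by
    rw [replaceAt, h1]
    ext k : 1
    by_cases hk : k = t
    · subst hk
      simp [hg]
    · have : (t : ℤ) - k ≠ 0 := by omega
      rw [Function.update_of_ne hk, Function.update_of_ne this, history]
  rw [Function.comp_apply, copyDiff, h1, h2, coordinate_history, coordinate, ← Complex.ofReal_sub,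
    Complex.norm_real]
  rfl

theorem IsIIDPair.memLp_coordinate (hε : IsIIDPair P ε ε') (hR : Measurable R) (hp : 0 < p)
    (h : vecNorm P p (causalProcess R ε 0) < ∞) (i : Fin n) :
    MemLp (coordinate R i) (ENNReal.ofReal p) (iidLaw (P.map (ε 0))) := by
  rw [← (hε.measurePreserving_history 0).map_eq]
  rw [memLp_map_measure_iff (measurable_coordinate hR i).aestronglyMeasurable
    (hε.measurePreserving_history 0).measurable.aemeasurable]
  refine ⟨((measurable_coordinate hR i).comp
    (hε.measurePreserving_history 0).measurable).aestronglyMeasurable, ?_⟩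
  rw [eLpNorm_lt_top_iff_lintegral_rpow_enorm_lt_top (by simpa using hp) ENNReal.ofReal_ne_top,
    ENNReal.toReal_ofReal hp.le]
  rw [vecNorm, ENNReal.rpow_lt_top_iff_of_pos (by positivity)] at h
  refine lt_of_eq_of_lt ?_ ((ENNReal.sum_lt_top.1 h) i (Finset.mem_univ i))
  refine lintegral_congr fun ω => ?_
  rw [Function.comp_apply, coordinate_history, ← ofReal_norm, Complex.norm_real, ofReal_norm]

theorem IsIIDPair.integral_coordinate (hε : IsIIDPair P ε ε') (hR : Measurable R) {i : Fin n}
    (h : ∫ ω, causalProcess R ε 0 ω i ∂P = 0) :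
    ∫ x, coordinate R i x ∂iidLaw (P.map (ε 0)) = 0 := by
  rw [← (hε.measurePreserving_history 0).map_eq,
    integral_map (hε.measurePreserving_history 0).measurable.aemeasurable
      (measurable_coordinate hR i).aestronglyMeasurable]
  simp only [coordinate_history]
  rw [integral_complex_ofReal, h, Complex.ofReal_zero]

theorem IsIIDPair.innovSum_le (hε : IsIIDPair P ε ε')
    (hR : Measurable R) (hp : 1 ≤ p) {i : Fin n}
    (hf : MemLp (coordinate R i) (ENNReal.ofReal p) (iidLaw (P.map (ε 0)))) :
    innovSum (P.map (ε 0)) p (coordinate R i) ≤ cumDep P R ε ε' 0 p := by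
  refine le_iSup_of_le i (ENNReal.tsum_le_tsum fun t => ?_)
  rw [zero_add, hε.depMeasure_eq hR]
  exact eLpNorm_innov_le (one_le_ofReal hp) ENNReal.ofReal_ne_top hf t

/-- The autocovariance as an integral over the space of innovations. -/
theorem IsIIDPair.autocov_eq (hε : IsIIDPair P ε ε') (hR : Measurable R) (i j : Fin n)
    (a c : ℕ) :
    (autocov P (causalProcess R ε) i j ((a : ℤ) - c) : ℂ) =
      ∫ x, coordinate R i (shift^[a] x) * coordinate R j (shift^[c] x) ∂iidLaw (P.map (ε 0)) := by
  have hmp := hε.measurePreserving_history a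
  have hm : ∀ (k : ℕ) (i : Fin n), Measurable fun x => coordinate R i (shift^[k] x) := fun k i =>
    (measurable_coordinate hR i).comp (measurable_shift.iterate k)
  have hm' : Measurable fun x => coordinate R i (shift^[a] x) * coordinate R j (shift^[c] x) :=
    (hm a i).mul (hm c j)
  rw [← hmp.map_eq, integral_map hmp.measurable.aemeasurable hm'.aestronglyMeasurable, autocov, ← integral_complex_ofReal]
  simp only [shift_iterate_history, coordinate_history, sub_self, Complex.ofReal_mul]

end History

end LagWindow

theorem theorem3 {Ω : Type*} [MeasurableSpace Ω] (P : Measure Ω) [IsProbabilityMeasure P]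
    {b n : ℕ} (R : (ℕ → Fin b → ℝ) → Fin n → ℝ) (hR : Measurable R)
    (ε ε' : ℤ → Ω → Fin b → ℝ) (hε : LagWindow.IsIIDPair P ε ε')
    (p : ℝ) (hp : 2 ≤ p)
    (hmean : ∀ i, ∫ ω, LagWindow.causalProcess R ε 0 ω i ∂P = 0)
    (hmoment : LagWindow.vecNorm P p (LagWindow.causalProcess R ε 0) < ∞)
    (hdep : LagWindow.cumDep P R ε ε' 0 p < ∞)
    (K : ℝ → ℝ) (hK : LagWindow.IsLagKernel K)
    (B : ℕ → ℝ) (hBpos : ∀ T : ℕ, 1 ≤ T → 0 < B T)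
    (hB : Tendsto (fun T : ℕ => 1 / B T + B T / (T : ℝ)) atTop (𝓝 0))
    (i j : Fin n) :
    (Summable fun u : ℤ => |LagWindow.autocov P (LagWindow.causalProcess R ε) i j u|) ∧
    Tendsto (fun T : ℕ => ⨆ lam : ℝ,
        eLpNorm (fun ω =>
          LagWindow.specEstimate K (B T) (LagWindow.causalProcess R ε) T i j lam ω
            - LagWindow.specDensity P (LagWindow.causalProcess R ε) i j lam)
          (ENNReal.ofReal (p / 2)) P)
      atTop (𝓝 0) := by
  have : IsProbabilityMeasure (P.map (ε 0)) :=
    Measure.isProbabilityMeasure_map (hε.measurable 0).aemeasurable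
  obtain ⟨κ, hκ⟩ := hK.exists_isFourierKernel
  have hf := hε.memLp_coordinate hR (by linarith) hmoment
  have hf0 := fun i => hε.integral_coordinate hR (hmean i)
  have hfs := fun i => ((hε.innovSum_le hR (by linarith) (hf i)).trans_lt hdep).ne
  have hB1 : Tendsto (fun T : ℕ => 1 / B T) atTop (𝓝 0) := by
    refine squeeze_zero' ?_ ?_ hB
    · filter_upwards [eventually_ge_atTop 1] with T hT
      exact (one_div_pos.2 (hBpos T hT)).le
    · filter_upwards [eventually_ge_atTop 1] with T hT
      exact le_add_of_nonneg_right (div_nonneg (hBpos T hT).le T.cast_nonneg)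
  have hB2 : Tendsto (fun T : ℕ => B T / (T : ℝ)) atTop (𝓝 0) := by
    refine squeeze_zero' ?_ ?_ hB
    · filter_upwards [eventually_ge_atTop 1] with T hT
      exact div_nonneg (hBpos T hT).le T.cast_nonneg
    · filter_upwards [eventually_ge_atTop 1] with T hT
      exact le_add_of_nonneg_left (one_div_pos.2 (hBpos T hT)).le
  obtain ⟨hsum, hlimit⟩ := LagWindow.summable_and_tsum_eq_limitForm hp (hf i) (hf j) (hfs i) (hfs j)
    (γ := fun u => (LagWindow.autocov P (LagWindow.causalProcess R ε) i j u : ℂ)) fun u => by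
      have hu : u = (u.toNat : ℤ) - (-u).toNat := by omega
      have h := hε.autocov_eq hR i j u.toNat (-u).toNat
      rw [LagWindow.integral_shift_mul_shift_eq_tsum hp (hf i) (hf j) (hf0 i) (hf0 j) (hfs i)
        (hfs j), ← hu] at h
      exact h
  refine ⟨by simpa only [Complex.norm_real, Real.norm_eq_abs] using hsum, ?_⟩
  refine (LagWindow.tendsto_iSup_quad_sub_limitForm hp hκ (hf i) (hf j) (hf0 i) (hf0 j) (hfs i)
    (hfs j) hBpos hB1 hB2).congr fun T => iSup_congr fun lam => ?_
  refine (eLpNorm_comp_measurePreserving ((LagWindow.aestronglyMeasurable_quad (hf i).1 (hf j).1 _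
    _).sub aestronglyMeasurable_const) (hε.measurePreserving_history T)).symm.trans ?_
  refine congrArg (fun F => eLpNorm F (ENNReal.ofReal (p / 2)) P) (funext fun ω => ?_)
  rw [LagWindow.specEstimate_eq_quad, LagWindow.specDensity, hlimit]
  rfl
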